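/- Notation. $\mathbb T=\mathbb R/\mathbb Z$ with Lebesgue measure $\lambda$, and $\|\cdot\|$ is the distance to $0$ in $\mathbb T$. For $\alpha\in\mathbb R\setminus\mathbb Q$, $1=q_0<q_1<q_2<\cdots$ are the denominators of the best rational approximations of $\alpha$: $\|q_s\alpha\|<\|k\alpha\|$ for all $0<k<q_{s+1}$, $k\ne q_s$. Singularities. Let $h$ be a positive $C^2$ function on $(0,1)=\mathbb T\setminus\{0\}$, decreasing, with $h'$ increasing and $\lim_{x\to0^+}h(x)=+\infty$. A function $f\in C^2(\mathbb T\setminus\{a_1,\dots,a_k\})$, with $a_1,\dots,a_k\in\mathbb T$ distinct, has singularities of type $h$ at $\{a_1,\dots,a_k\}$, with coefficients $A_i,B_i\ge 0$, if for all $i$ $$\lim_{x\to a_i^+}\frac{f'(x)}{h'(x-a_i)}=A_i,\qquad \lim_{x\to a_i^-}\frac{f'(x)}{h'(a_i-x)}=-B_i .$$ The set $\{a_1,\dots,a_k\}$ is badly approximable by $\alpha$ with constant $C>1$ if for all $x\in\mathbb T$ and $s\in\mathbb N$ there is at most one $j\in\{0,\dots,q_s-1\}$ with $x+j\alpha\in\bigcup_{i=1}^k\big[a_i-\tfrac1{2Cq_s},\,a_i+\tfrac1{2Cq_s}\big]$.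 Special flow. For $f:\mathbb T\to(0,\infty)$ integrable and $R_\alpha x=x+\alpha$, let $f^{(n)}$, $n\in\mathbb Z$, be the Birkhoff sums: $f^{(n)}=\sum_{j=0}^{n-1}f\circ R_\alpha^j$ for $n\ge0$ and $f^{(n)}=-\sum_{j=n}^{-1}f\circ R_\alpha^{j}$ for $n<0$. On $\mathbb T^f=\{(x,s): 0\le s<f(x)\}$, with the metric $d((x,s),(x',s'))=\|x-x'\|+|s-s'|$ and the normalized restriction of $\lambda\otimes\mathrm{Lebesgue}$, the special flow over $R_\alpha$ under $f$ is $T^f_t(x,s)=(x+n\alpha,\;t+s-f^{(n)}(x))$, where $n$ is the integer with $f^{(n)}(x)\le t+s<f^{(n+1)}(x)$. SWR-property. Let $(T_t)_{t\in\mathbb R}$ be an ergodic (measurable, measure-preserving) flow of a probability space $(X,\mu)$ carrying a metric $d$. For $t_0>0$ and a compact $P\subset\mathbb R\setminus\{0\}$, the flow has the switchable $R(t_0,P)$-property if for every $\varepsilon>0$ there is $\kappa>0$ such that for every $N\in\mathbb N$ there are $\delta>0$ and a measurable set $Z$ with $\mu(Z)>1-\varepsilon$ such that for all $x,y\in Z$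 with $d(x,y)<\delta$ and $x$ not in the orbit of $y$ there are integers $M,L>N$ with $L/M\ge\kappa$ and $p\in P$ for which $$\tfrac1L\big|\{n\in[M,M+L]\cap\mathbb Z: d(T_{nt_0}x,T_{nt_0+p}y)<\varepsilon\}\big|>1-\varepsilon$$ or $$\tfrac1L\big|\{n\in[M,M+L]\cap\mathbb Z: d(T_{-nt_0}x,T_{-nt_0+p}y)<\varepsilon\}\big|>1-\varepsilon .$$ The flow has the SWR-property if, for some compact $P\subset\mathbb R\setminus\{0\}$, the set of $t_0>0$ for which it has the switchable $R(t_0,P)$-property is uncountable. Theorem. Let $\alpha\in\mathbb R\setminus\mathbb Q$, and let $f\in C^2(\mathbb T\setminus\{a_1,\dots,a_k\})$ be positive and integrable (with arbitrary positive values at the points $a_i$), with singularities of type $h$ at $\{a_1,\dots,a_k\}$, where $\{a_1,\dots,a_k\}$ is badly approximable by $\alpha$ with constant $C>1$. Assume that $\sum_{i=1}^kA_i\ne\sum_{i=1}^kB_i$ and that there are a constant $m_0>0$ and a sequence $(x_s)$ such that $0<x_s<\frac1{q_s}$ for every $s\in\mathbb N$ and 1. $\displaystyle\lim_{s\to\infty}\frac{h'\big(\frac{x_s}{4C}\big)}{q_s\,h\big(\frac1{2q_s}\big)}=0$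 and $\displaystyle\lim_{s\to\infty}x_sq_s\,h\big(\tfrac1{2q_s}\big)=+\infty$; 2. $\displaystyle\sum_{s\notin K_\alpha}q_sx_s<+\infty$, where $K_\alpha:=\{s\in\mathbb N: q_{s+1}<\tfrac1{x_s}\}$; 3. $h\big(\frac1{2q_s}\big)/h\big(\frac1{2q_{s+1}}\big)>m_0$ for every $s\in\mathbb N$. Then the special flow $(T^f_t)_{t\in\mathbb R}$ over $R_\alpha$ under $f$ is an ergodic flow with the SWR-property. -/

import Mathlib

open Filter Topology MeasureTheory Set

/-! ### Flows and the switchable weak Ratner property -/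

section Flow

variable {X : Type*} [MetricSpace X] [MeasurableSpace X]

/-- `(T_t)` is a measurable ergodic flow of the probability space `(X, μ)`. -/
structure IsErgodicFlow (T : ℝ → X → X) (μ : Measure X) : Prop where
  prob : IsProbabilityMeasure μ
  measurable : Measurable fun p : ℝ × X => T p.1 p.2
  map_zero : ∀ x, T 0 x = x
  map_add : ∀ s t x, T (s + t) x = T s (T t x)
  preserving : ∀ t, MeasurePreserving (T t) μ μ
  ergodic : ∀ A, MeasurableSet A → (∀ t, T t ⁻¹' A = A) → μ A = 0 ∨ μ A = 1

open Classical in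
/-- The frequency `(1/L) · #{n ∈ [M, M+L] : d(T_{nτ} x, T_{nτ+p} y) < ε}`, where `n` runs over
integers. -/
noncomputable def closeFreq (T : ℝ → X → X) (τ p ε : ℝ) (x y : X) (M L : ℕ) : ℝ :=
  (1 / (L : ℝ)) *
    (((Finset.Icc M (M + L)).filter fun n : ℕ =>
      dist (T ((n : ℝ) * τ) x) (T ((n : ℝ) * τ + p) y) < ε).card : ℝ)

/-- The switchable `R(t₀, P)`-property: `κ` depends on `ε` only, while `δ` and `Z` depend on `ε`
and `N`; the time direction in the last line may depend on the pair `x, y`. -/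
def SwitchableR (T : ℝ → X → X) (μ : Measure X) (t₀ : ℝ) (P : Set ℝ) : Prop :=
  ∀ ε : ℝ, 0 < ε → ∃ κ : ℝ, 0 < κ ∧ ∀ N : ℕ, ∃ δ : ℝ, 0 < δ ∧
    ∃ Z : Set X, MeasurableSet Z ∧ 1 - ε < μ.real Z ∧
      ∀ x ∈ Z, ∀ y ∈ Z, dist x y < δ → (∀ t : ℝ, x ≠ T t y) →
        ∃ M L : ℕ, N < M ∧ N < L ∧ κ ≤ (L : ℝ) / (M : ℝ) ∧ ∃ p ∈ P,
          1 - ε < closeFreq T t₀ p ε x y M L ∨ 1 - ε < closeFreq T (-t₀) p ε x y M L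

/-- The SWR-property (switchable weak Ratner property) of an ergodic flow. -/
def HasSWR (T : ℝ → X → X) (μ : Measure X) : Prop :=
  IsErgodicFlow T μ ∧
    ∃ P : Set ℝ, IsCompact P ∧ (0 : ℝ) ∉ P ∧
      ¬ {t₀ : ℝ | 0 < t₀ ∧ SwitchableR T μ t₀ P}.Countable

end Flow

/-! ### Special flows -/

section SpecialFlow

variable {X : Type*}

/-- The Birkhoff cocycle `f^{(n)}(x)`, `n ∈ ℤ`: it is `f(x) + ⋯ + f(T^{n-1}x)` for `n > 0`, it is
`0` for `n = 0`, and it is `-(f(T^n x) + ⋯ + f(T^{-1}x))` for `n < 0`. -/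
def birkhoffCocycle (T : Equiv.Perm X) (f : X → ℝ) : ℤ → X → ℝ
  | Int.ofNat n, x => ∑ i ∈ Finset.range n, f ((T ^ (i : ℤ)) x)
  | Int.negSucc n, x => -∑ i ∈ Finset.range (n + 1), f ((T ^ (-((i : ℤ) + 1))) x)

theorem birkhoffCocycle_add_one (T : Equiv.Perm X) (f : X → ℝ) (n : ℤ) (x : X) :
    birkhoffCocycle T f (n + 1) x = birkhoffCocycle T f n x + f ((T ^ n) x) := by
  match n with
  | Int.ofNat n =>
    change birkhoffCocycle T f (Int.ofNat (n + 1)) x = _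
    simp [birkhoffCocycle, Finset.sum_range_succ]
  | Int.negSucc 0 =>
    change birkhoffCocycle T f (Int.ofNat 0) x = _
    simp [birkhoffCocycle]
  | Int.negSucc (n + 1) =>
    have h : Int.negSucc (n + 1) + 1 = Int.negSucc n := by omega
    have h2 : (-(((n + 1 : ℕ) : ℤ) + 1)) = Int.negSucc (n + 1) := by omega
    rw [h]
    simp only [birkhoffCocycle]
    rw [Finset.sum_range_succ _ (n + 1), h2]
    ring

/-- The phase space `X^f = {(x, s) : 0 ≤ s < f(x)}`, a fundamental domain of the identification
`(x, s + f(x)) ∼ (T x, s)`. -/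
@[ext]
structure SpecialSpace (f : X → ℝ) where
  base : X
  height : ℝ
  height_nonneg : 0 ≤ height
  height_lt : height < f base

/-- The inclusion of `X^f` in `X × ℝ`. -/
def SpecialSpace.toProd {f : X → ℝ} (p : SpecialSpace f) : X × ℝ := (p.base, p.height)

/-- The metric `d^f((x,s),(x',s')) = d(x,x') + |s - s'|`. -/
instance SpecialSpace.instMetricSpace [MetricSpace X] (f : X → ℝ) :
    MetricSpace (SpecialSpace f) where
  dist p q := dist p.base q.base + |p.height - q.height|
  dist_self p := by simp
  dist_comm p q := by rw [dist_comm, abs_sub_comm]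
  dist_triangle p q r := by
    have h1 := dist_triangle p.base q.base r.base
    have h2 := abs_sub_le p.height q.height r.height
    linarith
  eq_of_dist_eq_zero := by
    intro p q h
    have h1 : 0 ≤ dist p.base q.base := dist_nonneg
    have h2 : 0 ≤ |p.height - q.height| := abs_nonneg _
    have h3 : dist p.base q.base + |p.height - q.height| = 0 := h
    refine SpecialSpace.ext (dist_eq_zero.mp (by linarith)) ?_
    exact sub_eq_zero.mp (abs_eq_zero.mp (by linarith))

/-- The trace on `X^f` of the product `σ`-algebra. -/
instance SpecialSpace.instMeasurableSpace [MeasurableSpace X] (f : X → ℝ) :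
    MeasurableSpace (SpecialSpace f) :=
  MeasurableSpace.comap SpecialSpace.toProd inferInstance

/-- The restriction of `μ ⊗ Lebesgue` to `X^f`, not yet normalized. -/
noncomputable def specialMeasureAux [MeasurableSpace X] (μ : Measure X) (f : X → ℝ) :
    Measure (SpecialSpace f) :=
  (μ.prod (volume : Measure ℝ)).comap SpecialSpace.toProd

/-- The normalized restriction `μ^f` of `μ ⊗ Lebesgue` to `X^f`. -/
noncomputable def specialMeasure [MeasurableSpace X] (μ : Measure X) (f : X → ℝ) :
    Measure (SpecialSpace f) :=
  (specialMeasureAux μ f Set.univ)⁻¹ • specialMeasureAux μ f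

open Classical in
/-- The special flow `T_t^f(x, s) = (T^n x, t + s - f^{(n)}(x))`, where `n` is the integer with
`f^{(n)}(x) ≤ t + s < f^{(n+1)}(x)`. For `f > 0` there is at most one such `n`; there is one
as soon as `f^{(n)}(x) → ±∞` when `n → ±∞` (otherwise the point is left fixed by convention). -/
noncomputable def specialFlow (T : Equiv.Perm X) (f : X → ℝ) (t : ℝ) (p : SpecialSpace f) :
    SpecialSpace f :=
  if h : ∃ n : ℤ, birkhoffCocycle T f n p.base ≤ t + p.height ∧
      t + p.height < birkhoffCocycle T f (n + 1) p.base then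
    { base := (T ^ h.choose) p.base
      height := t + p.height - birkhoffCocycle T f h.choose p.base
      height_nonneg := sub_nonneg.mpr h.choose_spec.1
      height_lt := by
        have h2 := h.choose_spec.2
        rw [birkhoffCocycle_add_one] at h2
        linarith }
  else p

end SpecialFlow

/-! ### Rotations, best approximations and singularities -/

/-- The rotation `R_α x = x + α` of the circle `ℝ/ℤ`. -/
noncomputable def circleRotation (α : ℝ) : Equiv.Perm UnitAddCircle :=
  Equiv.addRight (α : UnitAddCircle)

/-- The distance `‖kα‖` of `kα` to the nearest integer. -/
noncomputable def distInt (α : ℝ) (k : ℕ) : ℝ := ‖(((k : ℝ) * α : ℝ) : UnitAddCircle)‖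

/-- The denominators `q_0 = 1 < q_1 < q_2 < ⋯` of the best rational approximations of `α`:
`q_{s+1}` is the least `k > q_s` with `‖kα‖ < ‖q_s α‖`. -/
noncomputable def bestDenom (α : ℝ) : ℕ → ℕ
  | 0 => 1
  | s + 1 => sInf {k : ℕ | bestDenom α s < k ∧ distInt α k < distInt α (bestDenom α s)}

theorem distInt_pos {α : ℝ} (hα : Irrational α) {k : ℕ} (hk : 0 < k) : 0 < distInt α k := by
  rw [distInt, UnitAddCircle.norm_eq, abs_pos, sub_ne_zero]
  exact (hα.natCast_mul hk.ne').ne_int _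

theorem exists_distInt_lt (α : ℝ) {ε : ℝ} (hε : 0 < ε) : ∃ k : ℕ, 0 < k ∧ distInt α k < ε := by
  obtain ⟨n, hn⟩ := exists_nat_one_div_lt hε
  obtain ⟨k, hk, -, hk2⟩ := Real.exists_nat_abs_mul_sub_round_le α (Nat.succ_pos n)
  refine ⟨k, hk, ?_⟩
  rw [distInt, UnitAddCircle.norm_eq]
  refine hk2.trans_lt (lt_of_le_of_lt ?_ hn)
  push_cast
  exact one_div_le_one_div_of_le (by positivity) (by linarith)

/-- For irrational `α` the `bestDenom α s` are strictly increasing, with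
`‖q_s α‖ < ‖kα‖` for all `0 < k < q_s` and `‖q_{s+1} α‖ < ‖q_s α‖`. -/
theorem bestDenom_spec {α : ℝ} (hα : Irrational α) (s : ℕ) :
    0 < bestDenom α s ∧
    (∀ k, 0 < k → k < bestDenom α s → distInt α (bestDenom α s) < distInt α k) ∧
    bestDenom α s < bestDenom α (s + 1) ∧
    distInt α (bestDenom α (s + 1)) < distInt α (bestDenom α s) := by
  have key : ∀ s, 0 < bestDenom α s →
      (∀ k, 0 < k → k < bestDenom α s → distInt α (bestDenom α s) < distInt α k) →
      bestDenom α s < bestDenom α (s + 1) ∧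
      distInt α (bestDenom α (s + 1)) < distInt α (bestDenom α s) := by
    intro s h0 h1
    have hne : {k : ℕ | bestDenom α s < k ∧
        distInt α k < distInt α (bestDenom α s)}.Nonempty := by
      obtain ⟨k, hk, hk2⟩ := exists_distInt_lt α (distInt_pos hα h0)
      refine ⟨k, ?_, hk2⟩
      rcases lt_trichotomy k (bestDenom α s) with h | h | h
      · exact absurd (h1 k hk h) (not_lt.mpr hk2.le)
      · rw [h] at hk2; exact absurd hk2 (lt_irrefl _)
      · exact h
    have hm := Nat.sInf_mem hne
    rw [bestDenom]
    exact hm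
  have main : ∀ s, 0 < bestDenom α s ∧
      ∀ k, 0 < k → k < bestDenom α s → distInt α (bestDenom α s) < distInt α k := by
    intro s
    induction s with
    | zero =>
      refine ⟨by simp [bestDenom], fun k hk hk2 => ?_⟩
      simp only [bestDenom] at hk2
      omega
    | succ s ih =>
      obtain ⟨hlt, hd⟩ := key s ih.1 ih.2
      refine ⟨ih.1.trans hlt, fun k hk hk2 => ?_⟩
      rcases lt_trichotomy k (bestDenom α s) with h | h | h
      · exact hd.trans (ih.2 k hk h)
      · rw [h]; exact hd
      · have hk3 : k ∉ {k : ℕ | bestDenom α s < k ∧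
            distInt α k < distInt α (bestDenom α s)} := by
          rw [bestDenom] at hk2
          exact Nat.notMem_of_lt_sInf hk2
        have hge : distInt α (bestDenom α s) ≤ distInt α k := by
          by_contra hc
          exact hk3 ⟨h, not_le.mp hc⟩
        exact hd.trans_le hge
  exact ⟨(main s).1, (main s).2, key s (main s).1 (main s).2⟩

/-- `h` is a positive `C²` function on `(0,1) = 𝕋 ∖ {0}`, decreasing, with increasing derivative,
and with `h(x) → +∞` as `x → 0⁺`. -/
structure IsSingularityProfile (h : ℝ → ℝ) : Prop where
  pos : ∀ x ∈ Ioo (0 : ℝ) 1, 0 < h x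
  contDiffOn : ContDiffOn ℝ 2 h (Ioo 0 1)
  antitoneOn : AntitoneOn h (Ioo 0 1)
  monotoneOn_deriv : MonotoneOn (deriv h) (Ioo 0 1)
  tendsto : Tendsto h (𝓝[>] 0) atTop

/-- The derivative of a function on the circle `ℝ/ℤ`. -/
noncomputable def circleDeriv (f : UnitAddCircle → ℝ) (x : UnitAddCircle) : ℝ :=
  deriv (fun t : ℝ => f (x + (t : UnitAddCircle))) 0

/-- `f ∈ C²(𝕋 ∖ {a_1, …, a_k})`. -/
def IsC2Off {k : ℕ} (f : UnitAddCircle → ℝ) (a : Fin k → UnitAddCircle) : Prop :=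
  ContDiffOn ℝ 2 (fun t : ℝ => f (t : UnitAddCircle)) {t : ℝ | (t : UnitAddCircle) ∉ range a}

/-- `f` has singularities of type `h` at the distinct points `a_1, …, a_k`, with coefficients
`A_i, B_i ≥ 0`: `f'(x)/h'(x - a_i) → A_i` as `x → a_i⁺` and `f'(x)/h'(a_i - x) → -B_i` as
`x → a_i⁻`; below `x = a_i + t`, resp. `x = a_i - t`, with `t → 0⁺`. -/
structure HasSingularitiesOfType {k : ℕ} (f : UnitAddCircle → ℝ) (a : Fin k → UnitAddCircle)
    (h : ℝ → ℝ) (A B : Fin k → ℝ) : Prop where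
  profile : IsSingularityProfile h
  injective : Function.Injective a
  contDiff : IsC2Off f a
  nonneg_right : ∀ i, 0 ≤ A i
  nonneg_left : ∀ i, 0 ≤ B i
  right : ∀ i, Tendsto (fun t : ℝ => circleDeriv f (a i + (t : UnitAddCircle)) / deriv h t)
    (𝓝[>] 0) (𝓝 (A i))
  left : ∀ i, Tendsto (fun t : ℝ => circleDeriv f (a i - (t : UnitAddCircle)) / deriv h t)
    (𝓝[>] 0) (𝓝 (-B i))

/-- `{a_1, …, a_k}` is badly approximable by `α` with constant `C`: for all `x ∈ 𝕋` and `s`, at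
most one `j ∈ {0, …, q_s - 1}` is such that `x + jα` lies in one of the arcs
`[a_i - 1/(2Cq_s), a_i + 1/(2Cq_s)]`. -/
def BadlyApproximableBy {k : ℕ} (α : ℝ) (a : Fin k → UnitAddCircle) (C : ℝ) : Prop :=
  ∀ (x : UnitAddCircle) (s : ℕ),
    {j : ℕ | j < bestDenom α s ∧ ∃ i : Fin k,
      ‖x + (((j : ℝ) * α : ℝ) : UnitAddCircle) - a i‖
        ≤ 1 / (2 * C * (bestDenom α s : ℝ))}.Subsingleton

/-! Two points of the special flow on different orbits have different base points z and y. Their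
relative position along the flow is governed by the drift f^(n)(z) − f^(n)(y). It suffices to find a
long window of indices n, of length comparable to its starting time, on which the drift is almost
constant with absolute value in a fixed interval [c, V], c > 0. Shifting the time of the second
orbit by minus this drift then makes the two orbits close, and P = {c ≤ |p| ≤ V} is compact and
avoids 0.

The drift comes from the asymmetry Γ = ∑A_i − ∑B_i. Write H_s = q_s h(1/(2q_s)). An orbit block of
length q_s has one point in each of q_s overlapping arcs of length 2/q_s, so its sum of −h' is a
telescoping sum of values of h, equal to H_s up to an error controlled by the closest approach to
the singularity (`abs_sum_rotation_sub_le`). Right and left branches enter with opposite signs.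
Hence the sum of f' over a block away from the singularities is −ΓH_s up to a small proportion of
H_s, and the sum of |f'| is O(H_s) (`exists_bound`, `block_bounds`). If y = z + d, one block
therefore changes the drift by about ΓH_s d, with variation O(H_s|d|) (`block_difference`), and
about 1/(H_s|d|) blocks produce a drift of order 1. Cutting this stretch into J windows and applying
the pigeonhole principle to the variation yields a window where the drift is stable and bounded away
from 0 (`exists_stable_window`).

All blocks must avoid the singularities, for a time proportional to q_{τ+1}. Bad approximability
provides this in at least one direction of time, as long as z is outside a set made small by the
summability in condition 2 (`eventually_forward_or_backward_far`, `tendsto_measure_compl_farSet`).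
This is why the property is switchable. Condition 1 makes the allowed distance x_τ/(4C) both
harmless for the block estimate and larger than ‖z − y‖. Condition 3 makes neighbouring scales
comparable, so that blocks of length q_σ can be chosen much shorter than q_{τ+1} (`exists_scales`).
Together these give `exists_drift_window`.

To pass from indices to times, the flow point must keep away from the bottom and the top of its
fibre, since otherwise the shifted point may lie over another base point. Times spent near the
boundary are rare at every scale, by the weak maximal inequality, but must also be rare inside the
selected window. For this reason their counts are fed into the pigeonhole argument as additional
weights (`exists_closeFreq_window`, `switchableR_specialFlow`). -/

open scoped ENNReal

/-! ### The weak maximal inequality -/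

section Maximal

variable {X : Type*}

/-- The points having an orbit segment of length at most `N` along which the mean of `g` is at
least `c`. -/
def largeMeanSet (T : X → X) (g : X → ℝ≥0∞) (c : ℝ≥0∞) (N : ℕ) : Set X :=
  {x | ∃ n : ℕ, 1 ≤ n ∧ n ≤ N ∧ c * n ≤ ∑ k ∈ Finset.range n, g (T^[k] x)}

/-- Greedy covering of the orbit: at a point of the set, jump over the segment on which the mean is
at least c; at any other point, move one step. The last jump may overshoot K by at most N. -/
theorem sum_indicator_largeMeanSet_le (T : X → X) (g : X → ℝ≥0∞) (c : ℝ≥0∞) (N : ℕ) :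
    ∀ (K : ℕ) (x : X),
      c * ∑ k ∈ Finset.range K, (largeMeanSet T g c N).indicator 1 (T^[k] x) ≤
        ∑ k ∈ Finset.range (K + N), g (T^[k] x) := by
  intro K
  induction K using Nat.strong_induction_on with
  | _ K ih =>
  intro x
  rcases Nat.eq_zero_or_pos K with rfl | hK
  · simp
  by_cases hx : x ∈ largeMeanSet T g c N
  · obtain ⟨n, hn1, hnN, hn⟩ := hx
    have hle : ∀ m, ∀ y : X, ∑ k ∈ Finset.range m, (largeMeanSet T g c N).indicator 1 (T^[k] y) ≤
        (m : ℝ≥0∞) := by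
      intro m y
      calc ∑ k ∈ Finset.range m, (largeMeanSet T g c N).indicator 1 (T^[k] y)
          ≤ ∑ k ∈ Finset.range m, (1 : ℝ≥0∞) :=
            Finset.sum_le_sum fun k _ => Set.indicator_le_self' (by simp) _
        _ = m := by simp
    by_cases hnK : K ≤ n
    · calc c * ∑ k ∈ Finset.range K, (largeMeanSet T g c N).indicator 1 (T^[k] x)
          ≤ c * n := by
            gcongr
            exact (hle K x).trans (by exact_mod_cast hnK)
        _ ≤ _ := hn
        _ ≤ _ := Finset.sum_le_sum_of_subset (Finset.range_mono (by omega))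
    · push Not at hnK
      obtain ⟨m, rfl⟩ := Nat.exists_eq_add_of_lt hnK
      have h1 := ih (m + 1) (by omega) (T^[n] x)
      rw [add_assoc n m 1, Finset.sum_range_add _ n, add_assoc n, Finset.sum_range_add _ n, mul_add]
      have h2 : c * ∑ k ∈ Finset.range n, (largeMeanSet T g c N).indicator 1 (T^[k] x) ≤ c * n := by
        have := hle n x
        gcongr
      simp only [← Function.iterate_add_apply, add_comm _ n] at h1
      exact add_le_add (h2.trans hn) h1
  · obtain ⟨m, rfl⟩ := Nat.exists_eq_add_of_le' hK
    have h1 := ih m (by omega) (T x)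
    rw [Finset.sum_range_succ', add_right_comm, Finset.sum_range_succ']
    simp only [Function.iterate_zero, id, Set.indicator_of_notMem hx, add_zero]
    simp only [← Function.iterate_succ_apply] at h1
    exact h1.trans le_self_add

variable [MeasurableSpace X]

theorem measurableSet_largeMeanSet {T : X → X} (hT : Measurable T) {g : X → ℝ≥0∞}
    (hg : Measurable g) (c : ℝ≥0∞) (N : ℕ) : MeasurableSet (largeMeanSet T g c N) := by
  have : largeMeanSet T g c N = ⋃ n : ℕ, ⋃ _ : 1 ≤ n, ⋃ _ : n ≤ N,
      {x | c * n ≤ ∑ k ∈ Finset.range n, g (T^[k] x)} := by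
    ext x
    simp only [largeMeanSet, mem_ofPred_eq, mem_iUnion, exists_prop]
  rw [this]
  refine MeasurableSet.iUnion fun n => MeasurableSet.iUnion fun _ => MeasurableSet.iUnion fun _ =>
    measurableSet_le measurable_const ?_
  exact Finset.measurable_sum _ fun k _ => hg.comp (hT.iterate k)

/-- Integrating the covering estimate over an orbit of length K gives K a ≤ (K + N) I; the overshoot
N disappears as K → ∞. -/
theorem mul_measure_largeMeanSet_le {μ : Measure X} {T : X → X} (hT : MeasurePreserving T μ μ)
    {g : X → ℝ≥0∞} (hg : Measurable g) (c : ℝ≥0∞) (N : ℕ) :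
    c * μ (largeMeanSet T g c N) ≤ ∫⁻ x, g x ∂μ := by
  set I := ∫⁻ x, g x ∂μ with hI
  set a := c * μ (largeMeanSet T g c N) with ha
  have hE := measurableSet_largeMeanSet hT.measurable hg c N
  have key : ∀ K : ℕ, K * a ≤ ((K + N : ℕ) : ℝ≥0∞) * I := by
    intro K
    have h1 := lintegral_mono (μ := μ) (sum_indicator_largeMeanSet_le T g c N K)
    have hind : ∀ k : ℕ, Measurable fun x => (largeMeanSet T g c N).indicator
        (1 : X → ℝ≥0∞) (T^[k] x) := fun k =>
      (measurable_one.indicator hE).comp (hT.measurable.iterate k)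
    have hgk : ∀ k : ℕ, Measurable fun x => g (T^[k] x) := fun k =>
      hg.comp (hT.measurable.iterate k)
    rw [lintegral_const_mul _ (Finset.measurable_sum _ fun k _ => hind k),
      lintegral_finsetSum _ (fun k _ => hind k), lintegral_finsetSum _ (fun k _ => hgk k)] at h1
    have h2 : ∀ k, ∫⁻ x, g (T^[k] x) ∂μ = I := fun k =>
      (hT.iterate k).lintegral_comp hg
    have h3 : ∀ k, ∫⁻ x, (largeMeanSet T g c N).indicator 1 (T^[k] x) ∂μ
        = μ (largeMeanSet T g c N) := fun k => by
      rw [(hT.iterate k).lintegral_comp (measurable_one.indicator hE), lintegral_indicator_one hE]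
    simp only [h2, h3, Finset.sum_const, Finset.card_range, nsmul_eq_mul] at h1
    rw [ha]
    calc (K : ℝ≥0∞) * (c * μ (largeMeanSet T g c N))
        = c * (K * μ (largeMeanSet T g c N)) := by ring
      _ ≤ _ := h1
  by_contra hlt
  push Not at hlt
  have hItop : I ≠ ∞ := ne_top_of_lt hlt
  have hatop : a ≠ ∞ := by
    intro h
    have := key 1
    rw [h] at this
    simp only [Nat.cast_one, one_mul, top_le_iff] at this
    exact ENNReal.mul_ne_top (ENNReal.natCast_ne_top _) hItop this
  clear_value I a
  lift I to NNReal using hItop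
  lift a to NNReal using hatop
  have key' : ∀ K : ℕ, (K : ℝ) * (a : ℝ) ≤ ((K + N : ℕ) : ℝ) * (I : ℝ) := fun K => by
    exact_mod_cast key K
  have hlt' : (I : ℝ) < (a : ℝ) := by exact_mod_cast hlt
  obtain ⟨K, hK⟩ := exists_nat_gt (N * (I : ℝ) / ((a : ℝ) - I))
  rw [div_lt_iff₀ (by linarith)] at hK
  have := key' K
  push_cast at this
  nlinarith

/-- The weak maximal inequality for a measure preserving map. -/
theorem mul_measure_exists_le_sum_le {μ : Measure X} {T : X → X} (hT : MeasurePreserving T μ μ)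
    {g : X → ℝ≥0∞} (hg : Measurable g) {c : ℝ≥0∞} :
    c * μ {x | ∃ n : ℕ, 1 ≤ n ∧ c * n ≤ ∑ k ∈ Finset.range n, g (T^[k] x)} ≤ ∫⁻ x, g x ∂μ := by
  have : {x | ∃ n : ℕ, 1 ≤ n ∧ c * n ≤ ∑ k ∈ Finset.range n, g (T^[k] x)} =
      ⋃ N, largeMeanSet T g c N := by
    ext x
    simp only [mem_ofPred_eq, mem_iUnion, largeMeanSet]
    exact ⟨fun ⟨n, h1, h2⟩ => ⟨n, n, h1, le_rfl, h2⟩, fun ⟨_, n, h1, _, h2⟩ => ⟨n, h1, h2⟩⟩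
  have hmono : Monotone (largeMeanSet T g c) := fun N M h x ⟨n, h1, h2, h3⟩ =>
    ⟨n, h1, h2.trans h, h3⟩
  rw [this, hmono.measure_iUnion, ENNReal.mul_iSup]
  exact iSup_le fun N => mul_measure_largeMeanSet_le hT hg c N

theorem measurableSet_exists_le_sum {T : X → X} (hT : Measurable T) {g : X → ℝ≥0∞}
    (hg : Measurable g) (c : ℝ≥0∞) :
    MeasurableSet {x | ∃ n : ℕ, 1 ≤ n ∧ c * n ≤ ∑ k ∈ Finset.range n, g (T^[k] x)} := by
  have : {x | ∃ n : ℕ, 1 ≤ n ∧ c * n ≤ ∑ k ∈ Finset.range n, g (T^[k] x)} =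
      ⋃ N, largeMeanSet T g c N := by
    ext x
    simp only [mem_ofPred_eq, mem_iUnion, largeMeanSet]
    exact ⟨fun ⟨n, h1, h2⟩ => ⟨n, n, h1, le_rfl, h2⟩, fun ⟨_, n, h1, _, h2⟩ => ⟨n, h1, h2⟩⟩
  rw [this]
  exact MeasurableSet.iUnion fun N => measurableSet_largeMeanSet hT hg c N

end Maximal

/-! ### Special flows -/

section SpecialFlow

variable {X : Type*} {T : Equiv.Perm X} {f : X → ℝ}

theorem birkhoffCocycle_zero (T : Equiv.Perm X) (f : X → ℝ) (x : X) :
    birkhoffCocycle T f 0 x = 0 := by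
  change birkhoffCocycle T f (Int.ofNat 0) x = 0
  simp [birkhoffCocycle]

theorem birkhoffCocycle_natCast (T : Equiv.Perm X) (f : X → ℝ) (n : ℕ) (x : X) :
    birkhoffCocycle T f n x = ∑ i ∈ Finset.range n, f ((T ^ (i : ℤ)) x) := rfl

theorem birkhoffCocycle_neg_natCast (T : Equiv.Perm X) (f : X → ℝ) (n : ℕ) (x : X) :
    birkhoffCocycle T f (-(n : ℤ)) x =
      -∑ i ∈ Finset.range n, f ((T ^ (-((i : ℤ) + 1))) x) := by
  cases n with
  | zero => simp [birkhoffCocycle_zero]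
  | succ n => rfl

theorem birkhoffCocycle_add (T : Equiv.Perm X) (f : X → ℝ) (m n : ℤ) (x : X) :
    birkhoffCocycle T f (m + n) x =
      birkhoffCocycle T f m x + birkhoffCocycle T f n ((T ^ m) x) := by
  induction n using Int.induction_on with
  | zero => simp [birkhoffCocycle_zero]
  | succ n ih =>
    rw [← add_assoc, birkhoffCocycle_add_one, ih, birkhoffCocycle_add_one, ← Equiv.Perm.mul_apply,
      ← zpow_add, add_comm (n : ℤ) m]
    ring
  | pred n ih =>
    have h1 := birkhoffCocycle_add_one T f (m + (-n - 1)) x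
    have h2 := birkhoffCocycle_add_one T f (-n - 1) ((T ^ m) x)
    rw [← Equiv.Perm.mul_apply, ← zpow_add, add_comm _ m] at h2
    rw [show m + (-(n : ℤ) - 1) + 1 = m + -n by ring, ih] at h1
    rw [show -(n : ℤ) - 1 + 1 = -n by ring] at h2
    linarith

theorem strictMono_birkhoffCocycle (hf : ∀ x, 0 < f x) (x : X) :
    StrictMono fun n : ℤ => birkhoffCocycle T f n x := by
  refine strictMono_int_of_lt_succ fun n => ?_
  rw [birkhoffCocycle_add_one]
  linarith [hf ((T ^ n) x)]

theorem birkhoffCocycle_index_unique (hf : ∀ x, 0 < f x) {x : X} {r : ℝ} {m n : ℤ}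
    (hm : birkhoffCocycle T f m x ≤ r) (hm' : r < birkhoffCocycle T f (m + 1) x)
    (hn : birkhoffCocycle T f n x ≤ r) (hn' : r < birkhoffCocycle T f (n + 1) x) : m = n := by
  have h1 : m < n + 1 := (strictMono_birkhoffCocycle (T := T) hf x).lt_iff_lt.mp (hm.trans_lt hn')
  have h2 : n < m + 1 := (strictMono_birkhoffCocycle (T := T) hf x).lt_iff_lt.mp (hn.trans_lt hm')
  omega

/-- The Birkhoff sums are unbounded in both directions. -/
def BirkhoffUnbounded (T : Equiv.Perm X) (f : X → ℝ) : Prop :=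
  ∀ x, (∀ r : ℝ, ∃ n : ℤ, r < birkhoffCocycle T f n x) ∧
    ∀ r : ℝ, ∃ n : ℤ, birkhoffCocycle T f n x ≤ r

theorem BirkhoffUnbounded.exists_index (hf : ∀ x, 0 < f x) (hu : BirkhoffUnbounded T f) (x : X)
    (r : ℝ) : ∃ n : ℤ, birkhoffCocycle T f n x ≤ r ∧ r < birkhoffCocycle T f (n + 1) x := by
  obtain ⟨b, hb⟩ := (hu x).1 r
  obtain ⟨n, hn, hmax⟩ := Int.exists_greatest_of_bdd
    (P := fun n => birkhoffCocycle T f n x ≤ r)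
    ⟨b, fun z hz => ((strictMono_birkhoffCocycle (T := T) hf x).lt_iff_lt.mp
      (hz.trans_lt hb)).le⟩ ((hu x).2 r)
  refine ⟨n, hn, ?_⟩
  by_contra hc
  have := hmax (n + 1) (not_lt.mp hc)
  omega

/-- Uniqueness of the index makes the choice in the definition of the flow immaterial: any
admissible n computes it. -/
theorem specialFlow_eq (hf : ∀ x, 0 < f x) {t : ℝ} {p : SpecialSpace f} {n : ℤ}
    (h1 : birkhoffCocycle T f n p.base ≤ t + p.height)
    (h2 : t + p.height < birkhoffCocycle T f (n + 1) p.base) :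
    (specialFlow T f t p).base = (T ^ n) p.base ∧
      (specialFlow T f t p).height = t + p.height - birkhoffCocycle T f n p.base := by
  have h : ∃ n : ℤ, birkhoffCocycle T f n p.base ≤ t + p.height ∧
      t + p.height < birkhoffCocycle T f (n + 1) p.base := ⟨n, h1, h2⟩
  have hn : h.choose = n :=
    birkhoffCocycle_index_unique hf h.choose_spec.1 h.choose_spec.2 h1 h2
  simp only [specialFlow, dif_pos h, hn, and_self]

theorem specialFlow_zero (hf : ∀ x, 0 < f x) (p : SpecialSpace f) : specialFlow T f 0 p = p := by
  obtain ⟨h1, h2⟩ := specialFlow_eq (T := T) hf (t := 0) (p := p) (n := 0)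
    (by simpa [birkhoffCocycle_zero] using p.height_nonneg)
    (by rw [birkhoffCocycle_add_one, birkhoffCocycle_zero]; simpa using p.height_lt)
  ext
  · simpa using h1
  · simpa [birkhoffCocycle_zero] using h2

theorem specialFlow_add (hf : ∀ x, 0 < f x) (hu : BirkhoffUnbounded T f) (s t : ℝ)
    (p : SpecialSpace f) : specialFlow T f (s + t) p = specialFlow T f s (specialFlow T f t p) := by
  obtain ⟨n, hn1, hn2⟩ := hu.exists_index hf p.base (t + p.height)
  obtain ⟨e1, e2⟩ := specialFlow_eq hf hn1 hn2
  set q := specialFlow T f t p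
  obtain ⟨m, hm1, hm2⟩ := hu.exists_index hf q.base (s + q.height)
  obtain ⟨d1, d2⟩ := specialFlow_eq hf hm1 hm2
  have a1 := birkhoffCocycle_add T f n m p.base
  have a2 := birkhoffCocycle_add T f n (m + 1) p.base
  rw [← e1] at a1 a2
  obtain ⟨c1, c2⟩ := specialFlow_eq (T := T) hf (t := s + t) (p := p) (n := n + m)
    (by linarith) (by rw [add_assoc n]; linarith)
  ext
  · rw [c1, d1, e1, ← Equiv.Perm.mul_apply, ← zpow_add, add_comm]
  · rw [c2, d2, e2, a1]; linarith

end SpecialFlow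

/-! ### Measurability, invariant measure and ergodicity of special flows. -/

section SpecialFlow

variable {X : Type*} {T : Equiv.Perm X} {f : X → ℝ}

theorem toProd_injective : Function.Injective (SpecialSpace.toProd (f := f)) := by
  intro p q h
  simp only [SpecialSpace.toProd, Prod.mk.injEq] at h
  exact SpecialSpace.ext h.1 h.2

theorem range_toProd :
    range (SpecialSpace.toProd (f := f)) = {z : X × ℝ | 0 ≤ z.2 ∧ z.2 < f z.1} := by
  ext z
  constructor
  · rintro ⟨p, rfl⟩
    exact ⟨p.height_nonneg, p.height_lt⟩
  · rintro ⟨h1, h2⟩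
    exact ⟨⟨z.1, z.2, h1, h2⟩, rfl⟩

/-- The index `n` with `f^{(n)}(x) ≤ t + s < f^{(n+1)}(x)`, for `p = (x, s)`. -/
def flowIndexSet (T : Equiv.Perm X) (f : X → ℝ) (t : ℝ) (n : ℤ) : Set (SpecialSpace f) :=
  {p | birkhoffCocycle T f n p.base ≤ t + p.height ∧
    t + p.height < birkhoffCocycle T f (n + 1) p.base}

/-- The cocycle identity f^(−n)(T^n x) = −f^(n)(x) shows that time −t crosses back the n fibres
crossed in time t. This matches the pieces of the two partitions in the proof of invariance. -/
theorem specialFlow_mem_flowIndexSet_neg (hf : ∀ x, 0 < f x) {t : ℝ} {n : ℤ}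
    {p : SpecialSpace f} (hp : p ∈ flowIndexSet T f t n) :
    specialFlow T f t p ∈ flowIndexSet T f (-t) (-n) := by
  obtain ⟨e1, e2⟩ := specialFlow_eq hf hp.1 hp.2
  have a1 := birkhoffCocycle_add T f n (-n) p.base
  have a2 := birkhoffCocycle_add T f n (-n + 1) p.base
  rw [← e1] at a1 a2
  rw [add_neg_cancel, birkhoffCocycle_zero] at a1
  rw [← add_assoc, add_neg_cancel, birkhoffCocycle_add_one, birkhoffCocycle_zero] at a2
  simp only [zpow_zero, Equiv.Perm.coe_one, id_eq, zero_add] at a2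
  have := p.height_nonneg
  have := p.height_lt
  constructor <;> linarith

theorem specialFlow_height_base (hf : ∀ x, 0 < f x) (p : SpecialSpace f) :
    specialFlow T f p.height ⟨p.base, 0, le_rfl, hf _⟩ = p := by
  have := p.height_nonneg
  have := p.height_lt
  obtain ⟨h1, h2⟩ := specialFlow_eq (T := T) (n := 0) (t := p.height)
    (p := ⟨p.base, 0, le_rfl, hf _⟩) hf (by simpa [birkhoffCocycle_zero])
    (by rw [birkhoffCocycle_add_one, birkhoffCocycle_zero]; simpa)
  ext
  · simpa using h1
  · simpa [birkhoffCocycle_zero] using h2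

variable [MeasurableSpace X]

theorem measurable_toProd : Measurable (SpecialSpace.toProd (f := f)) :=
  comap_measurable _

theorem measurable_base : Measurable (SpecialSpace.base (f := f)) :=
  measurable_fst.comp measurable_toProd

theorem measurable_height : Measurable (SpecialSpace.height (f := f)) :=
  measurable_snd.comp measurable_toProd

theorem measurable_specialSpace_of {Y : Type*} [MeasurableSpace Y] {F : Y → SpecialSpace f}
    (h1 : Measurable fun y => (F y).base) (h2 : Measurable fun y => (F y).height) :
    Measurable F := by
  rw [measurable_comap_iff]
  exact h1.prodMk h2

theorem measurableSet_range_toProd (hf : Measurable f) :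
    MeasurableSet (range (SpecialSpace.toProd (f := f))) := by
  rw [range_toProd]
  exact (measurableSet_le measurable_const measurable_snd).inter
    (measurableSet_lt measurable_snd (hf.comp measurable_fst))

theorem measurableEmbedding_toProd (hf : Measurable f) :
    MeasurableEmbedding (SpecialSpace.toProd (f := f)) where
  injective := toProd_injective
  measurable := measurable_toProd
  measurableSet_image' := by
    rintro s ⟨t, ht, rfl⟩
    rw [image_preimage_eq_inter_range]
    exact ht.inter (measurableSet_range_toProd hf)

theorem specialMeasureAux_apply (hf : Measurable f) (μ : Measure X) (s : Set (SpecialSpace f)) :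
    specialMeasureAux μ f s = μ.prod volume (SpecialSpace.toProd '' s) := by
  rw [specialMeasureAux, (measurableEmbedding_toProd hf).comap_apply]

theorem measurable_zpow_perm (hT : Measurable T) (hT' : Measurable T.symm) (n : ℤ) :
    Measurable (T ^ n : Equiv.Perm X) := by
  have hpow : ∀ (S : Equiv.Perm X), Measurable S → ∀ n : ℕ, Measurable (S ^ n : Equiv.Perm X) := by
    intro S hS n
    rw [Equiv.Perm.coe_pow]
    exact hS.iterate n
  obtain ⟨m, rfl | rfl⟩ := n.eq_nat_or_neg
  · exact_mod_cast hpow T hT m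
  · rw [zpow_neg, zpow_natCast, ← inv_pow]
    exact hpow _ hT' m

theorem measurePreserving_zpow_perm {μ : Measure X} (hT : MeasurePreserving T μ μ)
    (hT' : MeasurePreserving T.symm μ μ) (n : ℤ) :
    MeasurePreserving (T ^ n : Equiv.Perm X) μ μ := by
  have hpow : ∀ (S : Equiv.Perm X), MeasurePreserving S μ μ → ∀ n : ℕ,
      MeasurePreserving (S ^ n : Equiv.Perm X) μ μ := by
    intro S hS n
    rw [Equiv.Perm.coe_pow]
    exact hS.iterate n
  obtain ⟨m, rfl | rfl⟩ := n.eq_nat_or_neg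
  · exact_mod_cast hpow T hT m
  · rw [zpow_neg, zpow_natCast, ← inv_pow]
    exact hpow _ hT' m

theorem measurable_birkhoffCocycle (hT : Measurable T) (hT' : Measurable T.symm)
    (hf : Measurable f) (n : ℤ) : Measurable (birkhoffCocycle T f n) := by
  match n with
  | Int.ofNat n =>
    exact Finset.measurable_sum _ fun i _ => hf.comp (measurable_zpow_perm hT hT' _)
  | Int.negSucc n =>
    exact (Finset.measurable_sum _ fun i _ => hf.comp (measurable_zpow_perm hT hT' _)).neg

theorem measurable_specialFlow (hT : Measurable T) (hT' : Measurable T.symm)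
    (hfm : Measurable f) (hf : ∀ x, 0 < f x) (hu : BirkhoffUnbounded T f) :
    Measurable fun z : ℝ × SpecialSpace f => specialFlow T f z.1 z.2 := by
  choose N hN1 hN2 using fun z : ℝ × SpecialSpace f =>
    hu.exists_index hf z.2.base (z.1 + z.2.height)
  have hb : Measurable fun z : ℝ × SpecialSpace f => z.2.base := measurable_base.comp measurable_snd
  have hh : Measurable fun z : ℝ × SpecialSpace f => z.1 + z.2.height :=
    measurable_fst.add (measurable_height.comp measurable_snd)
  have hS : ∀ n, Measurable fun z : ℝ × SpecialSpace f => birkhoffCocycle T f n z.2.base :=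
    fun n => (measurable_birkhoffCocycle hT hT' hfm n).comp hb
  have hN : Measurable N := by
    refine measurable_to_countable' fun n => ?_
    have : N ⁻¹' {n} = {z | birkhoffCocycle T f n z.2.base ≤ z.1 + z.2.height} ∩
        {z | z.1 + z.2.height < birkhoffCocycle T f (n + 1) z.2.base} := by
      ext z
      constructor
      · rintro rfl
        exact ⟨hN1 z, hN2 z⟩
      · rintro ⟨h1, h2⟩
        exact birkhoffCocycle_index_unique hf (hN1 z) (hN2 z) h1 h2
    rw [this]
    exact (measurableSet_le (hS n) hh).inter (measurableSet_lt hh (hS (n + 1)))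
  have hNz : Measurable fun z : ℝ × SpecialSpace f => (N z, z) := hN.prodMk measurable_id
  refine measurable_specialSpace_of ?_ ?_
  · have : (fun z : ℝ × SpecialSpace f => (specialFlow T f z.1 z.2).base) =
        (fun w : ℤ × (ℝ × SpecialSpace f) => (T ^ w.1) w.2.2.base) ∘ fun z => (N z, z) :=
      funext fun z => (specialFlow_eq hf (hN1 z) (hN2 z)).1
    rw [this]
    exact (measurable_from_prod_countable_right fun n =>
      (measurable_zpow_perm hT hT' n).comp hb).comp hNz
  · have : (fun z : ℝ × SpecialSpace f => (specialFlow T f z.1 z.2).height) =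
        (fun w : ℤ × (ℝ × SpecialSpace f) => w.2.1 + w.2.2.height -
          birkhoffCocycle T f w.1 w.2.2.base) ∘ fun z => (N z, z) :=
      funext fun z => (specialFlow_eq hf (hN1 z) (hN2 z)).2
    rw [this]
    exact (measurable_from_prod_countable_right fun n => hh.sub (hS n)).comp hNz

theorem measurableSet_flowIndexSet (hT : Measurable T) (hT' : Measurable T.symm)
    (hfm : Measurable f) (t : ℝ) (n : ℤ) : MeasurableSet (flowIndexSet T f t n) :=
  (measurableSet_le ((measurable_birkhoffCocycle hT hT' hfm n).comp measurable_base)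
    (measurable_height.const_add t)).inter
  (measurableSet_lt (measurable_height.const_add t)
    ((measurable_birkhoffCocycle hT hT' hfm (n + 1)).comp measurable_base))

/-- On the piece where the index is n, the flow is the restriction of a skew product over T^n by
translations of ℝ, which preserves μ ⊗ Lebesgue. It maps piece n at time t onto piece −n at time −t,
and both families of pieces are countable partitions. -/
theorem measurePreserving_specialFlow_aux {μ : Measure X} [SFinite μ]
    (hT : MeasurePreserving T μ μ) (hT' : MeasurePreserving T.symm μ μ)
    (hfm : Measurable f) (hf : ∀ x, 0 < f x) (hu : BirkhoffUnbounded T f) (t : ℝ) :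
    MeasurePreserving (specialFlow T f t) (specialMeasureAux μ f) (specialMeasureAux μ f) := by
  have hmeas : Measurable (specialFlow T f t) :=
    (measurable_specialFlow hT.measurable hT'.measurable hfm hf hu).comp measurable_prodMk_left
  have hI := fun s n => measurableSet_flowIndexSet (f := f) hT.measurable hT'.measurable hfm s n
  have hdisj : ∀ s, Pairwise (Function.onFun Disjoint (flowIndexSet T f s)) := by
    intro s m n hmn
    rw [Function.onFun, Set.disjoint_left]
    exact fun p h1 h2 => hmn (birkhoffCocycle_index_unique hf h1.1 h1.2 h2.1 h2.2)
  have hcover : ∀ s, ⋃ n, flowIndexSet T f s n = univ := by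
    intro s
    refine eq_univ_of_forall fun p => mem_iUnion.mpr ?_
    exact hu.exists_index hf p.base (s + p.height)
  have hsplit : ∀ s A, MeasurableSet A → specialMeasureAux μ f A =
      ∑' n, specialMeasureAux μ f (A ∩ flowIndexSet T f s n) := by
    intro s A hA
    rw [← measure_iUnion (fun m n h => (hdisj s h).mono inter_subset_right inter_subset_right)
      (fun n => hA.inter (hI s n)), ← inter_iUnion, hcover, inter_univ]
  refine ⟨hmeas, Measure.ext fun A hA => ?_⟩
  -- The preimage is split by the indices at time t and A by those at time −t; the change of sign of
  -- n pairs each piece with its image.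
  rw [Measure.map_apply hmeas hA, hsplit t _ (hmeas hA), hsplit (-t) A hA,
    ← (Equiv.neg ℤ).tsum_eq]
  refine tsum_congr fun n => ?_
  rw [specialMeasureAux_apply hfm, specialMeasureAux_apply hfm]
  have hΦ : MeasurePreserving
      (fun z : X × ℝ => ((T ^ (-n)) z.1, (t - birkhoffCocycle T f (-n) z.1) + z.2))
      (μ.prod volume) (μ.prod volume) := by
    refine (measurePreserving_zpow_perm hT hT' (-n)).skew_product
      (g := fun x s => (t - birkhoffCocycle T f (-n) x) + s) ?_ (ae_of_all _ fun x => ?_)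
    · exact ((measurable_const.sub ((measurable_birkhoffCocycle hT.measurable hT'.measurable hfm
        (-n)).comp measurable_fst))).add measurable_snd
    · exact (measurePreserving_add_left volume _).map_eq
  rw [← hΦ.measure_preimage ((measurableEmbedding_toProd hfm).measurableSet_image.mpr
    (hA.inter (hI (-t) n))).nullMeasurableSet]
  congr 1
  simp only [Equiv.neg_apply]
  ext z
  constructor
  · rintro ⟨p, ⟨hp1, hp2⟩, rfl⟩
    obtain ⟨e1, e2⟩ := specialFlow_eq hf hp2.1 hp2.2
    have h3 := specialFlow_mem_flowIndexSet_neg hf hp2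
    rw [neg_neg] at h3
    refine ⟨specialFlow T f t p, ⟨hp1, h3⟩, ?_⟩
    simp only [SpecialSpace.toProd, Prod.mk.injEq]
    exact ⟨e1, by rw [e2]; ring⟩
  · rintro ⟨q, ⟨hq1, hq2⟩, hq3⟩
    have h3 := specialFlow_mem_flowIndexSet_neg hf hq2
    obtain ⟨e1, e2⟩ := specialFlow_eq hf hq2.1 hq2.2
    rw [neg_neg] at h3
    refine ⟨specialFlow T f (-t) q, ⟨?_, h3⟩, ?_⟩
    · change specialFlow T f t (specialFlow T f (-t) q) ∈ A
      rwa [← specialFlow_add hf hu, add_neg_cancel, specialFlow_zero hf]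
    · have h4 := birkhoffCocycle_add T f (-n) n z.1
      rw [neg_add_cancel, birkhoffCocycle_zero] at h4
      simp only [SpecialSpace.toProd, Prod.mk.injEq] at hq3
      have hz : z.1 = (T ^ n) q.base := by
        rw [hq3.1, ← Equiv.Perm.mul_apply, ← zpow_add]; simp
      refine Prod.ext (by simpa [SpecialSpace.toProd, hz] using e1) ?_
      simp only [SpecialSpace.toProd]
      rw [e2, hq3.1, hq3.2]
      linarith

theorem specialMeasureAux_univ (hfm : Measurable f) (μ : Measure X) [SFinite μ] :
    specialMeasureAux μ f univ = ∫⁻ x, ENNReal.ofReal (f x) ∂μ := by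
  rw [specialMeasureAux_apply hfm, image_univ,
    Measure.prod_apply (measurableSet_range_toProd hfm)]
  refine lintegral_congr fun x => ?_
  have : Prod.mk x ⁻¹' range (SpecialSpace.toProd (f := f)) = Ico 0 (f x) := by
    rw [range_toProd]; ext s; simp
  rw [this, Real.volume_Ico, sub_zero]

/-- The measure of the part of the special space over a base set. -/
theorem specialMeasureAux_base_preimage (hfm : Measurable f) (μ : Measure X) [SFinite μ]
    {s : Set X} (hs : MeasurableSet s) :
    specialMeasureAux μ f (SpecialSpace.base ⁻¹' s) = ∫⁻ x in s, ENNReal.ofReal (f x) ∂μ := by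
  have hpre : SpecialSpace.toProd '' (SpecialSpace.base ⁻¹' s : Set (SpecialSpace f)) =
      range (SpecialSpace.toProd (f := f)) ∩ Prod.fst ⁻¹' s := by
    ext z
    constructor
    · rintro ⟨p, hp, rfl⟩
      exact ⟨⟨p, rfl⟩, hp⟩
    · rintro ⟨⟨p, rfl⟩, hp⟩
      exact ⟨p, hp, rfl⟩
  rw [specialMeasureAux_apply hfm, hpre, Measure.prod_apply
    ((measurableSet_range_toProd hfm).inter (measurable_fst hs)), ← lintegral_indicator hs]
  refine lintegral_congr fun x => ?_
  by_cases hx : x ∈ s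
  · have : Prod.mk x ⁻¹' (range (SpecialSpace.toProd (f := f)) ∩ Prod.fst ⁻¹' s) = Ico 0 (f x) := by
      rw [range_toProd]; ext r; simp [hx]
    rw [this, Real.volume_Ico, sub_zero, indicator_of_mem hx]
  · have : Prod.mk x ⁻¹' (range (SpecialSpace.toProd (f := f)) ∩ Prod.fst ⁻¹' s) = ∅ := by
      ext r; simp [hx]
    rw [this, measure_empty, indicator_of_notMem hx]

/-- A set invariant at all times is a union of whole fibres over its trace on the zero section.
Flowing for time f(x) shows that this trace is T-invariant, so ergodicity of the base applies. -/
theorem isErgodicFlow_specialFlow [MetricSpace X] {μ : Measure X} [IsProbabilityMeasure μ]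
    (hT : MeasurePreserving T μ μ) (hT' : MeasurePreserving T.symm μ μ)
    (herg : PreErgodic T μ) (hfm : Measurable f) (hf : ∀ x, 0 < f x)
    (hint : ∫⁻ x, ENNReal.ofReal (f x) ∂μ ≠ ∞) (hu : BirkhoffUnbounded T f) :
    IsErgodicFlow (specialFlow T f) (specialMeasure μ f) := by
  have htop : specialMeasureAux μ f univ ≠ ∞ := by rwa [specialMeasureAux_univ hfm]
  have hzero : specialMeasureAux μ f univ ≠ 0 := by
    rw [specialMeasureAux_univ hfm, Ne, lintegral_eq_zero_iff hfm.ennreal_ofReal]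
    intro h
    obtain ⟨x, hx⟩ := h.exists
    simp only [Pi.zero_apply, ENNReal.ofReal_eq_zero] at hx
    exact absurd (hf x) (not_lt.mpr hx)
  refine ⟨⟨?_⟩, measurable_specialFlow hT.measurable hT'.measurable hfm hf hu,
    specialFlow_zero hf, specialFlow_add hf hu, fun t => ?_, fun A hA hinv => ?_⟩
  · rw [specialMeasure, Measure.smul_apply, smul_eq_mul, ENNReal.inv_mul_cancel hzero htop]
  · exact (measurePreserving_specialFlow_aux hT hT' hfm hf hu t).smul_measure _
  · set A₀ : Set X := (fun x => (⟨x, 0, le_rfl, hf x⟩ : SpecialSpace f)) ⁻¹' A with hA₀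
    have hA₀m : MeasurableSet A₀ :=
      measurable_specialSpace_of (F := fun x => (⟨x, 0, le_rfl, hf x⟩ : SpecialSpace f))
        measurable_id measurable_const hA
    have hAA : A = SpecialSpace.base ⁻¹' A₀ := by
      ext p
      have h1 : (⟨p.base, 0, le_rfl, hf _⟩ : SpecialSpace f) ∈ A ↔ p ∈ A := by
        conv_lhs => rw [← hinv p.height]
        rw [mem_preimage, specialFlow_height_base hf]
      exact h1.symm
    have hinv₀ : T ⁻¹' A₀ = A₀ := by
      ext x
      have h1 : (⟨x, 0, le_rfl, hf _⟩ : SpecialSpace f) ∈ A ↔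
          (⟨T x, 0, le_rfl, hf _⟩ : SpecialSpace f) ∈ A := by
        conv_lhs => rw [← hinv (f x)]
        rw [mem_preimage]
        have h0 : birkhoffCocycle T f 1 x = f x := by
          have := birkhoffCocycle_add_one T f 0 x
          simpa [birkhoffCocycle_zero] using this
        have h2 := birkhoffCocycle_add_one T f 1 x
        obtain ⟨e1, e2⟩ := specialFlow_eq (T := T) (n := 1) (t := f x)
          (p := ⟨x, 0, le_rfl, hf _⟩) hf (by simp [h0]) (by
            rw [h2, h0]; simpa using hf _)
        have : specialFlow T f (f x) ⟨x, 0, le_rfl, hf _⟩ = ⟨T x, 0, le_rfl, hf _⟩ := by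
          ext
          · simpa using e1
          · simpa [h0] using e2
        rw [this]
      exact h1.symm
    rcases herg.prob_eq_zero_or_one hA₀m hinv₀ with h0 | h1
    · left
      rw [specialMeasure, Measure.smul_apply, hAA, specialMeasureAux_base_preimage hfm μ hA₀m,
        Measure.restrict_zero_set h0, lintegral_zero_measure, smul_zero]
    · right
      have hae : ∀ᵐ x ∂μ, x ∈ A₀ := by
        rw [ae_iff]
        exact (prob_compl_eq_zero_iff hA₀m).mpr h1
      rw [specialMeasure, Measure.smul_apply, smul_eq_mul]
      rw [hAA, specialMeasureAux_base_preimage hfm μ hA₀m,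
        Measure.restrict_eq_self_of_ae_mem hae, ← specialMeasureAux_univ hfm,
        ENNReal.inv_mul_cancel hzero htop]

end SpecialFlow

/-! ### Rotations of the circle -/

section Rotation

theorem circleRotation_zpow_apply (α : ℝ) (n : ℤ) (x : UnitAddCircle) :
    (circleRotation α ^ n) x = x + (((n : ℝ) * α : ℝ) : UnitAddCircle) := by
  have hone : ∀ y : UnitAddCircle, circleRotation α y = y + (α : UnitAddCircle) := fun y => rfl
  induction n using Int.induction_on generalizing x with
  | zero => simp
  | succ n ih =>
    rw [zpow_add_one, Equiv.Perm.mul_apply, ih, hone, add_assoc, ← AddCircle.coe_add]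
    congr 2
    push_cast; ring
  | pred n ih =>
    have hinv : (circleRotation α)⁻¹ x = x + ((-α : ℝ) : UnitAddCircle) := by
      rw [Equiv.Perm.inv_eq_iff_eq, hone, add_assoc, ← AddCircle.coe_add]; simp
    rw [zpow_sub_one, Equiv.Perm.mul_apply, ih, hinv, add_assoc, ← AddCircle.coe_add]
    congr 2
    push_cast; ring

theorem measurePreserving_circleRotation (α : ℝ) :
    MeasurePreserving (circleRotation α) (volume : Measure UnitAddCircle) volume :=
  measurePreserving_add_right volume (α : UnitAddCircle)

theorem measurePreserving_circleRotation_symm (α : ℝ) :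
    MeasurePreserving (circleRotation α).symm (volume : Measure UnitAddCircle) volume := by
  have : ((circleRotation α).symm : UnitAddCircle → UnitAddCircle) =
      fun x => x + -(α : UnitAddCircle) := by
    ext x
    rw [Equiv.symm_apply_eq]
    simp [circleRotation]
  rw [this]
  exact measurePreserving_add_right volume (-(α : UnitAddCircle))

theorem addOrderOf_coe_eq_zero {α : ℝ} (hα : Irrational α) :
    addOrderOf (α : UnitAddCircle) = 0 := by
  rw [addOrderOf_eq_zero_iff']
  intro n hn h
  have h1 : ((n * α : ℝ) : UnitAddCircle) = 0 := by
    rw [← nsmul_eq_mul, AddCircle.coe_nsmul]; exact h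
  obtain ⟨m, hm⟩ := (AddCircle.coe_eq_zero_iff (1 : ℝ)).mp h1
  exact (hα.natCast_mul hn.ne').ne_int m (by simpa using hm.symm)

theorem preErgodic_circleRotation {α : ℝ} (hα : Irrational α) :
    PreErgodic (circleRotation α) (volume : Measure UnitAddCircle) :=
  (AddCircle.ergodic_add_right.mpr (addOrderOf_coe_eq_zero hα)).toPreErgodic

theorem exists_nat_add_mem {α : ℝ} (hα : Irrational α) {U : Set UnitAddCircle} (hU : IsOpen U)
    (hne : U.Nonempty) (x : UnitAddCircle) :
    ∃ n : ℕ, x + (((n : ℝ) * α : ℝ) : UnitAddCircle) ∈ U := by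
  have hd : DenseRange ((· • (α : UnitAddCircle)) : ℕ → UnitAddCircle) :=
    denseRange_zsmul_iff_nsmul.mp (AddCircle.denseRange_zsmul_iff.mpr (addOrderOf_coe_eq_zero hα))
  obtain ⟨n, hn⟩ := hd.exists_mem_open (hU.preimage (continuous_const_add x))
    (by obtain ⟨u, hu⟩ := hne; exact ⟨u - x, by simpa using hu⟩)
  refine ⟨n, ?_⟩
  rw [← nsmul_eq_mul, AddCircle.coe_nsmul]
  exact hn

/-- Compactness of the circle makes the hitting time of an open set uniform in the starting point.
-/
theorem exists_uniform_nat_add_mem {α : ℝ} (hα : Irrational α) {U : Set UnitAddCircle}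
    (hU : IsOpen U) (hne : U.Nonempty) :
    ∃ N : ℕ, ∀ x : UnitAddCircle, ∃ n < N, x + (((n : ℝ) * α : ℝ) : UnitAddCircle) ∈ U := by
  obtain ⟨N, hN⟩ := isCompact_univ.elim_directed_cover
    (fun N : ℕ => ⋃ n : ℕ, ⋃ _ : n < N,
      (fun x : UnitAddCircle => x + (((n : ℝ) * α : ℝ) : UnitAddCircle)) ⁻¹' U)
    (fun N => isOpen_iUnion fun n => isOpen_iUnion fun _ => hU.preimage (continuous_add_const _))
    (fun x _ => by
      obtain ⟨n, hn⟩ := exists_nat_add_mem hα hU hne x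
      exact mem_iUnion.mpr ⟨n + 1, mem_iUnion₂.mpr ⟨n, n.lt_succ_self, hn⟩⟩)
    (Monotone.directed_le fun N M h =>
      iUnion_mono fun n => iUnion_mono' fun hn => ⟨hn.trans_le h, subset_rfl⟩)
  refine ⟨N, fun x => ?_⟩
  obtain ⟨n, hn, hx⟩ := mem_iUnion₂.mp (hN (mem_univ x))
  exact ⟨n, hn, hx⟩

variable {k : ℕ} {a : Fin k → UnitAddCircle} {f : UnitAddCircle → ℝ}

theorem isOpen_coe_notMem_range (a : Fin k → UnitAddCircle) :
    IsOpen {t : ℝ | (t : UnitAddCircle) ∉ range a} :=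
  ((finite_range a).isClosed.isOpen_compl).preimage (AddCircle.continuous_mk' 1)

theorem IsC2Off.continuousAt (hf : IsC2Off f a) {z : UnitAddCircle} (hz : z ∉ range a) :
    ContinuousAt f z := by
  obtain ⟨t, rfl⟩ := QuotientAddGroup.mk_surjective z
  have h1 : ContinuousAt (fun t : ℝ => f (t : UnitAddCircle)) t :=
    hf.continuousOn.continuousAt ((isOpen_coe_notMem_range a).mem_nhds hz)
  exact QuotientAddGroup.isOpenQuotientMap_mk.continuousAt_comp_iff.mp h1

theorem IsC2Off.measurable (hf : IsC2Off f a) : Measurable f := by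
  refine measurable_of_measurable_on_compl_finite (range a) (finite_range a) ?_
  exact (continuousOn_iff_continuous_domRestrict.mp fun z hz =>
    (hf.continuousAt hz).continuousWithinAt).measurable

/-- Near a point of continuity f exceeds a positive constant, and every orbit returns there within a
bounded time. This lower bound holds at every x, so the flow is defined everywhere and not only
almost everywhere. -/
theorem IsC2Off.exists_linear_growth {α : ℝ} (hα : Irrational α) (hf : IsC2Off f a)
    (hpos : ∀ x, 0 < f x) : ∃ c b : ℝ, 0 < c ∧ 0 ≤ b ∧ ∀ (n : ℕ) (x : UnitAddCircle),
      c * n - b ≤ birkhoffCocycle (circleRotation α) f n x := by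
  obtain ⟨z, hz⟩ : ∃ z : UnitAddCircle, z ∉ range a := by
    have : Infinite UnitAddCircle := (AddCircle.equivIco (1 : ℝ) 0).infinite_iff.mpr
      (infinite_coe_iff.mpr (Ico_infinite (by norm_num)))
    by_contra! h
    exact (Set.infinite_univ (α := UnitAddCircle)) ((finite_range a).subset fun z _ => h z)
  have hnhds : {w | f z / 2 < f w} ∈ 𝓝 z :=
    (hf.continuousAt hz).eventually (lt_mem_nhds (half_lt_self (hpos z)))
  obtain ⟨N, hN⟩ := exists_uniform_nat_add_mem hα isOpen_interior
    ⟨z, mem_interior_iff_mem_nhds.mpr hnhds⟩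
  have hb : ∀ x, f z / 2 ≤ birkhoffCocycle (circleRotation α) f N x := by
    intro x
    obtain ⟨n, hn, hx⟩ := hN x
    rw [birkhoffCocycle_natCast]
    refine (interior_subset hx).le.trans ?_
    have := Finset.single_le_sum (f := fun i : ℕ => f ((circleRotation α ^ (i : ℤ)) x))
      (fun i _ => (hpos _).le) (Finset.mem_range.mpr hn)
    simpa only [circleRotation_zpow_apply, Int.cast_natCast] using this
  have hN0 : 0 < N := by
    obtain ⟨n, hn, -⟩ := hN z
    omega
  have hN0' : (0 : ℝ) < N := by exact_mod_cast hN0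
  have hmul : ∀ (m : ℕ) (x : UnitAddCircle),
      m * (f z / 2) ≤ birkhoffCocycle (circleRotation α) f ((N * m : ℕ) : ℤ) x := by
    intro m
    induction m with
    | zero => intro x; simp [birkhoffCocycle_zero]
    | succ m ih =>
      intro x
      have h1 := birkhoffCocycle_add (circleRotation α) f ((N * m : ℕ) : ℤ) (N : ℤ) x
      have h2 := hb ((circleRotation α ^ ((N * m : ℕ) : ℤ)) x)
      have h3 := ih x
      rw [Nat.mul_succ, Nat.cast_add (R := ℤ), h1]
      push_cast
      push_cast at h2 h3
      linarith
  refine ⟨f z / 2 / N, f z / 2, div_pos (half_pos (hpos z)) hN0', (half_pos (hpos z)).le,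
    fun n x => ?_⟩
  have h1 := hmul (n / N) x
  have h2 : birkhoffCocycle (circleRotation α) f ((N * (n / N) : ℕ) : ℤ) x ≤
      birkhoffCocycle (circleRotation α) f n x :=
    (strictMono_birkhoffCocycle hpos x).monotone (by exact_mod_cast Nat.mul_div_le n N)
  have h3 : (n : ℝ) / N < (n / N : ℕ) + 1 := by
    rw [← Nat.floor_div_eq_div (K := ℝ)]
    exact Nat.lt_floor_add_one _
  have h4 := half_pos (hpos z)
  calc f z / 2 / N * n - f z / 2 = (n / N - 1) * (f z / 2) := by ring
    _ ≤ ((n / N : ℕ) : ℝ) * (f z / 2) := by gcongr; linarith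
    _ ≤ _ := h1.trans h2

theorem IsC2Off.birkhoffUnbounded {α : ℝ} (hα : Irrational α) (hf : IsC2Off f a)
    (hpos : ∀ x, 0 < f x) : BirkhoffUnbounded (circleRotation α) f := by
  obtain ⟨c, b, hc, -, h⟩ := hf.exists_linear_growth hα hpos
  have hlarge : ∀ r : ℝ, ∃ n : ℕ, ∀ x, r < birkhoffCocycle (circleRotation α) f n x := by
    intro r
    obtain ⟨n, hn⟩ := exists_nat_gt ((r + b) / c)
    rw [div_lt_iff₀ hc] at hn
    exact ⟨n, fun x => by linarith [h n x]⟩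
  refine fun x => ⟨fun r => ?_, fun r => ?_⟩
  · obtain ⟨n, hn⟩ := hlarge r
    exact ⟨n, hn x⟩
  · obtain ⟨n, hn⟩ := hlarge (-r)
    refine ⟨-n, ?_⟩
    have h1 := birkhoffCocycle_add (circleRotation α) f (-n) n x
    rw [neg_add_cancel, birkhoffCocycle_zero] at h1
    linarith [hn ((circleRotation α ^ (-(n : ℤ))) x)]

end Rotation

/-! ### Denominators of best approximations -/

section BestDenom

variable {α : ℝ}

theorem bestDenom_pos (hα : Irrational α) (s : ℕ) : 0 < bestDenom α s := (bestDenom_spec hα s).1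

theorem bestDenom_strictMono (hα : Irrational α) : StrictMono (bestDenom α) :=
  strictMono_nat_of_lt_succ fun s => (bestDenom_spec hα s).2.2.1

theorem distInt_le_abs_sub (α : ℝ) (k : ℕ) (m : ℤ) : distInt α k ≤ |k * α - m| := by
  rw [distInt, UnitAddCircle.norm_eq]
  exact round_le _ _

theorem distInt_eq (α : ℝ) (k : ℕ) : distInt α k = |k * α - round (k * α)| := by
  rw [distInt, UnitAddCircle.norm_eq]

theorem distInt_bestDenom_le (hα : Irrational α) {s k : ℕ} (hk : 0 < k)
    (hks : k < bestDenom α (s + 1)) : distInt α (bestDenom α s) ≤ distInt α k := by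
  rcases lt_trichotomy k (bestDenom α s) with h | rfl | h
  · exact ((bestDenom_spec hα s).2.1 k hk h).le
  · exact le_rfl
  · by_contra hc
    rw [bestDenom] at hks
    exact Nat.notMem_of_lt_sInf hks ⟨h, not_le.mp hc⟩

/-- Dirichlet's theorem with denominators at most q_{s+1} − 1, among which q_s is the best. -/
theorem distInt_bestDenom_le_one_div (hα : Irrational α) (s : ℕ) :
    distInt α (bestDenom α s) ≤ 1 / bestDenom α (s + 1) := by
  have h1 := bestDenom_pos hα s
  have h2 := bestDenom_strictMono hα (Nat.lt_succ_self s)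
  obtain ⟨k, hk, hk2, hk3⟩ := Real.exists_nat_abs_mul_sub_round_le α
    (n := bestDenom α (s + 1) - 1) (by simp only [Nat.succ_eq_add_one] at h2; omega)
  refine (distInt_bestDenom_le hα hk (by simp only [Nat.succ_eq_add_one] at h2; omega)).trans ?_
  rw [distInt_eq]
  refine hk3.trans (le_of_eq ?_)
  rw [Nat.cast_sub (by simp only [Nat.succ_eq_add_one] at h2; omega)]
  simp

/-- The signed errors q_s α − p_s alternate in sign, so q_{s+2} − q_s has an error smaller than that
of q_s and cannot be less than q_{s+1}. This gives exponential growth of the denominators without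
continued fractions. -/
theorem two_mul_bestDenom_le (hα : Irrational α) (s : ℕ) :
    2 * bestDenom α s ≤ bestDenom α (s + 2) := by
  set δ : ℕ → ℝ := fun s => bestDenom α s * α - round (bestDenom α s * α) with hδ
  have habs : ∀ s, distInt α (bestDenom α s) = |δ s| := fun s => distInt_eq α _
  have hpos : ∀ s, 0 < |δ s| := fun s => habs s ▸ distInt_pos hα (bestDenom_pos hα s)
  have hlt : ∀ s, |δ (s + 1)| < |δ s| := fun s => by
    rw [← habs, ← habs]; exact (bestDenom_spec hα s).2.2.2
  have hsub : ∀ s t, s ≤ t → distInt α (bestDenom α t - bestDenom α s) ≤ |δ t - δ s| := by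
    intro s t hst
    refine (distInt_le_abs_sub α _
      (round (bestDenom α t * α) - round (bestDenom α s * α))).trans (le_of_eq ?_)
    rw [Nat.cast_sub ((bestDenom_strictMono hα).monotone hst), hδ]
    push_cast
    ring_nf
  have hsame : ∀ s t, 0 < δ s * δ t → |δ t| < |δ s| → |δ t - δ s| < |δ s| := by
    intro s t h1 h2
    rcases pos_and_pos_or_neg_and_neg_of_mul_pos h1 with ⟨a, b⟩ | ⟨a, b⟩
    · rw [abs_of_pos a, abs_of_pos b] at *
      rw [abs_lt]; constructor <;> linarith
    · rw [abs_of_neg a, abs_of_neg b] at *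
      rw [abs_lt]; constructor <;> linarith
  -- If two successive errors had the same sign, the denominator q_{s+1} − q_s would approximate
  -- better than q_s, although it is less than q_{s+1}.
  have halt : ∀ s, δ s * δ (s + 1) < 0 := by
    intro s
    by_contra hc
    have hne : δ s * δ (s + 1) ≠ 0 :=
      mul_ne_zero (abs_pos.mp (hpos s)) (abs_pos.mp (hpos (s + 1)))
    have h1 := hsame s (s + 1) (lt_of_le_of_ne (not_lt.mp hc) hne.symm) (hlt s)
    have h2 := (hsub s (s + 1) (Nat.le_succ s)).trans_lt h1
    rw [← habs] at h2
    have h3 := bestDenom_strictMono hα (Nat.lt_succ_self s)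
    have h4 := bestDenom_pos hα s
    simp only [Nat.succ_eq_add_one] at h3
    exact absurd (distInt_bestDenom_le hα (s := s) (k := bestDenom α (s + 1) - bestDenom α s)
      (by omega) (by omega)) (not_le.mpr h2)
  have h1 : 0 < δ s * δ (s + 2) := by
    have h1 := halt s
    have h2 := halt (s + 1)
    have h3 : 0 < (δ s * δ (s + 2)) * (δ (s + 1) * δ (s + 1)) := by
      have := mul_pos_of_neg_of_neg h1 h2
      calc 0 < _ := this
        _ = _ := by ring
    exact pos_of_mul_pos_left h3 (mul_self_nonneg _)
  have h2 := (hsub s (s + 2) (by omega)).trans_lt (hsame s (s + 2) h1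
    ((hlt (s + 1)).trans (hlt s)))
  rw [← habs] at h2
  have h3 := bestDenom_strictMono hα (show s < s + 1 by omega)
  have h4 := bestDenom_strictMono hα (show s + 1 < s + 2 by omega)
  by_contra hc
  exact absurd (distInt_bestDenom_le hα (s := s) (k := bestDenom α (s + 2) - bestDenom α s)
    (by omega) (by omega)) (not_le.mpr h2)

/-- Replaces coprimality of p_s and q_s. If q divides (i − j)p with quotient m, then (i − j)α − m is
(i − j)/q times the error qα − p, so i − j < q would approximate at least as well as q. -/
theorem bestDenom_mul_injective (hα : Irrational α) (s : ℕ) {i j : ℕ}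
    (hi : i < bestDenom α s) (hj : j < bestDenom α s)
    (hij : (bestDenom α s : ℤ) ∣ (i - j) * round (bestDenom α s * α)) : i = j := by
  wlog hlt : j < i generalizing i j
  · rcases lt_trichotomy i j with h | h | h
    · refine (this hj hi ?_ h).symm
      rw [← neg_sub, neg_mul]
      exact (dvd_neg).mpr hij
    · exact h
    · exact absurd h hlt
  exfalso
  obtain ⟨m, hm⟩ := hij
  have hq : (0 : ℝ) < bestDenom α s := by exact_mod_cast bestDenom_pos hα s
  have h1 := distInt_le_abs_sub α (i - j) m
  have hm' : ((i : ℝ) - j) * round (bestDenom α s * α) = bestDenom α s * m := by exact_mod_cast hm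
  have h2 : ((i - j : ℕ) : ℝ) * α - m =
      ((i - j : ℕ) : ℝ) / bestDenom α s * (bestDenom α s * α - round (bestDenom α s * α)) := by
    rw [Nat.cast_sub hlt.le]
    generalize round ((bestDenom α s : ℝ) * α) = P at hm'
    field_simp
    linear_combination hm'
  rw [h2, abs_mul, ← distInt_eq, abs_of_nonneg (by positivity)] at h1
  have h3 := (bestDenom_spec hα s).2.1 (i - j) (by omega) (by omega)
  have h4 : ((i - j : ℕ) : ℝ) / bestDenom α s ≤ 1 := by
    rw [div_le_one hq]; exact_mod_cast (by omega)
  have h5 := distInt_pos hα (bestDenom_pos hα s)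
  nlinarith

end BestDenom

/-! ### Sums of a singularity profile along well distributed points -/

section Profile

variable {h : ℝ → ℝ}

namespace IsSingularityProfile

theorem hasDerivAt (hh : IsSingularityProfile h) {x : ℝ} (hx : x ∈ Ioo (0 : ℝ) 1) :
    HasDerivAt h (deriv h x) x :=
  ((hh.contDiffOn.differentiableOn (by norm_num)).differentiableAt
    (isOpen_Ioo.mem_nhds hx)).hasDerivAt

theorem deriv_nonpos (hh : IsSingularityProfile h) {x : ℝ} (hx : x ∈ Ioo (0 : ℝ) 1) :
    deriv h x ≤ 0 := by
  have h1 := hh.antitoneOn.derivWithin_nonpos (x := x)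
  rwa [derivWithin_of_isOpen isOpen_Ioo hx] at h1

/-- Mean value theorem and monotonicity of h'. These two bounds are what turns sums of −h' on a grid
into telescoping sums of h. -/
theorem slope_bounds (hh : IsSingularityProfile h) {x y : ℝ} (hx : 0 < x) (hxy : x < y)
    (hy : y < 1) :
    (y - x) * -deriv h y ≤ h x - h y ∧ h x - h y ≤ (y - x) * -deriv h x := by
  have hsub : Icc x y ⊆ Ioo (0 : ℝ) 1 := fun z hz => ⟨hx.trans_le hz.1, hz.2.trans_lt hy⟩
  obtain ⟨c, hc, hc2⟩ := exists_hasDerivAt_eq_slope h (deriv h) hxy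
    (fun z hz => (hh.hasDerivAt (hsub hz)).continuousAt.continuousWithinAt)
    (fun z hz => hh.hasDerivAt (hsub (Ioo_subset_Icc_self hz)))
  have hpos : 0 < y - x := by linarith
  have h1 : h x - h y = (y - x) * -deriv h c := by
    rw [hc2]; field_simp; ring
  have h2 := hh.monotoneOn_deriv (hsub (left_mem_Icc.mpr hxy.le))
    (hsub (Ioo_subset_Icc_self hc)) hc.1.le
  have h3 := hh.monotoneOn_deriv (hsub (Ioo_subset_Icc_self hc))
    (hsub (right_mem_Icc.mpr hxy.le)) hc.2.le
  rw [h1]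
  constructor <;> nlinarith

theorem neg_deriv_anti (hh : IsSingularityProfile h) {x y : ℝ} (hx : 0 < x) (hxy : x ≤ y)
    (hy : y < 1) : -deriv h y ≤ -deriv h x :=
  neg_le_neg (hh.monotoneOn_deriv ⟨hx, hxy.trans_lt hy⟩ ⟨hx.trans_le hxy, hy⟩ hxy)

/-- The sum of `-h'` over `q` points, one in each of `q` overlapping arcs of length `2/q`. -/
theorem abs_sum_fract_sub_le (hh : IsSingularityProfile h) {q : ℕ} (hq : 4 ≤ q) (c : ℝ)
    (k : ℕ → ℤ) (e : ℕ → ℝ) (he : ∀ j < q, 0 ≤ e j ∧ e j ≤ 1 / q)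
    (hk : ∀ i < q, ∀ j < q, (q : ℤ) ∣ k i - k j → i = j) {ξ : ℝ} (hξ0 : 0 < ξ)
    (hξ : ξ ≤ 1 / (2 * q)) (hfr : ∀ j < q, ξ ≤ Int.fract (c + k j / q + e j)) :
    |∑ j ∈ Finset.range q, -deriv h (Int.fract (c + k j / q + e j)) - q * h (1 / (2 * q))| ≤
      3 * -deriv h ξ + q * h (1 / 2) := by
  obtain ⟨n, hqn⟩ : ∃ n, q = n + 3 := ⟨q - 3, by omega⟩
  have hrange : Finset.range q = Finset.range (n + 3) := by rw [hqn]
  have hq0 : (0 : ℝ) < q := by exact_mod_cast (by omega : 0 < q)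
  have hq4 : (4 : ℝ) ≤ q := by exact_mod_cast hq
  have hqn' : (q : ℝ) = n + 3 := by rw [hqn]; push_cast; ring
  have hξ1 : ξ < 1 := by
    refine hξ.trans_lt ?_
    rw [div_lt_one (by positivity)]; linarith
  have hGξ : 0 ≤ -deriv h ξ := neg_nonneg.mpr (hh.deriv_nonpos ⟨hξ0, hξ1⟩)
  -- Once c is rounded down to the grid of step 1/q, r j is the number of the arc that contains the
  -- j-th point. The hypothesis on k makes r a permutation of {0, …, q − 1}.
  set r : ℕ → ℕ := fun j => ((k j + ⌊q * c⌋) % q).toNat with hr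
  have hrz : ∀ j, ((r j : ℕ) : ℤ) = (k j + ⌊q * c⌋) % q := fun j =>
    Int.toNat_of_nonneg (Int.emod_nonneg _ (by omega))
  have hrlt : ∀ j, r j < q := by
    intro j
    have := Int.emod_lt_of_pos (k j + ⌊q * c⌋) (show (0 : ℤ) < q by omega)
    have := hrz j
    omega
  have hrinj : Set.InjOn r (Finset.range q) := by
    intro i hi j hj hij
    refine hk i (by simpa using hi) j (by simpa using hj) ?_
    have h1 : (k i + ⌊q * c⌋) % q = (k j + ⌊q * c⌋) % q := by rw [← hrz, ← hrz, hij]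
    have h2 : (q : ℤ) ∣ (k i + ⌊q * c⌋) - (k j + ⌊q * c⌋) := Int.ModEq.dvd h1.symm
    simpa using h2
  have himage : (Finset.range q).image r = Finset.range q :=
    Finset.eq_of_subset_of_card_le
      (fun x hx => by
        obtain ⟨j, -, rfl⟩ := Finset.mem_image.mp hx
        exact Finset.mem_range.mpr (hrlt j))
      (by rw [Finset.card_image_of_injOn hrinj])
  have hsum : ∀ U : ℕ → ℝ, ∑ j ∈ Finset.range q, U (r j) = ∑ m ∈ Finset.range q, U m := by
    intro U
    conv_rhs => rw [← himage]
    rw [Finset.sum_image hrinj]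
  -- Offset of the point from the left end of its arc: the rounding error of c plus e j, each of
  -- size at most 1/q.
  set o : ℕ → ℝ := fun j => Int.fract (q * c) / q + e j with ho
  have ho0 : ∀ j < q, 0 ≤ o j := fun j hj =>
    add_nonneg (div_nonneg (Int.fract_nonneg _) hq0.le) (he j hj).1
  have ho2 : ∀ j < q, o j < 2 / q := fun j hj => by
    have h1 : Int.fract (q * c) / q < 1 / q := by
      gcongr; exact Int.fract_lt_one _
    have h2 := (he j hj).2
    have h3 : (2 : ℝ) / q = 1 / q + 1 / q := by ring
    simp only [ho]; linarith
  have hfeq : ∀ j, Int.fract (c + k j / q + e j) = Int.fract (r j / q + o j) := by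
    intro j
    rw [Int.fract_eq_fract]
    refine ⟨(k j + ⌊q * c⌋) / q, ?_⟩
    have h1 : (q : ℝ) * (((k j + ⌊q * c⌋) / q : ℤ) : ℝ) + (r j : ℝ) = k j + ⌊q * c⌋ := by
      have := Int.mul_ediv_add_emod (k j + ⌊q * c⌋) q
      rw [← hrz j] at this
      exact_mod_cast this
    have h2 : Int.fract (q * c) = q * c - ⌊q * c⌋ := rfl
    simp only [ho, h2]
    generalize ⌊(q : ℝ) * c⌋ = F at h1
    field_simp
    linear_combination -h1
  have hval : ∀ j < q, r j + 2 ≤ q → Int.fract (c + k j / q + e j) = r j / q + o j := by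
    intro j hj hrj
    rw [hfeq j, Int.fract_eq_self]
    refine ⟨add_nonneg (by positivity) (ho0 j hj), ?_⟩
    have h1 : ((r j : ℝ) + 2) / q ≤ 1 := by
      rw [div_le_one hq0]; exact_mod_cast hrj
    have h2 : ((r j : ℝ) + 2) / q = r j / q + 2 / q := by ring
    linarith [ho2 j hj]
  have hUp : ∑ j ∈ Finset.range q, -deriv h (Int.fract (c + k j / q + e j)) ≤
      3 * -deriv h ξ + q * h (1 / (2 * q)) := by
    -- Each point lies to the right of the left end of its arc, except possibly in the last arc,
    -- which may wrap around 0. There, and in arc 0, only the distance ξ is available; arc 1 is also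
    -- bounded by the value at ξ, whence the factor 3.
    set U : ℕ → ℝ := fun m => if m = 0 ∨ m = n + 2 then -deriv h ξ else -deriv h (m / q) with hU
    have h1 : ∑ j ∈ Finset.range q, -deriv h (Int.fract (c + k j / q + e j)) ≤
        ∑ m ∈ Finset.range q, U m := by
      rw [← hsum U]
      refine Finset.sum_le_sum fun j hj => ?_
      have hj' := Finset.mem_range.mp hj
      simp only [hU]
      split_ifs with hc
      · exact hh.neg_deriv_anti hξ0 (hfr j hj') (Int.fract_lt_one _)
      · push Not at hc
        have hrj := hrlt j
        have h3 : (0 : ℝ) < r j := by exact_mod_cast Nat.pos_of_ne_zero hc.1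
        refine hh.neg_deriv_anti (by positivity) ?_ (Int.fract_lt_one _)
        rw [hval j hj' (by omega)]
        linarith [ho0 j hj']
    have h2 : ∑ m ∈ Finset.range q, U m = -deriv h ξ + -deriv h ξ + -deriv h (1 / q) +
        ∑ m ∈ Finset.range n, -deriv h ((m + 2 : ℕ) / q) := by
      rw [hrange, Finset.sum_range_succ, Finset.sum_range_succ', Finset.sum_range_succ']
      have h3 : ∑ m ∈ Finset.range n, U (m + 1 + 1) =
          ∑ m ∈ Finset.range n, -deriv h ((m + 2 : ℕ) / q) :=
        Finset.sum_congr rfl fun m hm => by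
          have := Finset.mem_range.mp hm
          simp only [hU]
          rw [if_neg (by omega)]
      rw [h3]
      simp [hU]
      ring
    have h3 : -deriv h (1 / q) ≤ -deriv h ξ := by
      refine hh.neg_deriv_anti hξ0 (hξ.trans ?_) ?_
      · gcongr; linarith
      · rw [div_lt_one hq0]; linarith
    have h4 : ∑ m ∈ Finset.range n, -deriv h ((m + 2 : ℕ) / q) ≤ q * h (1 / (2 * q)) := by
      have h5 : ∀ m ∈ Finset.range n, -deriv h ((m + 2 : ℕ) / q) ≤
          q * (h (((m : ℕ) + 1 : ℕ) / q) - h (((m + 1 : ℕ) + 1 : ℕ) / q)) := by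
        intro m hm
        have hm' : (m : ℝ) < n := by exact_mod_cast Finset.mem_range.mp hm
        have h6 := (hh.slope_bounds (x := ((m : ℕ) + 1 : ℕ) / q) (y := (m + 2 : ℕ) / q)
          (by positivity) (by gcongr; omega) (by
            rw [div_lt_one hq0, hqn']; push_cast; linarith)).1
        have h7 : ((m + 2 : ℕ) : ℝ) / q - ((m : ℕ) + 1 : ℕ) / q = 1 / q := by
          push_cast; field_simp; ring
        rw [h7, one_div, inv_mul_le_iff₀ hq0] at h6
        exact h6
      refine (Finset.sum_le_sum h5).trans ?_
      rw [← Finset.mul_sum, Finset.sum_range_sub' (fun m : ℕ => h ((m + 1 : ℕ) / q))]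
      have h8 : 0 < h ((n + 1 : ℕ) / q) := hh.pos _ ⟨by positivity, by
        rw [div_lt_one hq0, hqn']; push_cast; linarith⟩
      have h9 : h ((0 + 1 : ℕ) / q) ≤ h (1 / (2 * q)) := by
        refine hh.antitoneOn ⟨by positivity, ?_⟩ ⟨by positivity, ?_⟩ ?_
        · rw [div_lt_one (by positivity)]; linarith
        · rw [div_lt_one (by positivity)]; push_cast; linarith
        · push_cast; gcongr; linarith
      gcongr
      linarith
    linarith
  have hLow : q * h (1 / (2 * q)) - 3 * -deriv h ξ - q * h (1 / 2) ≤
      ∑ j ∈ Finset.range q, -deriv h (Int.fract (c + k j / q + e j)) := by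
    -- For the lower bound the right end (m + 2)/q of the arc is used; the last three arcs are
    -- discarded because −h' ≥ 0.
    set L : ℕ → ℝ := fun m => if m < n then -deriv h ((m + 2 : ℕ) / q) else 0 with hL
    have h1 : ∑ m ∈ Finset.range q, L m ≤
        ∑ j ∈ Finset.range q, -deriv h (Int.fract (c + k j / q + e j)) := by
      rw [← hsum L]
      refine Finset.sum_le_sum fun j hj => ?_
      have hj' := Finset.mem_range.mp hj
      simp only [hL]
      split_ifs with hc
      · refine hh.neg_deriv_anti (hξ0.trans_le (hfr j hj')) ?_ ?_
        · rw [hval j hj' (by omega)]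
          have h2 : ((r j + 2 : ℕ) : ℝ) / q = r j / q + 2 / q := by push_cast; ring
          linarith [ho2 j hj']
        · have hm' : (r j : ℝ) < n := by exact_mod_cast hc
          rw [div_lt_one hq0, hqn']; push_cast; linarith
      · exact neg_nonneg.mpr (hh.deriv_nonpos ⟨hξ0.trans_le (hfr j hj'), Int.fract_lt_one _⟩)
    have h2 : ∑ m ∈ Finset.range q, L m = ∑ m ∈ Finset.range n, -deriv h ((m + 2 : ℕ) / q) := by
      rw [hrange, Finset.sum_range_add]
      have h3 : ∑ m ∈ Finset.range 3, L (n + m) = 0 :=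
        Finset.sum_eq_zero fun m _ => by simp [hL]
      rw [h3, add_zero]
      exact Finset.sum_congr rfl fun m hm => by simp [hL, Finset.mem_range.mp hm]
    have h4 : q * (h (2 / q) - h ((n + 2 : ℕ) / q)) ≤
        ∑ m ∈ Finset.range n, -deriv h ((m + 2 : ℕ) / q) := by
      have h5 : ∀ m ∈ Finset.range n,
          q * (h (((m : ℕ) + 2 : ℕ) / q) - h (((m + 1 : ℕ) + 2 : ℕ) / q)) ≤
            -deriv h ((m + 2 : ℕ) / q) := by
        intro m hm
        have hm' : (m : ℝ) + 1 ≤ n := by exact_mod_cast Finset.mem_range.mp hm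
        have h6 := (hh.slope_bounds (x := ((m : ℕ) + 2 : ℕ) / q) (y := ((m + 1 : ℕ) + 2 : ℕ) / q)
          (by positivity) (by gcongr; omega) (by
            rw [div_lt_one hq0, hqn']; push_cast; linarith)).2
        have h7 : (((m + 1 : ℕ) + 2 : ℕ) : ℝ) / q - ((m : ℕ) + 2 : ℕ) / q = 1 / q := by
          push_cast; field_simp; ring
        rwa [h7, one_div, ← div_eq_inv_mul, le_div_iff₀' hq0] at h6
      refine le_trans ?_ (Finset.sum_le_sum h5)
      rw [← Finset.mul_sum, Finset.sum_range_sub' (fun m : ℕ => h ((m + 2 : ℕ) / q))]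
      simp
    have h8 : h ((n + 2 : ℕ) / q) ≤ h (1 / 2) := by
      refine hh.antitoneOn ⟨by norm_num, by norm_num⟩ ⟨by positivity, ?_⟩ ?_
      · rw [div_lt_one hq0, hqn']; push_cast; linarith
      · rw [div_le_div_iff₀ (by norm_num) hq0, hqn']; push_cast; linarith
    -- The telescoping starts at 2/q instead of 1/(2q); the slope bound pays for the gap of length
    -- 3/(2q).
    have h9 : q * (h (1 / (2 * q)) - h (2 / q)) ≤ 3 / 2 * -deriv h ξ := by
      have h10 : 2 / (q : ℝ) < 1 := by rw [div_lt_one hq0]; linarith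
      have h11 : 2 / (q : ℝ) - 1 / (2 * q) = 3 / 2 / q := by field_simp; norm_num
      have h12 := (hh.slope_bounds (x := 1 / (2 * q)) (y := 2 / q) (by positivity)
        (by have : (0 : ℝ) < 3 / 2 / q := by positivity
            linarith) h10).2
      rw [h11] at h12
      have h13 : -deriv h (1 / (2 * q)) ≤ -deriv h ξ := hh.neg_deriv_anti hξ0 hξ (by
        rw [div_lt_one (by positivity)]; linarith)
      calc q * (h (1 / (2 * q)) - h (2 / q)) ≤ q * (3 / 2 / q * -deriv h (1 / (2 * q))) := by
            gcongr
        _ = 3 / 2 * -deriv h (1 / (2 * q)) := by field_simp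
        _ ≤ _ := by gcongr
    have h14 : q * h ((n + 2 : ℕ) / q) ≤ q * h (1 / 2) := by gcongr
    rw [mul_sub] at h9 h4
    linarith
  have : 0 < h (1 / 2) := hh.pos _ ⟨by norm_num, by norm_num⟩
  have : 0 < q * h (1 / 2) := by positivity
  rw [abs_le]
  constructor <;> linarith

/-- The sum of `-h'` along an orbit of length `q_s` of the rotation by `α`, or by `-α`. -/
theorem abs_sum_rotation_sub_le (hh : IsSingularityProfile h) {α : ℝ} (hα : Irrational α) {s : ℕ}
    (hq : 4 ≤ bestDenom α s) {σ : ℤ} (hσ : σ = 1 ∨ σ = -1) (θ : ℝ) {ξ : ℝ} (hξ0 : 0 < ξ)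
    (hξ : ξ ≤ 1 / (2 * bestDenom α s))
    (hfr : ∀ j < bestDenom α s, ξ ≤ Int.fract (θ + σ * (j * α))) :
    |∑ j ∈ Finset.range (bestDenom α s), -deriv h (Int.fract (θ + σ * (j * α))) -
        bestDenom α s * h (1 / (2 * bestDenom α s))| ≤
      3 * -deriv h ξ + bestDenom α s * h (1 / 2) := by
  set q := bestDenom α s with hqdef
  set p : ℤ := round (q * α) with hp
  have hq0 : (0 : ℝ) < q := by exact_mod_cast bestDenom_pos hα s
  have hδ : |q * α - p| ≤ 1 / q := by
    rw [hp, ← distInt_eq]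
    refine (distInt_bestDenom_le_one_div hα s).trans ?_
    gcongr
    exact (bestDenom_strictMono hα).monotone (Nat.le_succ s)
  have hk : ∀ i < q, ∀ j < q, (q : ℤ) ∣ σ * (i * p) - σ * (j * p) → i = j := by
    intro i hi j hj hd
    refine bestDenom_mul_injective hα s hi hj ?_
    rw [← hqdef, ← hp]
    rcases hσ with rfl | rfl
    · convert hd using 1; ring
    · have h1 : ((i : ℤ) - j) * p = -(-1 * (i * p) - -1 * (j * p)) := by ring
      rw [h1]
      exact dvd_neg.mpr hd
  have hσ1 : |(σ : ℝ)| = 1 := by rcases hσ with rfl | rfl <;> simp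
  have hbound : ∀ j < q, |σ * (j * (q * α - p)) / q| ≤ 1 / q := by
    intro j hj
    rw [abs_div, abs_mul, hσ1, abs_mul, abs_of_pos hq0, one_mul, Nat.abs_cast]
    have hj' : (j : ℝ) ≤ q := by exact_mod_cast hj.le
    gcongr
    calc (j : ℝ) * |q * α - p| ≤ q * (1 / q) := by gcongr
      _ = 1 := by field_simp
  -- The orbit is a rational one with step p/q perturbed by σj(qα − p)/q. These perturbations all
  -- have the same sign; if they are negative, moving the origin by −1/q brings them into [0, 1/q].
  rcases le_total 0 (σ * (q * α - p)) with hs | hs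
  · have heq : ∀ j : ℕ, θ + ((σ * (j * p) : ℤ) : ℝ) / q + σ * (j * (q * α - p)) / q =
        θ + σ * (j * α) := by
      intro j; push_cast; field_simp; ring
    have := hh.abs_sum_fract_sub_le hq θ (fun j => σ * (j * p))
      (fun j => σ * (j * (q * α - p)) / q) (fun j hj => ⟨?_, (le_abs_self _).trans (hbound j hj)⟩)
      hk hξ0 hξ (fun j hj => by rw [heq]; exact hfr j hj)
    · simpa only [heq] using this
    · refine div_nonneg ?_ hq0.le
      calc (0 : ℝ) ≤ j * (σ * (q * α - p)) := by positivity
        _ = _ := by ring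
  · have heq : ∀ j : ℕ, θ - 1 / q + ((σ * (j * p) : ℤ) : ℝ) / q +
        (1 / q + σ * (j * (q * α - p)) / q) = θ + σ * (j * α) := by
      intro j
      have : ((σ * (j * p) : ℤ) : ℝ) / q + σ * (j * (q * α - p)) / q = σ * (j * α) := by
        push_cast; field_simp; ring
      linarith
    have := hh.abs_sum_fract_sub_le hq (θ - 1 / q) (fun j => σ * (j * p))
      (fun j => 1 / q + σ * (j * (q * α - p)) / q)
      (fun j hj => ⟨by linarith [neg_abs_le (σ * (j * (q * α - p)) / q), hbound j hj], ?_⟩)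
      hk hξ0 hξ (fun j hj => by rw [heq]; exact hfr j hj)
    · simpa only [heq] using this
    · have : (σ * (j * (q * α - p)) / q : ℝ) ≤ 0 := by
        refine div_nonpos_of_nonpos_of_nonneg ?_ hq0.le
        calc (σ * (j * (q * α - p)) : ℝ) = j * (σ * (q * α - p)) := by ring
          _ ≤ 0 := mul_nonpos_of_nonneg_of_nonpos (by positivity) hs
      linarith

end IsSingularityProfile

end Profile

/-! ### The derivative of a function with singularities -/

/-- The representative in `[0, 1)` of a point of the circle. -/
noncomputable def circleFract (z : UnitAddCircle) : ℝ := (AddCircle.equivIco (1 : ℝ) 0 z : ℝ)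

theorem circleFract_coe (t : ℝ) : circleFract (t : UnitAddCircle) = Int.fract t := by
  have := AddCircle.coe_equivIco_mk_apply (1 : ℝ) t
  rw [div_one, mul_one] at this
  exact this

theorem coe_circleFract (z : UnitAddCircle) : (circleFract z : UnitAddCircle) = z :=
  (AddCircle.equivIco (1 : ℝ) 0).symm_apply_apply z

theorem circleFract_lt_one (z : UnitAddCircle) : circleFract z < 1 := by
  obtain ⟨t, rfl⟩ := QuotientAddGroup.mk_surjective z
  exact (circleFract_coe t).trans_lt (Int.fract_lt_one t)

theorem norm_le_circleFract (z : UnitAddCircle) : ‖z‖ ≤ circleFract z := by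
  obtain ⟨t, rfl⟩ := QuotientAddGroup.mk_surjective z
  refine le_trans ?_ (circleFract_coe t).ge
  change ‖(t : UnitAddCircle)‖ ≤ _
  rw [UnitAddCircle.norm_eq]
  refine (round_le t ⌊t⌋).trans (le_of_eq ?_)
  rw [Int.self_sub_floor, abs_of_nonneg (Int.fract_nonneg t)]

theorem circleFract_neg {z : UnitAddCircle} (hz : z ≠ 0) :
    circleFract (-z) = 1 - circleFract z := by
  obtain ⟨t, rfl⟩ := QuotientAddGroup.mk_surjective z
  change circleFract (-(t : UnitAddCircle)) = 1 - circleFract (t : UnitAddCircle)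
  rw [← AddCircle.coe_neg, circleFract_coe, circleFract_coe]
  refine Int.fract_neg fun h => hz ?_
  have := coe_circleFract (t : UnitAddCircle)
  rw [circleFract_coe, h] at this
  rw [← this]; rfl

theorem exists_small_coe_eq {z : UnitAddCircle} : ∃ t : ℝ, |t| = ‖z‖ ∧ (t : UnitAddCircle) = z := by
  obtain ⟨t, rfl⟩ := QuotientAddGroup.mk_surjective z
  refine ⟨t - round t, ?_, ?_⟩
  · exact (UnitAddCircle.norm_eq (x := t)).symm
  · rw [AddCircle.coe_sub]
    have : ((round t : ℝ) : UnitAddCircle) = 0 := by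
      rw [AddCircle.coe_eq_zero_iff]; exact ⟨round t, by simp⟩
    rw [this, sub_zero]

section Derivative

variable {k : ℕ} {a : Fin k → UnitAddCircle} {f : UnitAddCircle → ℝ} {h : ℝ → ℝ}
  {A B : Fin k → ℝ}

theorem circleDeriv_coe (f : UnitAddCircle → ℝ) (t : ℝ) :
    circleDeriv f (t : UnitAddCircle) = deriv (fun s : ℝ => f (s : UnitAddCircle)) t := by
  have h1 := deriv_comp_const_add (fun s : ℝ => f (s : UnitAddCircle)) t 0
  rw [add_zero] at h1
  rw [← h1]
  simp only [circleDeriv, AddCircle.coe_add]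

theorem IsC2Off.hasDerivAt (hf : IsC2Off f a) {t : ℝ} (ht : (t : UnitAddCircle) ∉ range a) :
    HasDerivAt (fun s : ℝ => f (s : UnitAddCircle)) (circleDeriv f (t : UnitAddCircle)) t := by
  rw [circleDeriv_coe]
  exact ((hf.differentiableOn (by norm_num)).differentiableAt
    ((isOpen_coe_notMem_range a).mem_nhds ht)).hasDerivAt

theorem IsC2Off.continuousAt_circleDeriv (hf : IsC2Off f a) {z : UnitAddCircle}
    (hz : z ∉ range a) : ContinuousAt (circleDeriv f) z := by
  obtain ⟨t, rfl⟩ := QuotientAddGroup.mk_surjective z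
  have h1 : ContinuousAt (deriv fun s : ℝ => f (s : UnitAddCircle)) t :=
    (hf.continuousOn_deriv_of_isOpen (isOpen_coe_notMem_range a) (by norm_num)).continuousAt
      ((isOpen_coe_notMem_range a).mem_nhds hz)
  refine QuotientAddGroup.isOpenQuotientMap_mk.continuousAt_comp_iff.mp ?_
  exact h1.congr (Eventually.of_forall fun s => (circleDeriv_coe f s).symm)

/-- Unboundedness at 0 forces a negative slope somewhere, and monotonicity of h' carries it down to
0. Without this the quotients f'/h' could be the default value 0 and say nothing about f'. -/
theorem IsSingularityProfile.exists_deriv_neg (hh : IsSingularityProfile h) :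
    ∃ r : ℝ, 0 < r ∧ r < 1 / 2 ∧ ∀ t, 0 < t → t ≤ r → deriv h t < 0 := by
  obtain ⟨r, hr, hr2, hr3⟩ := ((hh.tendsto.eventually_gt_atTop (h (1 / 2))).and
    (Ioo_mem_nhdsGT (show (0 : ℝ) < 1 / 2 by norm_num))).exists
  refine ⟨r, hr2, hr3, fun t ht htr => ?_⟩
  have h1 := (hh.slope_bounds hr2 hr3 (by norm_num)).2
  have h2 := hh.neg_deriv_anti ht htr (by linarith)
  have h3 : 0 < -deriv h r := by
    by_contra hc
    nlinarith
  linarith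

/-- The singular part, at `a i`, of the derivative. -/
noncomputable def singularPart (h : ℝ → ℝ) (A B : ℝ) (w : UnitAddCircle) : ℝ :=
  A * deriv h (circleFract w) - B * deriv h (circleFract (-w))

/-- The size of the singularity. -/
noncomputable def singularSize (h : ℝ → ℝ) (w : UnitAddCircle) : ℝ :=
  -deriv h (circleFract w) - deriv h (circleFract (-w))

theorem IsSingularityProfile.neg_deriv_circleFract_nonneg (hh : IsSingularityProfile h)
    {w : UnitAddCircle} (hw : w ≠ 0) : 0 ≤ -deriv h (circleFract w) :=
  neg_nonneg.mpr (hh.deriv_nonpos ⟨(norm_pos_iff.mpr hw).trans_le (norm_le_circleFract w),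
    circleFract_lt_one w⟩)

theorem IsSingularityProfile.neg_deriv_circleFract_le (hh : IsSingularityProfile h)
    {w : UnitAddCircle} {r : ℝ} (hr : 0 < r) (hw : r ≤ ‖w‖) :
    -deriv h (circleFract w) ≤ -deriv h r :=
  hh.neg_deriv_anti hr (hw.trans (norm_le_circleFract w)) (circleFract_lt_one w)

/-- At a singularity the limits of f'/h' leave an error of at most η|h'| on each side, while the
other singular parts are bounded there. Elsewhere f' and all singular parts are locally bounded. The
statement is local so that compactness can globalise it. -/
theorem HasSingularitiesOfType.exists_local_bound (hf : HasSingularitiesOfType f a h A B) {η : ℝ}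
    (hη : 0 < η) (z₀ : UnitAddCircle) : ∃ K : ℝ, ∀ᶠ z in 𝓝 z₀, z ∉ range a →
      |circleDeriv f z - ∑ i, singularPart h (A i) (B i) (z - a i)| ≤
        η * ∑ i, singularSize h (z - a i) + K := by
  have hh := hf.profile
  have hsize : ∀ w : UnitAddCircle, w ≠ 0 → 0 ≤ singularSize h w := fun w hw => by
    have h1 := hh.neg_deriv_circleFract_nonneg hw
    have h2 := hh.neg_deriv_circleFract_nonneg (neg_ne_zero.mpr hw)
    simp only [singularSize]; linarith
  have hloc : ∀ i, ∃ K : ℝ, 0 ≤ K ∧ ∀ᶠ z in 𝓝 z₀, a i ≠ z₀ →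
      |singularPart h (A i) (B i) (z - a i)| ≤ K := by
    intro i
    by_cases hi : a i = z₀
    · exact ⟨0, le_rfl, Eventually.of_forall fun z hz => absurd hi hz⟩
    have hr : 0 < ‖z₀ - a i‖ / 2 := half_pos (norm_pos_iff.mpr (sub_ne_zero.mpr (Ne.symm hi)))
    set r := ‖z₀ - a i‖ / 2 with hrdef
    have hr1 : r < 1 := by
      have := (norm_le_circleFract (z₀ - a i)).trans_lt (circleFract_lt_one _)
      linarith
    have hG : 0 ≤ -deriv h r := neg_nonneg.mpr (hh.deriv_nonpos ⟨hr, hr1⟩)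
    refine ⟨(A i + B i) * -deriv h r,
      mul_nonneg (add_nonneg (hf.nonneg_right i) (hf.nonneg_left i)) hG, ?_⟩
    have hcont : ContinuousAt (fun z : UnitAddCircle => ‖z - a i‖) z₀ := by fun_prop
    filter_upwards [hcont.eventually (lt_mem_nhds (show r < ‖z₀ - a i‖ by linarith))] with z hz _
    have hne : z - a i ≠ 0 := norm_pos_iff.mp (hr.trans hz)
    have h1 := hh.neg_deriv_circleFract_le hr hz.le
    have h2 := hh.neg_deriv_circleFract_le (w := -(z - a i)) hr (by rw [norm_neg]; exact hz.le)
    have h3 := hh.neg_deriv_circleFract_nonneg hne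
    have h4 := hh.neg_deriv_circleFract_nonneg (neg_ne_zero.mpr hne)
    have h5 := mul_le_mul_of_nonneg_left h1 (hf.nonneg_right i)
    have h6 := mul_le_mul_of_nonneg_left h2 (hf.nonneg_left i)
    have h7 := mul_nonneg (hf.nonneg_right i) h3
    have h8 := mul_nonneg (hf.nonneg_left i) h4
    simp only [singularPart]
    rw [abs_le]
    constructor <;> linarith
  choose K hK0 hK using hloc
  have hKall : ∀ᶠ z in 𝓝 z₀, ∀ i, a i ≠ z₀ →
      |singularPart h (A i) (B i) (z - a i)| ≤ K i := eventually_all.mpr hK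
  by_cases hz₀ : z₀ ∈ range a
  · obtain ⟨i₀, rfl⟩ := hz₀
    obtain ⟨r, hr0, hr2, hr⟩ := hh.exists_deriv_neg
    have hlim : ∀ᶠ t : ℝ in 𝓝[>] (0 : ℝ),
        |circleDeriv f (a i₀ + (t : UnitAddCircle)) / deriv h t - A i₀| < η ∧
          |circleDeriv f (a i₀ - (t : UnitAddCircle)) / deriv h t - -B i₀| < η :=
      ((Metric.tendsto_nhds.mp (hf.right i₀)) η hη).and
        ((Metric.tendsto_nhds.mp (hf.left i₀)) η hη)
    obtain ⟨r', hr'0, hr'⟩ := mem_nhdsGT_iff_exists_Ioo_subset.mp hlim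
    rw [mem_Ioi] at hr'0
    have hconv : ∀ t, 0 < t → t < r → ∀ D c : ℝ, |D / deriv h t - c| < η →
        |D - c * deriv h t| ≤ η * -deriv h t := by
      intro t ht htr D c hD
      have hneg := hr t ht htr.le
      have h1 : D - c * deriv h t = (D / deriv h t - c) * deriv h t := by
        field_simp [hneg.ne]
      rw [h1, abs_mul, abs_of_neg hneg]
      exact mul_le_mul_of_nonneg_right hD.le (by linarith)
    -- Within distance r < 1/2 of the singularity, the representative seen from the opposite side
    -- exceeds 1/2, so that branch is bounded by −h'(1/2).
    have hG2 : 0 ≤ -deriv h (1 / 2) := neg_nonneg.mpr (hh.deriv_nonpos ⟨by norm_num, by norm_num⟩)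
    have hball : ∀ᶠ z in 𝓝 (a i₀), ‖z - a i₀‖ < min r r' := by
      have hcont : ContinuousAt (fun z : UnitAddCircle => ‖z - a i₀‖) (a i₀) := by fun_prop
      exact hcont.eventually (gt_mem_nhds (by simp [hr0, hr'0]))
    have hsplit : ∀ c : Fin k → ℝ, ∑ i, c i = c i₀ + ∑ i ∈ Finset.univ.erase i₀, c i := fun c =>
      (Finset.add_sum_erase _ c (Finset.mem_univ i₀)).symm
    refine ⟨(A i₀ + B i₀) * -deriv h (1 / 2) + ∑ i, K i, ?_⟩
    filter_upwards [hKall, hball] with z hz1 hz2 hz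
    have hrest : |∑ i ∈ Finset.univ.erase i₀, singularPart h (A i) (B i) (z - a i)| ≤
        ∑ i, K i := by
      refine (Finset.abs_sum_le_sum_abs _ _).trans ?_
      refine (Finset.sum_le_sum fun i hi => hz1 i
        (hf.injective.ne (Finset.ne_of_mem_erase hi))).trans ?_
      exact Finset.sum_le_sum_of_subset_of_nonneg (Finset.erase_subset _ _) fun i _ _ => hK0 i
    have hsz : singularSize h (z - a i₀) ≤ ∑ i, singularSize h (z - a i) :=
      Finset.single_le_sum (f := fun i => singularSize h (z - a i))
        (fun i _ => hsize _ (sub_ne_zero.mpr fun h => hz ⟨i, h.symm⟩)) (Finset.mem_univ i₀)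
    have hne : z - a i₀ ≠ 0 := sub_ne_zero.mpr fun h => hz ⟨i₀, h.symm⟩
    have hmain : |circleDeriv f z - singularPart h (A i₀) (B i₀) (z - a i₀)| ≤
        η * singularSize h (z - a i₀) + (A i₀ + B i₀) * -deriv h (1 / 2) := by
      have hp1 := hh.neg_deriv_circleFract_nonneg hne
      have hp2 := hh.neg_deriv_circleFract_nonneg (neg_ne_zero.mpr hne)
      have hA := hf.nonneg_right i₀
      have hB := hf.nonneg_left i₀
      obtain ⟨t, ht1, ht2⟩ := exists_small_coe_eq (z := z - a i₀)
      rw [← ht1, lt_min_iff] at hz2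
      have ht0 : t ≠ 0 := by
        rintro rfl
        exact hne (by rw [← ht2]; rfl)
      have hfr := circleFract_neg hne
      rcases lt_or_gt_of_ne ht0 with hneg | hpos
      · rw [abs_of_neg hneg] at hz2
        have hz3 : z = a i₀ - ((-t : ℝ) : UnitAddCircle) := by
          rw [AddCircle.coe_neg, ht2]; abel
        have hfr2 : circleFract (-(z - a i₀)) = -t := by
          rw [← ht2, ← AddCircle.coe_neg, circleFract_coe, Int.fract_eq_self]
          constructor <;> linarith
        have h1 := hconv (-t) (by linarith) hz2.1 _ _ (hr' ⟨by linarith, hz2.2⟩).2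
        rw [← hz3] at h1
        have h2 : -deriv h (circleFract (z - a i₀)) ≤ -deriv h (1 / 2) :=
          hh.neg_deriv_anti (by norm_num) (by linarith) (circleFract_lt_one _)
        have h3 := mul_le_mul_of_nonneg_left h2 hA
        have h4 := mul_nonneg hA hp1
        have h5 := mul_nonneg hB hG2
        have h6 := mul_nonneg hη.le hp1
        simp only [singularPart, singularSize, hfr2] at *
        rw [abs_le] at h1 ⊢
        constructor <;> nlinarith
      · rw [abs_of_pos hpos] at hz2
        have hz3 : z = a i₀ + (t : UnitAddCircle) := by
          rw [ht2]; abel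
        have hfr2 : circleFract (z - a i₀) = t := by
          rw [← ht2, circleFract_coe, Int.fract_eq_self]
          constructor <;> linarith
        have h1 := hconv t hpos hz2.1 _ _ (hr' ⟨hpos, hz2.2⟩).1
        rw [← hz3] at h1
        have h2 : -deriv h (circleFract (-(z - a i₀))) ≤ -deriv h (1 / 2) :=
          hh.neg_deriv_anti (by norm_num) (by linarith) (circleFract_lt_one _)
        have h3 := mul_le_mul_of_nonneg_left h2 hB
        have h4 := mul_nonneg hB hp2
        have h5 := mul_nonneg hA hG2
        have h6 := mul_nonneg hη.le hp2
        simp only [singularPart, singularSize, hfr2] at *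
        rw [abs_le] at h1 ⊢
        constructor <;> nlinarith
    rw [hsplit]
    have h1 := mul_le_mul_of_nonneg_left hsz hη.le
    rw [abs_le] at hmain hrest ⊢
    constructor <;> linarith
  · have hcont := hf.contDiff.continuousAt_circleDeriv hz₀
    refine ⟨|circleDeriv f z₀| + 1 + ∑ i, K i, ?_⟩
    filter_upwards [hKall, hcont.abs.eventually
      (gt_mem_nhds (show |circleDeriv f z₀| < |circleDeriv f z₀| + 1 by linarith))] with z hz1 hz2 hz
    have h1 : |∑ i, singularPart h (A i) (B i) (z - a i)| ≤ ∑ i, K i :=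
      (Finset.abs_sum_le_sum_abs _ _).trans
        (Finset.sum_le_sum fun i _ => hz1 i fun h => hz₀ ⟨i, h⟩)
    have h2 : 0 ≤ η * ∑ i, singularSize h (z - a i) := mul_nonneg hη.le
      (Finset.sum_nonneg fun i _ => hsize _ (sub_ne_zero.mpr fun h => hz ⟨i, h.symm⟩))
    have h3 := abs_sub (circleDeriv f z) (∑ i, singularPart h (A i) (B i) (z - a i))
    linarith

/-- Up to a bounded error and a small proportion of the size of the singularities, the derivative
is the sum of its singular parts. -/
theorem HasSingularitiesOfType.exists_bound (hf : HasSingularitiesOfType f a h A B) {η : ℝ}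
    (hη : 0 < η) : ∃ K : ℝ, ∀ z ∉ range a,
      |circleDeriv f z - ∑ i, singularPart h (A i) (B i) (z - a i)| ≤
        η * ∑ i, singularSize h (z - a i) + K := by
  have := isCompact_univ.induction_on (X := UnitAddCircle)
    (p := fun s => ∃ K : ℝ, ∀ z ∈ s, z ∉ range a →
      |circleDeriv f z - ∑ i, singularPart h (A i) (B i) (z - a i)| ≤
        η * ∑ i, singularSize h (z - a i) + K)
    ⟨0, by simp⟩ (fun s t hst ⟨K, hK⟩ => ⟨K, fun z hz => hK z (hst hz)⟩)
    (fun s t ⟨K, hK⟩ ⟨K', hK'⟩ => ⟨max K K', fun z hz hza => by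
      rcases hz with hz | hz
      · exact (hK z hz hza).trans (by gcongr; exact le_max_left _ _)
      · exact (hK' z hz hza).trans (by gcongr; exact le_max_right _ _)⟩)
    (fun z _ => by
      obtain ⟨K, hK⟩ := hf.exists_local_bound hη z
      exact ⟨_, mem_nhdsWithin_of_mem_nhds hK, K, fun w hw => hw⟩)
  obtain ⟨K, hK⟩ := this
  exact ⟨K, fun z hz => hK z (mem_univ z) hz⟩

end Derivative

/-! ### Birkhoff sums of the derivative over a block of length `q_s` -/

/-- The value `h(1/(2q_s))`. -/
noncomputable def profileHeight (α : ℝ) (h : ℝ → ℝ) (s : ℕ) : ℝ :=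
  h (1 / (2 * (bestDenom α s : ℝ)))

/-- The order of growth `q_s h(1/(2q_s))` of the Birkhoff sums of length `q_s` of the
derivative. -/
noncomputable def profileScale (α : ℝ) (h : ℝ → ℝ) (s : ℕ) : ℝ :=
  (bestDenom α s : ℝ) * profileHeight α h s

section Scale

variable {α : ℝ} {h : ℝ → ℝ}

theorem tendsto_bestDenom (hα : Irrational α) :
    Tendsto (fun s => (bestDenom α s : ℝ)) atTop atTop :=
  tendsto_natCast_atTop_atTop.comp (bestDenom_strictMono hα).tendsto_atTop

theorem half_inv_bestDenom_mem (hα : Irrational α) (s : ℕ) :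
    1 / (2 * (bestDenom α s : ℝ)) ∈ Ioo (0 : ℝ) 1 := by
  have h1 : (1 : ℝ) ≤ bestDenom α s := by exact_mod_cast bestDenom_pos hα s
  refine ⟨by positivity, ?_⟩
  rw [div_lt_one (by positivity)]; linarith

theorem profileHeight_pos (hα : Irrational α) (hh : IsSingularityProfile h) (s : ℕ) :
    0 < profileHeight α h s := hh.pos _ (half_inv_bestDenom_mem hα s)

theorem profileHeight_mono (hα : Irrational α) (hh : IsSingularityProfile h) :
    Monotone (profileHeight α h) := by
  intro s t hst
  refine hh.antitoneOn (half_inv_bestDenom_mem hα t) (half_inv_bestDenom_mem hα s) ?_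
  have h1 : (0 : ℝ) < bestDenom α s := by exact_mod_cast bestDenom_pos hα s
  have h2 : (bestDenom α s : ℝ) ≤ bestDenom α t := by
    exact_mod_cast (bestDenom_strictMono hα).monotone hst
  gcongr

theorem profileScale_pos (hα : Irrational α) (hh : IsSingularityProfile h) (s : ℕ) :
    0 < profileScale α h s :=
  mul_pos (by exact_mod_cast bestDenom_pos hα s) (profileHeight_pos hα hh s)

theorem profileScale_mono (hα : Irrational α) (hh : IsSingularityProfile h) :
    Monotone (profileScale α h) := by
  intro s t hst
  have h2 : (bestDenom α s : ℝ) ≤ bestDenom α t := by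
    exact_mod_cast (bestDenom_strictMono hα).monotone hst
  exact mul_le_mul h2 (profileHeight_mono hα hh hst) (profileHeight_pos hα hh s).le (by positivity)

theorem tendsto_profileHeight (hα : Irrational α) (hh : IsSingularityProfile h) :
    Tendsto (profileHeight α h) atTop atTop := by
  refine hh.tendsto.comp (tendsto_nhdsWithin_iff.mpr ⟨?_, Eventually.of_forall fun s =>
    (half_inv_bestDenom_mem hα s).1⟩)
  exact tendsto_const_nhds.div_atTop ((tendsto_bestDenom hα).const_mul_atTop (by norm_num))

theorem tendsto_profileScale (hα : Irrational α) (hh : IsSingularityProfile h) :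
    Tendsto (profileScale α h) atTop atTop :=
  (tendsto_bestDenom hα).atTop_mul_atTop₀ (tendsto_profileHeight hα hh)

end Scale

section Block

variable {k : ℕ} {a : Fin k → UnitAddCircle} {f : UnitAddCircle → ℝ} {h : ℝ → ℝ}
  {A B : Fin k → ℝ} {α : ℝ}

/-- Left branches are measured by −w, whose orbit is an orbit of the rotation by −α; this is the
purpose of the sign σ in `abs_sum_rotation_sub_le`. -/
theorem IsSingularityProfile.abs_sum_circleFract_sub_le (hh : IsSingularityProfile h)
    (hα : Irrational α) {s : ℕ} (hq : 4 ≤ bestDenom α s) {ξ : ℝ} (hξ0 : 0 < ξ)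
    (hξ : ξ ≤ 1 / (2 * bestDenom α s)) (θ b : UnitAddCircle)
    (hfar : ∀ j < bestDenom α s, ξ ≤ ‖θ + (((j : ℝ) * α : ℝ) : UnitAddCircle) - b‖) :
    |∑ j ∈ Finset.range (bestDenom α s),
        -deriv h (circleFract (θ + (((j : ℝ) * α : ℝ) : UnitAddCircle) - b)) -
          profileScale α h s| ≤ 3 * -deriv h ξ + bestDenom α s * h (1 / 2) ∧
    |∑ j ∈ Finset.range (bestDenom α s),
        -deriv h (circleFract (-(θ + (((j : ℝ) * α : ℝ) : UnitAddCircle) - b))) -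
          profileScale α h s| ≤ 3 * -deriv h ξ + bestDenom α s * h (1 / 2) := by
  obtain ⟨t, rfl⟩ := QuotientAddGroup.mk_surjective θ
  obtain ⟨u, rfl⟩ := QuotientAddGroup.mk_surjective b
  have e1 : ∀ j : ℕ, (t : UnitAddCircle) + (((j : ℝ) * α : ℝ) : UnitAddCircle) - (u : UnitAddCircle)
      = ((t - u + (1 : ℤ) * (j * α) : ℝ) : UnitAddCircle) := by
    intro j
    rw [← AddCircle.coe_add, ← AddCircle.coe_sub]
    congr 1; push_cast; ring
  have e2 : ∀ j : ℕ, -((t : UnitAddCircle) + (((j : ℝ) * α : ℝ) : UnitAddCircle) -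
      (u : UnitAddCircle)) = ((u - t + (-1 : ℤ) * (j * α) : ℝ) : UnitAddCircle) := by
    intro j
    rw [← AddCircle.coe_add, ← AddCircle.coe_sub, ← AddCircle.coe_neg]
    congr 1; push_cast; ring
  have h1 := hh.abs_sum_rotation_sub_le hα hq (Or.inl rfl) (t - u) hξ0 hξ fun j hj => by
    have := (hfar j hj).trans (norm_le_circleFract _)
    erw [e1 j, circleFract_coe] at this
    exact this
  have h2 := hh.abs_sum_rotation_sub_le hα hq (Or.inr rfl) (u - t) hξ0 hξ fun j hj => by
    have h3 := hfar j hj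
    rw [← norm_neg] at h3
    have := h3.trans (norm_le_circleFract _)
    erw [e2 j, circleFract_coe] at this
    exact this
  constructor
  · convert h1 using 5 with j hj
    · erw [e1 j, circleFract_coe]
    · rfl
  · convert h2 using 5 with j hj
    · erw [e2 j, circleFract_coe]
    · rfl

/-- Over a block each right branch contributes about −A_i H and each left branch about B_i H. The
error terms are small relative to H: −h'(ξ) by assumption on ξ, and the terms of order q because
h(1/(2q)) → ∞. In absolute values the branches no longer cancel, whence the second bound. -/
theorem HasSingularitiesOfType.block_bounds (hf : HasSingularitiesOfType f a h A B)
    (hα : Irrational α) {η : ℝ} (hη : 0 < η) : ∃ ρ : ℝ, 0 < ρ ∧ ∀ᶠ s in atTop, ∀ ξ : ℝ, 0 < ξ →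
      ξ ≤ 1 / (2 * bestDenom α s) → -deriv h ξ ≤ ρ * profileScale α h s → ∀ θ : UnitAddCircle,
      (∀ j < bestDenom α s, ∀ i, ξ ≤ ‖θ + (((j : ℝ) * α : ℝ) : UnitAddCircle) - a i‖) →
      |∑ j ∈ Finset.range (bestDenom α s),
          circleDeriv f (θ + (((j : ℝ) * α : ℝ) : UnitAddCircle)) +
            (∑ i, A i - ∑ i, B i) * profileScale α h s| ≤ η * profileScale α h s ∧
      ∑ j ∈ Finset.range (bestDenom α s),
          |circleDeriv f (θ + (((j : ℝ) * α : ℝ) : UnitAddCircle))| ≤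
            (η + 2 * (∑ i, A i + ∑ i, B i)) * profileScale α h s := by
  have hh := hf.profile
  set SA := ∑ i, A i with hSA
  set SB := ∑ i, B i with hSB
  have hSA0 : 0 ≤ SA := Finset.sum_nonneg fun i _ => hf.nonneg_right i
  have hSB0 : 0 ≤ SB := Finset.sum_nonneg fun i _ => hf.nonneg_left i
  -- The 2k branch sums are at most 2H each, so this proportion costs at most ηH/2; the bounded
  -- error K costs ηH/4 more. The +1 covers k = 0.
  obtain ⟨K, hK⟩ := hf.exists_bound (η := η / (8 * (k + 1))) (by positivity)
  set η₁ := η / (8 * (k + 1)) with hη₁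
  -- Relative error allowed in each branch sum: at most 1, so that the sum stays below 2H, and small
  -- enough to cost at most ηH/4 after weighting by the coefficients.
  set τ := min 1 (η / (4 * (1 + SA + SB))) with hτ
  have hτ0 : 0 < τ := by positivity
  have hτ1 : τ ≤ 1 := min_le_left _ _
  have hτ2 : (1 + SA + SB) * τ ≤ η / 4 := by
    have : τ ≤ η / (4 * (1 + SA + SB)) := min_le_right _ _
    rw [le_div_iff₀ (by positivity)] at this
    linarith
  -- Half of the error τH is reserved for 3·(−h'(ξ)), the other half for q h(1/2).
  refine ⟨τ / 6, by positivity, ?_⟩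
  have hH := tendsto_profileHeight hα hh
  filter_upwards [(bestDenom_strictMono hα).tendsto_atTop.eventually_ge_atTop 4,
    hH.eventually_ge_atTop (2 * h (1 / 2) / τ), hH.eventually_ge_atTop (K / (η / 4))]
    with s hq hs1 hs2 ξ hξ0 hξ hξG θ hfar
  set q := bestDenom α s with hqdef
  set H := profileScale α h s with hHdef
  have hH0 : 0 < H := profileScale_pos hα hh s
  have hq0 : (0 : ℝ) < q := by exact_mod_cast bestDenom_pos hα s
  have hKq : q * K ≤ η / 4 * H := by
    rw [div_le_iff₀ (by positivity)] at hs2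
    calc q * K ≤ q * (profileHeight α h s * (η / 4)) := by gcongr
      _ = η / 4 * H := by rw [hHdef, profileScale]; ring
  have herr : 3 * -deriv h ξ + q * h (1 / 2) ≤ τ * H := by
    rw [div_le_iff₀ hτ0] at hs1
    have : q * (2 * h (1 / 2)) ≤ q * (profileHeight α h s * τ) := by gcongr
    have h3 : q * (profileHeight α h s * τ) = τ * H := by rw [hHdef, profileScale]; ring
    linarith
  set x : ℕ → UnitAddCircle := fun j => θ + (((j : ℝ) * α : ℝ) : UnitAddCircle) with hx
  set P : Fin k → ℝ := fun i => ∑ j ∈ Finset.range q, -deriv h (circleFract (x j - a i)) with hP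
  set M : Fin k → ℝ := fun i => ∑ j ∈ Finset.range q, -deriv h (circleFract (-(x j - a i))) with hM
  have hPM : ∀ i, |P i - H| ≤ τ * H ∧ |M i - H| ≤ τ * H := fun i => by
    have := hh.abs_sum_circleFract_sub_le hα hq hξ0 hξ θ (a i) fun j hj => hfar j hj i
    exact ⟨this.1.trans herr, this.2.trans herr⟩
  have hnotin : ∀ j ∈ Finset.range q, x j ∉ range a := by
    rintro j hj ⟨i, hi⟩
    have := hfar j (Finset.mem_range.mp hj) i
    rw [show θ + (((j : ℝ) * α : ℝ) : UnitAddCircle) = x j from rfl, ← hi, sub_self,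
      norm_zero] at this
    linarith
  have hdiff : ∑ j ∈ Finset.range q,
      |circleDeriv f (x j) - ∑ i, singularPart h (A i) (B i) (x j - a i)| ≤ 3 / 4 * η * H := by
    have h1 : ∑ j ∈ Finset.range q, ∑ i, singularSize h (x j - a i) = ∑ i, (P i + M i) := by
      rw [Finset.sum_comm]
      refine Finset.sum_congr rfl fun i _ => ?_
      rw [hP, hM, ← Finset.sum_add_distrib]
      exact Finset.sum_congr rfl fun j _ => by simp only [singularSize]; ring
    have h2 : ∑ i, (P i + M i) ≤ k * (4 * H) := by
      have h3 : ∀ i ∈ (Finset.univ : Finset (Fin k)), P i + M i ≤ 4 * H := fun i _ => by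
        have h4 := (abs_le.mp (hPM i).1).2
        have h5 := (abs_le.mp (hPM i).2).2
        have h6 : τ * H ≤ 1 * H := by gcongr
        linarith
      simpa using Finset.sum_le_card_nsmul _ _ _ h3
    calc _ ≤ ∑ j ∈ Finset.range q, (η₁ * ∑ i, singularSize h (x j - a i) + K) :=
          Finset.sum_le_sum fun j hj => hK _ (hnotin j hj)
      _ = η₁ * ∑ i, (P i + M i) + q * K := by
          rw [Finset.sum_add_distrib, ← Finset.mul_sum, h1]; simp
      _ ≤ η₁ * (k * (4 * H)) + η / 4 * H := by gcongr
      _ ≤ 1 / 2 * η * H + η / 4 * H := by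
          refine add_le_add ?_ le_rfl
          have h4 : η₁ * (k * (4 * H)) = η * H / 2 * (k / (k + 1)) := by
            rw [hη₁]; field_simp; ring
          have h5 : (k : ℝ) / (k + 1) ≤ 1 := by
            rw [div_le_one (by positivity)]; linarith
          rw [h4]
          calc η * H / 2 * (k / (k + 1)) ≤ η * H / 2 * 1 := by gcongr
            _ = _ := by ring
      _ = _ := by ring
  have hsing : ∑ j ∈ Finset.range q, ∑ i, singularPart h (A i) (B i) (x j - a i) =
      ∑ i, (-A i * P i + B i * M i) := by
    rw [Finset.sum_comm]
    refine Finset.sum_congr rfl fun i _ => ?_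
    rw [hP, hM, Finset.mul_sum, Finset.mul_sum, ← Finset.sum_add_distrib]
    exact Finset.sum_congr rfl fun j _ => by simp only [singularPart]; ring
  constructor
  · have h1 : ∑ i, (-A i * P i + B i * M i) + (SA - SB) * H =
        ∑ i, (-A i * (P i - H) + B i * (M i - H)) := by
      have : ∀ i, -A i * (P i - H) + B i * (M i - H) =
          (-A i * P i + B i * M i) + (A i * H - B i * H) := fun i => by ring
      rw [Finset.sum_congr rfl fun i _ => this i,
        Finset.sum_add_distrib (f := fun i => -A i * P i + B i * M i)
          (g := fun i => A i * H - B i * H), Finset.sum_sub_distrib, ← Finset.sum_mul, ← Finset.sum_mul]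
      ring
    have h2 : |∑ i, (-A i * (P i - H) + B i * (M i - H))| ≤ (SA + SB) * (τ * H) := by
      rw [hSA, hSB, ← Finset.sum_add_distrib, Finset.sum_mul]
      refine (Finset.abs_sum_le_sum_abs _ _).trans (Finset.sum_le_sum fun i _ => ?_)
      refine (abs_add_le _ _).trans ?_
      rw [abs_mul, abs_mul, abs_neg, abs_of_nonneg (hf.nonneg_right i),
        abs_of_nonneg (hf.nonneg_left i), add_mul]
      exact add_le_add (mul_le_mul_of_nonneg_left (hPM i).1 (hf.nonneg_right i))
        (mul_le_mul_of_nonneg_left (hPM i).2 (hf.nonneg_left i))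
    have h3 : |∑ j ∈ Finset.range q, circleDeriv f (x j) -
        ∑ j ∈ Finset.range q, ∑ i, singularPart h (A i) (B i) (x j - a i)| ≤ 3 / 4 * η * H := by
      rw [← Finset.sum_sub_distrib]
      exact (Finset.abs_sum_le_sum_abs _ _).trans hdiff
    rw [hsing] at h3
    have h4 : (SA + SB) * (τ * H) ≤ η / 4 * H := by
      have : (SA + SB) * τ ≤ η / 4 := by linarith
      calc (SA + SB) * (τ * H) = (SA + SB) * τ * H := by ring
        _ ≤ _ := by gcongr
    rw [← h1] at h2
    rw [abs_le] at h2 h3 ⊢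
    constructor <;> linarith
  · have h1 : ∑ j ∈ Finset.range q, |∑ i, singularPart h (A i) (B i) (x j - a i)| ≤
        ∑ i, (A i * P i + B i * M i) := by
      have : ∑ i, (A i * P i + B i * M i) = ∑ j ∈ Finset.range q,
          ∑ i, (A i * -deriv h (circleFract (x j - a i)) +
            B i * -deriv h (circleFract (-(x j - a i)))) := by
        rw [Finset.sum_comm]
        refine Finset.sum_congr rfl fun i _ => ?_
        rw [hP, hM, Finset.mul_sum, Finset.mul_sum, ← Finset.sum_add_distrib]
      rw [this]
      refine Finset.sum_le_sum fun j hj => (Finset.abs_sum_le_sum_abs _ _).trans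
        (Finset.sum_le_sum fun i _ => ?_)
      have hne : x j - a i ≠ 0 := sub_ne_zero.mpr fun h => hnotin j hj ⟨i, h.symm⟩
      have h3 := mul_nonneg (hf.nonneg_right i) (hh.neg_deriv_circleFract_nonneg hne)
      have h4 := mul_nonneg (hf.nonneg_left i)
        (hh.neg_deriv_circleFract_nonneg (neg_ne_zero.mpr hne))
      simp only [singularPart]
      rw [abs_le]
      constructor <;> linarith
    have h2 : ∑ i, (A i * P i + B i * M i) ≤ (SA + SB) * (2 * H) := by
      rw [hSA, hSB, ← Finset.sum_add_distrib, Finset.sum_mul]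
      refine Finset.sum_le_sum fun i _ => ?_
      have h4 := (abs_le.mp (hPM i).1).2
      have h5 := (abs_le.mp (hPM i).2).2
      have h6 : τ * H ≤ 1 * H := by gcongr
      rw [add_mul]
      exact add_le_add (mul_le_mul_of_nonneg_left (by linarith) (hf.nonneg_right i))
        (mul_le_mul_of_nonneg_left (by linarith) (hf.nonneg_left i))
    have h3 : ∑ j ∈ Finset.range q, |circleDeriv f (x j)| ≤
        ∑ j ∈ Finset.range q,
          |circleDeriv f (x j) - ∑ i, singularPart h (A i) (B i) (x j - a i)| +
        ∑ j ∈ Finset.range q, |∑ i, singularPart h (A i) (B i) (x j - a i)| := by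
      rw [← Finset.sum_add_distrib]
      refine Finset.sum_le_sum fun j _ => ?_
      have := abs_add_le (circleDeriv f (x j) - ∑ i, singularPart h (A i) (B i) (x j - a i))
        (∑ i, singularPart h (A i) (B i) (x j - a i))
      rwa [sub_add_cancel] at this
    have : 0 < η * H := by positivity
    linarith

end Block

/-! ### A pigeonhole argument for partial sums -/

section Pigeonhole

/-- If all sums of `v` of length `ℓ` are large and its total variation is bounded, then there is a
long window on which the partial sums are large and almost constant, and on which `w` has no more
than its share of mass. -/
theorem exists_stable_window {v w : ℕ → ℝ} (hw : ∀ j, 0 ≤ w j) {J ℓ L : ℕ} (hJ : 2 ≤ J)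
    (hJL : J * L ≤ ℓ) {V Λ c : ℝ} (hV0 : 0 < V) (hΛ0 : 0 < Λ)
    (hV : ∑ j ∈ Finset.range (2 * ℓ), |v j| ≤ V) (hΛ : ∑ j ∈ Finset.range (2 * ℓ), w j ≤ Λ)
    (hc : ∀ n ≤ ℓ, 2 * c ≤ |∑ j ∈ Finset.range (n + ℓ), v j - ∑ j ∈ Finset.range n, v j|) :
    ∃ M : ℕ, L ≤ M ∧ M + L ≤ 2 * ℓ ∧ c ≤ |∑ j ∈ Finset.range M, v j| ∧
      (∀ n, M ≤ n → n ≤ M + L →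
        |∑ j ∈ Finset.range n, v j - ∑ j ∈ Finset.range M, v j| ≤ 2 * V / (J - 1)) ∧
      ∑ j ∈ Finset.range (M + L), w j - ∑ j ∈ Finset.range M, w j ≤ 2 * Λ / (J - 1) := by
  set g : ℕ → ℝ := fun n => ∑ j ∈ Finset.range n, v j with hg
  set U : ℕ → ℝ := fun n => ∑ j ∈ Finset.range n, |v j| with hU
  set Q : ℕ → ℝ := fun n => ∑ j ∈ Finset.range n, w j with hQ
  have hUm : Monotone U := monotone_nat_of_le_succ fun n => by
    simp only [hU, Finset.sum_range_succ]; linarith [abs_nonneg (v n)]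
  have hQm : Monotone Q := monotone_nat_of_le_succ fun n => by
    simp only [hQ, Finset.sum_range_succ]; linarith [hw n]
  have hgU : ∀ m n, m ≤ n → |g n - g m| ≤ U n - U m := by
    intro m n hmn
    simp only [hg, hU]
    rw [← Finset.sum_Ico_eq_sub _ hmn, ← Finset.sum_Ico_eq_sub _ hmn]
    exact Finset.abs_sum_le_sum_abs _ _
  -- Variation and weight, each normalised to total mass at most 1, so that one pigeonhole controls
  -- both.
  set E : ℕ → ℝ := fun n => U n / V + Q n / Λ with hE
  have hEm : Monotone E := fun m n hmn => by
    have h1 := hUm hmn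
    have h2 := hQm hmn
    simp only [hE]; gcongr
  have hE2 : E (2 * ℓ) ≤ 2 := by
    have h1 : U (2 * ℓ) / V ≤ 1 := (div_le_one hV0).mpr hV
    have h2 : Q (2 * ℓ) / Λ ≤ 1 := (div_le_one hΛ0).mpr hΛ
    simp only [hE]; linarith
  have hE0 : E 0 = 0 := by simp [hE, hU, hQ]
  have hJ' : (0 : ℝ) < (J : ℝ) - 1 := by
    have : (2 : ℝ) ≤ J := by exact_mod_cast hJ
    linarith
  -- The i-th window and its translate by ℓ are treated together, as it is not known in advance
  -- which of the two will have large partial sums. Excluding i = 0 guarantees L ≤ M.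
  obtain ⟨i, hi, hi2⟩ : ∃ i ∈ Finset.Ico 1 J,
      (E ((i + 1) * L) - E (i * L)) + (E (ℓ + (i + 1) * L) - E (ℓ + i * L)) ≤ 2 / (J - 1) := by
    refine Finset.exists_le_of_sum_le (Finset.nonempty_Ico.mpr (by omega)) ?_
    rw [Finset.sum_const, Nat.card_Ico, nsmul_eq_mul, Nat.cast_sub (by omega), Nat.cast_one,
      mul_div_cancel₀ _ hJ'.ne']
    calc _ ≤ ∑ i ∈ Finset.range J,
          ((E ((i + 1) * L) - E (i * L)) + (E (ℓ + (i + 1) * L) - E (ℓ + i * L))) := by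
          refine Finset.sum_le_sum_of_subset_of_nonneg
            (fun i hi => Finset.mem_range.mpr (Finset.mem_Ico.mp hi).2) fun i _ _ => ?_
          have h1 : E (i * L) ≤ E ((i + 1) * L) := hEm (Nat.mul_le_mul_right L (Nat.le_succ i))
          have h2 : E (ℓ + i * L) ≤ E (ℓ + (i + 1) * L) :=
            hEm (Nat.add_le_add_left (Nat.mul_le_mul_right L (Nat.le_succ i)) ℓ)
          linarith
      _ = (E (J * L) - E (0 * L)) + (E (ℓ + J * L) - E (ℓ + 0 * L)) := by
          rw [Finset.sum_add_distrib, Finset.sum_range_sub (fun i => E (i * L)),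
            Finset.sum_range_sub (fun i => E (ℓ + i * L))]
      _ ≤ (E ℓ - E 0) + (E (2 * ℓ) - E ℓ) := by
          have h1 := hEm hJL
          have h2 : E (ℓ + J * L) ≤ E (2 * ℓ) := hEm (by omega)
          simp only [zero_mul, add_zero]
          linarith
      _ ≤ 2 := by rw [hE0]; linarith
  rw [Finset.mem_Ico] at hi
  have hiL : (i + 1) * L ≤ ℓ := (Nat.mul_le_mul_right L (by omega)).trans hJL
  have hLi : L ≤ i * L := Nat.le_mul_of_pos_left L (by omega)
  have hexp : (i + 1) * L = i * L + L := by ring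
  have hfinish : ∀ M, L ≤ M → M + L ≤ 2 * ℓ → c ≤ |g M| → E (M + L) - E M ≤ 2 / (J - 1) →
      ∃ M : ℕ, L ≤ M ∧ M + L ≤ 2 * ℓ ∧ c ≤ |g M| ∧
        (∀ n, M ≤ n → n ≤ M + L → |g n - g M| ≤ 2 * V / (J - 1)) ∧
          Q (M + L) - Q M ≤ 2 * Λ / (J - 1) := by
    intro M hM1 hM2 hM3 hM4
    have hUd := sub_nonneg.mpr (hUm (Nat.le_add_right M L))
    have hQd := sub_nonneg.mpr (hQm (Nat.le_add_right M L))
    have hsplit : E (M + L) - E M = (U (M + L) - U M) / V + (Q (M + L) - Q M) / Λ := by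
      simp only [hE]; ring
    have hUd' : 0 ≤ (U (M + L) - U M) / V := div_nonneg hUd hV0.le
    have hQd' : 0 ≤ (Q (M + L) - Q M) / Λ := div_nonneg hQd hΛ0.le
    refine ⟨M, hM1, hM2, hM3, fun n hn1 hn2 => ?_, ?_⟩
    · have h1 : (U (M + L) - U M) / V ≤ 2 / (J - 1) := by linarith
      rw [div_le_iff₀ hV0] at h1
      calc |g n - g M| ≤ U n - U M := hgU M n hn1
        _ ≤ U (M + L) - U M := by linarith [hUm hn2]
        _ ≤ 2 / (J - 1) * V := h1
        _ = _ := by ring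
    · have h1 : (Q (M + L) - Q M) / Λ ≤ 2 / (J - 1) := by linarith
      rw [div_le_iff₀ hΛ0] at h1
      calc Q (M + L) - Q M ≤ 2 / (J - 1) * Λ := h1
        _ = _ := by ring
  have hEi1 : E (i * L) ≤ E ((i + 1) * L) := hEm (by omega)
  have hEi2 : E (ℓ + i * L) ≤ E (ℓ + (i + 1) * L) := hEm (by omega)
  rw [hexp] at hi2 hEi1 hEi2
  -- The partial sums at iL and ℓ + iL differ by at least 2c, so one of them is at least c in
  -- absolute value.
  by_cases hM : c ≤ |g (i * L)|
  · exact hfinish (i * L) hLi (by omega) hM (by linarith)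
  · refine hfinish (ℓ + i * L) (by omega) (by omega) ?_ (by rw [add_assoc]; linarith)
    have h1 := hc (i * L) (by omega)
    rw [add_comm (i * L)] at h1
    have h2 := abs_sub (g (ℓ + i * L)) (g (i * L))
    have h3 : 2 * c ≤ |g (ℓ + i * L) - g (i * L)| := h1
    linarith

end Pigeonhole

/-! ### Orbits that come close to the singularities -/

section Freedom

theorem norm_coe_le_abs (t : ℝ) : ‖(t : UnitAddCircle)‖ ≤ |t| := by
  rw [UnitAddCircle.norm_eq]
  simpa using round_le t 0

/-- A point between two points close to `0` is close to `0`. -/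
theorem norm_lt_of_norm_add_lt_of_norm_sub_lt {w : UnitAddCircle} {b₁ b₂ δ ξ : ℝ} (hb₁ : 0 ≤ b₁)
    (hb₂ : 0 ≤ b₂) (h₁ : ‖w + ((b₁ * δ : ℝ) : UnitAddCircle)‖ < ξ)
    (h₂ : ‖w - ((b₂ * δ : ℝ) : UnitAddCircle)‖ < ξ) (hsmall : 2 * ξ + (b₁ + b₂) * |δ| ≤ 1) :
    ‖w‖ < ξ := by
  obtain ⟨e₁, he₁, he₁'⟩ := exists_small_coe_eq (z := w + ((b₁ * δ : ℝ) : UnitAddCircle))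
  obtain ⟨e₂, he₂, he₂'⟩ := exists_small_coe_eq (z := w - ((b₂ * δ : ℝ) : UnitAddCircle))
  rw [← he₁] at h₁
  rw [← he₂] at h₂
  have hz : ((e₁ - e₂ - (b₁ + b₂) * δ : ℝ) : UnitAddCircle) = 0 := by
    rw [add_mul, AddCircle.coe_sub, AddCircle.coe_sub, AddCircle.coe_add, he₁', he₂']
    abel
  -- The identity holds modulo 1; the smallness hypothesis leaves no room for a nonzero integer.
  have heq : e₁ - e₂ = (b₁ + b₂) * δ := by
    rw [AddCircle.coe_eq_zero_iff] at hz
    obtain ⟨n, hn⟩ := hz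
    simp only [zsmul_eq_mul, mul_one] at hn
    have h3 : |(n : ℝ)| < 1 := by
      rw [hn]
      have h4 := abs_sub (e₁ - e₂) ((b₁ + b₂) * δ)
      have h5 := abs_sub e₁ e₂
      have h6 : |(b₁ + b₂) * δ| = (b₁ + b₂) * |δ| := by
        rw [abs_mul, abs_of_nonneg (add_nonneg hb₁ hb₂)]
      linarith
    have h4 : n = 0 := by
      have : |n| < 1 := by exact_mod_cast h3
      rwa [Int.abs_lt_one_iff] at this
    rw [h4] at hn
    push_cast at hn
    linarith
  have hw : w = ((e₁ - b₁ * δ : ℝ) : UnitAddCircle) := by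
    rw [AddCircle.coe_sub, he₁']; abel
  rw [hw]
  refine (norm_coe_le_abs _).trans_lt ?_
  rcases (add_nonneg hb₁ hb₂).eq_or_lt with h0 | hpos
  · have : b₁ = 0 := by linarith
    simpa [this] using h₁
  -- A lift of w is a convex combination of two numbers of absolute value less than ξ.
  · have h3 : e₁ - b₁ * δ = (b₂ * e₁ + b₁ * e₂) / (b₁ + b₂) := by
      rw [eq_div_iff hpos.ne']
      linear_combination b₁ * heq
    rw [h3, abs_div, abs_of_pos hpos, div_lt_iff₀ hpos]
    have h4 := abs_add_le (b₂ * e₁) (b₁ * e₂)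
    rw [abs_mul, abs_mul, abs_of_nonneg hb₁, abs_of_nonneg hb₂] at h4
    rcases hb₁.eq_or_lt with h5 | h5
    · rw [← h5] at h4 hpos ⊢
      nlinarith
    · nlinarith

variable {k : ℕ} {a : Fin k → UnitAddCircle} {α C : ℝ} {x : ℕ → ℝ} {K : Set ℕ}

theorem eventually_forall_far (hα : Irrational α) (ha : Function.Injective a) (hC : 1 < C) :
    ∀ᶠ s in atTop, ∀ i j, i ≠ j → 1 / (C * bestDenom α s) < ‖a i - a j‖ := by
  refine eventually_all.mpr fun i => eventually_all.mpr fun j => ?_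
  by_cases hij : i = j
  · exact Eventually.of_forall fun s h => absurd hij h
  have hpos : 0 < ‖a i - a j‖ := norm_pos_iff.mpr (sub_ne_zero.mpr (ha.ne hij))
  have hlim : Tendsto (fun s => 1 / (C * (bestDenom α s : ℝ))) atTop (𝓝 0) :=
    tendsto_const_nhds.div_atTop ((tendsto_bestDenom hα).const_mul_atTop (by linarith))
  exact (hlim.eventually (gt_mem_nhds hpos)).mono fun s hs _ => hs

theorem eventually_mul_lt_of_summable {u : ℕ → ℝ}
    (h2 : Summable fun s : (Kᶜ : Set ℕ) => u s) {ε : ℝ} (hε : 0 < ε) :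
    ∀ᶠ s in atTop, s ∉ K → u s < ε := by
  have h3 : Summable (indicator (Kᶜ : Set ℕ) u) := summable_subtype_iff_indicator.mp h2
  filter_upwards [h3.tendsto_atTop_zero.eventually (gt_mem_nhds hε)] with s hs hsK
  rwa [indicator_of_mem (show s ∈ Kᶜ from hsK)] at hs

/-- In one of the two directions of time, the orbit of a point stays away from the
singularities. -/
theorem eventually_forward_or_backward_far (hα : Irrational α) (ha : Function.Injective a)
    (hC : 1 < C) (hbad : BadlyApproximableBy α a C) (hx_pos : ∀ s, 0 < x s)
    (hK : K = {s : ℕ | (bestDenom α (s + 1) : ℝ) < 1 / x s})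
    (h2 : Summable fun s : (Kᶜ : Set ℕ) => (bestDenom α (s : ℕ) : ℝ) * x (s : ℕ)) :
    ∀ᶠ s in atTop, ∀ z : UnitAddCircle,
      (s ∉ K → ∀ j < bestDenom α s, ∀ i, x s ≤ ‖z + (((j : ℝ) * α : ℝ) : UnitAddCircle) - a i‖) →
      ∀ W : ℕ, 8 * C * W ≤ bestDenom α (s + 1) →
        (∀ j < W, ∀ i, x s / (2 * C) ≤ ‖z + (((j : ℝ) * α : ℝ) : UnitAddCircle) - a i‖) ∨
        (∀ j < W, ∀ i,
          x s / (2 * C) ≤ ‖z - ((((j : ℝ) + 1) * α : ℝ) : UnitAddCircle) - a i‖) := by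
  filter_upwards [eventually_forall_far hα ha hC, eventually_mul_lt_of_summable
    (u := fun s => (bestDenom α s : ℝ) * x s) h2 (show 0 < 1 / (8 * C) by positivity)]
    with s hs1 hs2 z hz W hW
  by_contra hcon
  push Not at hcon
  obtain ⟨⟨j₁, hj₁, i₁, h₁⟩, ⟨j₂, hj₂, i₂, h₂⟩⟩ := hcon
  have hC0 : 0 < C := by linarith
  have hq0 : (0 : ℝ) < bestDenom α s := by exact_mod_cast bestDenom_pos hα s
  have hq1 : (0 : ℝ) < bestDenom α (s + 1) := by exact_mod_cast bestDenom_pos hα (s + 1)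
  have hxs := hx_pos s
  have hW0 : (1 : ℝ) ≤ W := by exact_mod_cast (by omega : 1 ≤ W)
  by_cases hsK : s ∈ K
  · have hlt : x s / (2 * C) ≤ 1 / (2 * C * bestDenom α (s + 1)) := by
      rw [hK] at hsK
      have : (bestDenom α (s + 1) : ℝ) < 1 / x s := hsK
      rw [lt_div_iff₀ hxs] at this
      rw [div_le_div_iff₀ (by positivity) (by positivity)]
      nlinarith
    have h2W : 2 * W ≤ bestDenom α (s + 1) := by
      have : (2 : ℝ) * W ≤ bestDenom α (s + 1) := by nlinarith
      exact_mod_cast this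
    -- For s ∈ K the two close visits are within 1/(2C q_{s+1}) and lie in one orbit segment of
    -- length 2W ≤ q_{s+1}, started at z − Wα. Bad approximability at scale s + 1 forbids two of
    -- them.
    have := hbad (z - ((W * α : ℝ) : UnitAddCircle)) (s + 1)
      (show j₁ + W ∈ _ from ⟨by omega, i₁, by
        refine le_trans (le_of_eq ?_) (h₁.le.trans hlt)
        congr 1
        rw [sub_add, ← AddCircle.coe_sub, sub_eq_add_neg z, ← AddCircle.coe_neg]
        congr 3; push_cast; ring⟩)
      (show W - (j₂ + 1) ∈ _ from ⟨by omega, i₂, by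
        refine le_trans (le_of_eq ?_) (h₂.le.trans hlt)
        congr 1
        rw [sub_add, ← AddCircle.coe_sub]
        congr 3; push_cast [Nat.cast_sub (show j₂ + 1 ≤ W by omega)]; ring⟩)
    omega
  · set q := bestDenom α s with hq
    set δ : ℝ := q * α - round (q * α) with hδ
    have hcoe : ∀ n : ℤ, ((n * δ : ℝ) : UnitAddCircle) = ((n * (q * α) : ℝ) : UnitAddCircle) := by
      intro n
      rw [hδ, mul_sub, AddCircle.coe_sub]
      have : ((n * round (q * α) : ℝ) : UnitAddCircle) = 0 := by
        rw [AddCircle.coe_eq_zero_iff]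
        exact ⟨n * round (q * α), by simp⟩
      rw [this, sub_zero]
    have hδ1 : |δ| ≤ 1 / bestDenom α (s + 1) := by
      rw [hδ, ← distInt_eq]
      exact distInt_bestDenom_le_one_div hα s
    have hqx : q * x s < 1 / (8 * C) := hs2 hsK
    have hq8 : 8 * C * q ≤ bestDenom α (s + 1) := by
      rw [hK] at hsK
      have h3 : 1 / x s ≤ (bestDenom α (s + 1) : ℝ) := not_lt.mp hsK
      refine le_trans ?_ h3
      rw [lt_div_iff₀ (by positivity)] at hqx
      rw [le_div_iff₀ hxs]
      linarith
    -- Both W and q are at most q_{s+1}/(8C), so the number of turns of length q in the window is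
    -- too small to move a point by more than 1/(4Cq).
    have hb : ∀ b : ℝ, 0 ≤ b → b * q ≤ W + q → b * |δ| ≤ 1 / (4 * C * q) := by
      intro b hb0 hb
      calc b * |δ| ≤ b * (1 / bestDenom α (s + 1)) := by gcongr
        _ ≤ 1 / (4 * C * q) := by
          rw [mul_one_div, div_le_div_iff₀ hq1 (by positivity)]
          nlinarith
    have hxC : x s / (2 * C) ≤ 1 / (4 * C * q) := by
      rw [lt_div_iff₀ (by positivity)] at hqx
      rw [div_le_div_iff₀ (by positivity) (by positivity)]
      nlinarith
    have hhalf : 1 / (4 * C * q) + 1 / (4 * C * q) = 1 / (2 * C * q) := by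
      field_simp; ring
    have hqz : (0 : ℤ) < q := by exact_mod_cast bestDenom_pos hα s
    have hreduce : ∀ n : ℤ, ∃ (b : ℤ) (j : ℕ), j < q ∧ n = b * q + j := by
      intro n
      refine ⟨n / q, (n % q).toNat, ?_, ?_⟩
      · have := Int.emod_lt_of_pos n hqz
        have := Int.emod_nonneg n hqz.ne'
        omega
      · rw [Int.toNat_of_nonneg (Int.emod_nonneg n hqz.ne')]
        exact (Int.ediv_mul_add_emod n q).symm
    -- For s ∉ K both visit times are reduced modulo q. The reduced points are still within 1/(2Cq)
    -- of singularities, so bad approximability at scale s, and the separation of the singularities,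
    -- make both the residue and the singularity the same.
    obtain ⟨b₁, r₁, hr₁, e₁⟩ := hreduce j₁
    obtain ⟨b₂, r₂, hr₂, e₂⟩ := hreduce (-((j₂ : ℤ) + 1))
    have hb₁ : 0 ≤ b₁ := by
      by_contra hc
      nlinarith
    have hb₂ : b₂ ≤ 0 := by
      by_contra hc
      nlinarith
    have e₁' : (j₁ : ℝ) = b₁ * q + r₁ := by exact_mod_cast e₁
    have e₂' : -((j₂ : ℝ) + 1) = b₂ * q + r₂ := by exact_mod_cast e₂
    have hb₁' : (0 : ℝ) ≤ b₁ := by exact_mod_cast hb₁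
    have hb₂' : (0 : ℝ) ≤ -b₂ := by
      have : (b₂ : ℝ) ≤ 0 := by exact_mod_cast hb₂
      linarith
    have hr₁' : (r₁ : ℝ) < q := by exact_mod_cast hr₁
    have hr₂' : (r₂ : ℝ) < q := by exact_mod_cast hr₂
    have hj₁' : (j₁ : ℝ) ≤ W := by exact_mod_cast hj₁.le
    have hj₂' : (j₂ : ℝ) + 1 ≤ W := by exact_mod_cast hj₂
    have hr₁0 : (0 : ℝ) ≤ r₁ := by positivity
    have hbb₁ := hb b₁ hb₁' (by linarith)
    have hbb₂ := hb (-b₂) hb₂' (by linarith)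
    have p₁ : z + (((j₁ : ℝ) * α : ℝ) : UnitAddCircle) - a i₁ =
        (z + (((r₁ : ℝ) * α : ℝ) : UnitAddCircle) - a i₁) + ((b₁ * δ : ℝ) : UnitAddCircle) := by
      rw [hcoe, e₁', add_mul, AddCircle.coe_add, mul_assoc]; abel
    have p₂ : z - ((((j₂ : ℝ) + 1) * α : ℝ) : UnitAddCircle) - a i₂ =
        (z + (((r₂ : ℝ) * α : ℝ) : UnitAddCircle) - a i₂) -
          ((-b₂ * δ : ℝ) : UnitAddCircle) := by
      rw [neg_mul, AddCircle.coe_neg, hcoe, sub_neg_eq_add,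
        show ((j₂ : ℝ) + 1) * α = -(b₂ * (q * α) + r₂ * α) by linear_combination (-α) * e₂',
        AddCircle.coe_neg, AddCircle.coe_add]
      abel
    rw [p₁] at h₁
    rw [p₂] at h₂
    have n₁ : ‖z + (((r₁ : ℝ) * α : ℝ) : UnitAddCircle) - a i₁‖ ≤ 1 / (2 * C * q) := by
      have h3 := norm_sub_le ((z + (((r₁ : ℝ) * α : ℝ) : UnitAddCircle) - a i₁) +
        ((b₁ * δ : ℝ) : UnitAddCircle)) ((b₁ * δ : ℝ) : UnitAddCircle)
      rw [add_sub_cancel_right] at h3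
      have h4 := norm_coe_le_abs (b₁ * δ)
      rw [abs_mul, abs_of_nonneg hb₁'] at h4
      linarith
    have n₂ : ‖z + (((r₂ : ℝ) * α : ℝ) : UnitAddCircle) - a i₂‖ ≤ 1 / (2 * C * q) := by
      have h3 := norm_add_le ((z + (((r₂ : ℝ) * α : ℝ) : UnitAddCircle) - a i₂) -
        ((-b₂ * δ : ℝ) : UnitAddCircle)) ((-b₂ * δ : ℝ) : UnitAddCircle)
      rw [sub_add_cancel] at h3
      have h4 := norm_coe_le_abs (-b₂ * δ)
      rw [abs_mul, abs_of_nonneg hb₂'] at h4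
      linarith
    have hr : r₁ = r₂ := hbad z s ⟨hr₁, i₁, n₁⟩ ⟨hr₂, i₂, n₂⟩
    subst hr
    have hi : i₁ = i₂ := by
      by_contra hne
      have h3 := hs1 i₁ i₂ hne
      have h4 := norm_sub_le (z + (((r₁ : ℝ) * α : ℝ) : UnitAddCircle) - a i₂)
        (z + (((r₁ : ℝ) * α : ℝ) : UnitAddCircle) - a i₁)
      rw [sub_sub_sub_cancel_left] at h4
      have h5 : 1 / (2 * C * q) + 1 / (2 * C * q) = 1 / (C * q) := by field_simp; ring
      linarith
    subst hi
    have hq1' : (1 : ℝ) ≤ q := by exact_mod_cast bestDenom_pos hα s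
    have hsmall : 1 / (4 * C * q) ≤ 1 / 4 := by
      rw [div_le_div_iff₀ (by positivity) (by norm_num)]
      nlinarith
    -- The reduced point lies between the forward and the backward visit, hence is as close to the
    -- singularity as they are. Its time is in {0, …, q − 1}, where a distance of at least x_s was
    -- assumed.
    have := norm_lt_of_norm_add_lt_of_norm_sub_lt hb₁' hb₂' h₁ h₂ (by
      rw [add_mul]; linarith)
    have h6 := hz hsK r₁ hr₁ i₁
    have h7 : x s / (2 * C) ≤ x s := div_le_self hxs.le (by linarith)
    linarith

end Freedom

/-! ### Differences of Birkhoff sums over blocks -/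

section BlockDifference

variable {k : ℕ} {a : Fin k → UnitAddCircle} {f : UnitAddCircle → ℝ} {α : ℝ}

/-- Mean value inequality for the whole weighted block as one function of the displacement, so that
the block estimate can be used at each intermediate point. The factor 2 in the distance keeps these
points at distance ξ from the singularities. -/
theorem IsC2Off.abs_sum_mul_sub_le (hf : IsC2Off f a) {q : ℕ} {θ₀ : UnitAddCircle}
    {d ξ c b : ℝ} {e : ℕ → ℝ} (hξ : 0 < ξ) (hd : |d| ≤ ξ)
    (hbd : ∀ θ : UnitAddCircle,
      (∀ j < q, ∀ i, ξ ≤ ‖θ + (((j : ℝ) * α : ℝ) : UnitAddCircle) - a i‖) →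
      |∑ j ∈ Finset.range q, e j * circleDeriv f (θ + (((j : ℝ) * α : ℝ) : UnitAddCircle)) + c| ≤ b)
    (hfar : ∀ j < q, ∀ i, 2 * ξ ≤ ‖θ₀ + (((j : ℝ) * α : ℝ) : UnitAddCircle) - a i‖) :
    |∑ j ∈ Finset.range q, e j * (f (θ₀ + (((j : ℝ) * α : ℝ) : UnitAddCircle)) -
      f (θ₀ + (d : UnitAddCircle) + (((j : ℝ) * α : ℝ) : UnitAddCircle))) - c * d| ≤ b * |d| := by
  obtain ⟨t, rfl⟩ := QuotientAddGroup.mk_surjective θ₀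
  set Ψ : ℝ → ℝ := fun u => ∑ j ∈ Finset.range q,
    e j * f ((t + j * α + u : ℝ) : UnitAddCircle) + c * u with hΨ
  have hcoe : ∀ (j : ℕ) (u : ℝ), ((t + j * α + u : ℝ) : UnitAddCircle) =
      (t : UnitAddCircle) + (u : UnitAddCircle) + (((j : ℝ) * α : ℝ) : UnitAddCircle) := by
    intro j u
    rw [AddCircle.coe_add, AddCircle.coe_add]; abel
  have hfar' : ∀ u ∈ uIcc 0 d, ∀ j < q, ∀ i,
      ξ ≤ ‖(t : UnitAddCircle) + (u : UnitAddCircle) + (((j : ℝ) * α : ℝ) : UnitAddCircle) -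
        a i‖ := by
    intro u hu j hj i
    have h1 := hfar j hj i
    change 2 * ξ ≤ ‖(t : UnitAddCircle) + (((j : ℝ) * α : ℝ) : UnitAddCircle) - a i‖ at h1
    have h2 : |u| ≤ |d| := by simpa using abs_sub_left_of_mem_uIcc hu
    have h3 := norm_sub_le ((t : UnitAddCircle) + (u : UnitAddCircle) +
      (((j : ℝ) * α : ℝ) : UnitAddCircle) - a i) (u : UnitAddCircle)
    have h4 : (t : UnitAddCircle) + (u : UnitAddCircle) + (((j : ℝ) * α : ℝ) : UnitAddCircle) - a i
        - (u : UnitAddCircle) = (t : UnitAddCircle) + (((j : ℝ) * α : ℝ) : UnitAddCircle) - a i := by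
      abel
    rw [h4] at h3
    have h5 := norm_coe_le_abs u
    linarith
  have hderiv : ∀ u ∈ uIcc 0 d, HasDerivAt Ψ (∑ j ∈ Finset.range q, e j * circleDeriv f
      ((t : UnitAddCircle) + (u : UnitAddCircle) + (((j : ℝ) * α : ℝ) : UnitAddCircle)) + c) u := by
    intro u hu
    refine HasDerivAt.add (HasDerivAt.fun_sum fun j hj => HasDerivAt.const_mul _ ?_)
      (by simpa using (hasDerivAt_id u).const_mul c)
    rw [← hcoe]
    refine HasDerivAt.comp_const_add (t + j * α) u (hf.hasDerivAt ?_)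
    rintro ⟨i, hi⟩
    have := hfar' u hu j (Finset.mem_range.mp hj) i
    rw [← hcoe, ← hi, sub_self, norm_zero] at this
    linarith
  have hmv := (convex_uIcc 0 d).norm_image_sub_le_of_norm_hasDerivWithin_le
    (fun u hu => (hderiv u hu).hasDerivWithinAt) (fun u hu => hbd _ (hfar' u hu))
    right_mem_uIcc left_mem_uIcc
  rw [zero_sub, norm_neg, Real.norm_eq_abs, Real.norm_eq_abs] at hmv
  refine le_trans (le_of_eq ?_) hmv
  congr 1
  simp only [hΨ, hcoe, mul_sub, Finset.sum_sub_distrib, AddCircle.coe_zero, add_zero, mul_zero]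
  change ∑ j ∈ Finset.range q, e j * f ((t : UnitAddCircle) + _) -
    ∑ j ∈ Finset.range q, e j * f ((t : UnitAddCircle) + _ + _) - c * d = _
  ring

/-- The differences of `f` along two close orbits, over a block. -/
theorem IsC2Off.block_difference (hf : IsC2Off f a) {q : ℕ} {θ₀ : UnitAddCircle}
    {d ξ c b E : ℝ} (hξ : 0 < ξ) (hd : |d| ≤ ξ)
    (hbd : ∀ θ : UnitAddCircle,
      (∀ j < q, ∀ i, ξ ≤ ‖θ + (((j : ℝ) * α : ℝ) : UnitAddCircle) - a i‖) →
      |∑ j ∈ Finset.range q, circleDeriv f (θ + (((j : ℝ) * α : ℝ) : UnitAddCircle)) + c| ≤ b ∧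
      ∑ j ∈ Finset.range q, |circleDeriv f (θ + (((j : ℝ) * α : ℝ) : UnitAddCircle))| ≤ E)
    (hfar : ∀ j < q, ∀ i, 2 * ξ ≤ ‖θ₀ + (((j : ℝ) * α : ℝ) : UnitAddCircle) - a i‖) :
    |∑ j ∈ Finset.range q, (f (θ₀ + (((j : ℝ) * α : ℝ) : UnitAddCircle)) -
      f (θ₀ + (d : UnitAddCircle) + (((j : ℝ) * α : ℝ) : UnitAddCircle))) - c * d| ≤ b * |d| ∧
    ∑ j ∈ Finset.range q, |f (θ₀ + (((j : ℝ) * α : ℝ) : UnitAddCircle)) -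
      f (θ₀ + (d : UnitAddCircle) + (((j : ℝ) * α : ℝ) : UnitAddCircle))| ≤ E * |d| := by
  constructor
  · simpa using hf.abs_sum_mul_sub_le (e := fun _ => 1) hξ hd
      (fun θ hθ => by simpa using (hbd θ hθ).1) hfar
  · set v : ℕ → ℝ := fun j => f (θ₀ + (((j : ℝ) * α : ℝ) : UnitAddCircle)) -
      f (θ₀ + (d : UnitAddCircle) + (((j : ℝ) * α : ℝ) : UnitAddCircle)) with hv
    -- Fixed signs, chosen at the end points, turn the sum of absolute values into a linear
    -- combination.
    have h1 := hf.abs_sum_mul_sub_le (e := fun j => (SignType.sign (v j) : ℝ)) (c := 0) (b := E)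
      hξ hd (fun θ hθ => by
        rw [add_zero]
        refine (Finset.abs_sum_le_sum_abs _ _).trans (le_trans (Finset.sum_le_sum fun j _ => ?_)
          (hbd θ hθ).2)
        rw [abs_mul]
        refine mul_le_of_le_one_left (abs_nonneg _) ?_
        rcases SignType.trichotomy (SignType.sign (v j)) with h | h | h <;> simp [h]) hfar
    rw [zero_mul, sub_zero] at h1
    refine le_trans (le_of_eq ?_) ((le_abs_self _).trans h1)
    exact Finset.sum_congr rfl fun j _ => (sign_mul_self (v j)).symm

end BlockDifference

/-! ### Selection of the scales -/

section Scales

variable {α : ℝ} {h : ℝ → ℝ}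

theorem two_pow_mul_bestDenom_le (hα : Irrational α) (n m : ℕ) :
    2 ^ m * bestDenom α n ≤ bestDenom α (n + 2 * m) := by
  induction m with
  | zero => simp
  | succ m ih =>
    have := two_mul_bestDenom_le hα (n + 2 * m)
    calc 2 ^ (m + 1) * bestDenom α n = 2 * (2 ^ m * bestDenom α n) := by ring
      _ ≤ 2 * bestDenom α (n + 2 * m) := by gcongr
      _ ≤ _ := this

theorem pow_mul_profileHeight_le {m₁ : ℝ} (hm₁ : 0 ≤ m₁)
    (h3 : ∀ s, m₁ * profileHeight α h (s + 1) ≤ profileHeight α h s) (s r : ℕ) :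
    m₁ ^ r * profileHeight α h (s + r) ≤ profileHeight α h s := by
  induction r with
  | zero => simp
  | succ r ih =>
    calc m₁ ^ (r + 1) * profileHeight α h (s + (r + 1))
        = m₁ ^ r * (m₁ * profileHeight α h (s + r + 1)) := by rw [← add_assoc]; ring
      _ ≤ m₁ ^ r * profileHeight α h (s + r) := by gcongr; exact h3 _
      _ ≤ _ := ih

/-- For small `Δ`, there are scales `σ ≤ τ` with `q_σ` much smaller than `q_{τ+1}`, for which
`Δ` is between `1/(q_{τ+1} h(1/(2q_{τ+1})))` and `1/(q_τ h(1/(2q_τ)))`, up to constants. -/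
theorem exists_scales (hα : Irrational α) (hh : IsSingularityProfile h) {m₀ : ℝ} (hm₀ : 0 < m₀)
    (h3 : ∀ s, m₀ < profileHeight α h s / profileHeight α h (s + 1)) {R : ℝ} (hR : 1 < R) :
    ∃ c₂ C₃ : ℝ, 0 < c₂ ∧ 0 < C₃ ∧ ∀ s₁ : ℕ, ∃ δ : ℝ, 0 < δ ∧ ∀ Δ : ℝ, 0 < Δ → Δ < δ →
      ∃ σ τ : ℕ, s₁ ≤ σ ∧ σ ≤ τ ∧ R * bestDenom α σ ≤ bestDenom α (τ + 1) ∧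
        Δ * profileScale α h τ ≤ 1 ∧ c₂ ≤ Δ * (bestDenom α (τ + 1) * profileHeight α h σ) ∧
        profileScale α h τ ≤ C₃ * profileScale α h σ := by
  set m₁ := min m₀ 1 with hm₁def
  have hm₁ : 0 < m₁ := lt_min hm₀ one_pos
  have hm₁1 : m₁ ≤ 1 := min_le_right _ _
  have hhp := profileHeight_pos hα hh
  have hstep : ∀ s, m₁ * profileHeight α h (s + 1) ≤ profileHeight α h s := by
    intro s
    have h4 := h3 s
    rw [lt_div_iff₀ (hhp (s + 1))] at h4
    have h5 : m₁ * profileHeight α h (s + 1) ≤ m₀ * profileHeight α h (s + 1) :=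
      mul_le_mul_of_nonneg_right (min_le_left _ _) (hhp (s + 1)).le
    linarith
  -- Denominators at least double every two steps, so 2m steps gain a factor R; ω bounds the loss in
  -- h(1/(2q_s)) over these steps.
  obtain ⟨m, hm⟩ := pow_unbounded_of_one_lt R (show (1 : ℝ) < 2 by norm_num)
  have hm0 : 1 ≤ m := by
    by_contra hc
    have : m = 0 := by omega
    rw [this] at hm
    norm_num at hm
    linarith
  set ω := m₁ ^ (2 * m) with hω
  have hω0 : 0 < ω := by positivity
  have hω1 : ω ≤ 1 := pow_le_one₀ hm₁.le hm₁1
  have hcomp : ∀ s t, s ≤ t → t ≤ s + 2 * m → ω * profileHeight α h t ≤ profileHeight α h s := by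
    intro s t hst hts
    obtain ⟨r, rfl⟩ := Nat.exists_eq_add_of_le hst
    refine le_trans ?_ (pow_mul_profileHeight_le hm₁.le hstep s r)
    refine mul_le_mul_of_nonneg_right ?_ (hhp _).le
    exact pow_le_pow_of_le_one hm₁.le hm₁1 (by omega)
  have hq0 : ∀ s, (0 : ℝ) < bestDenom α s := fun s => by exact_mod_cast bestDenom_pos hα s
  refine ⟨ω / R, R ^ 2 / ω, by positivity, by positivity, fun s₁ =>
    ⟨1 / profileScale α h (s₁ + 2 * m), one_div_pos.mpr (profileScale_pos hα hh _),
      fun Δ hΔ hΔδ => ?_⟩⟩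
  rw [lt_div_iff₀ (profileScale_pos hα hh _)] at hΔδ
  have hex : ∃ n, 1 < Δ * profileScale α h n := by
    obtain ⟨n, hn⟩ := ((tendsto_profileScale hα hh).const_mul_atTop hΔ).eventually_gt_atTop 1
      |>.exists
    exact ⟨n, hn⟩
  classical
  -- s + 1 is the first scale with ΔH_{s+1} > 1. The choice of δ forces s ≥ s₁ + 2m, which leaves
  -- room to go down by 2m scales.
  obtain ⟨s, hs⟩ : ∃ s, Nat.find hex = s + 1 := by
    refine Nat.exists_eq_succ_of_ne_zero fun h0 => ?_
    have h1 := Nat.find_spec hex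
    rw [h0] at h1
    have h2 := mul_le_mul_of_nonneg_left
      (profileScale_mono hα hh (Nat.zero_le (s₁ + 2 * m))) hΔ.le
    linarith
  have hs1 : 1 < Δ * profileScale α h (s + 1) := hs ▸ Nat.find_spec hex
  have hs2 : Δ * profileScale α h s ≤ 1 := not_lt.mp (Nat.find_min hex (by omega))
  have hs3 : s₁ + 2 * m ≤ s := by
    by_contra hc
    have h2 := mul_le_mul_of_nonneg_left
      (profileScale_mono hα hh (show s + 1 ≤ s₁ + 2 * m by omega)) hΔ.le
    linarith
  -- σ is the last scale with q_σ smaller than q_{s+1} by a factor R; it lies within 2m of s + 1, so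
  -- the heights there are comparable up to ω.
  set P : ℕ → Prop := fun j => R * bestDenom α j ≤ bestDenom α (s + 1) with hP
  have hPj : P (s + 1 - 2 * m) := by
    have h1 := two_pow_mul_bestDenom_le hα (s + 1 - 2 * m) m
    rw [Nat.sub_add_cancel (by omega)] at h1
    have h2 : (2 : ℝ) ^ m * bestDenom α (s + 1 - 2 * m) ≤ bestDenom α (s + 1) := by
      exact_mod_cast h1
    refine le_trans ?_ h2
    exact mul_le_mul_of_nonneg_right hm.le (hq0 _).le
  set σ := Nat.findGreatest P s with hσ
  have hσP : P σ := Nat.findGreatest_spec (by omega) hPj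
  have hσs : σ ≤ s := Nat.findGreatest_le s
  have hσ1 : s + 1 - 2 * m ≤ σ := Nat.le_findGreatest (by omega) hPj
  have hσ2 : (bestDenom α (s + 1) : ℝ) < R * bestDenom α (σ + 1) := by
    rcases hσs.eq_or_lt with h1 | h1
    · rw [h1]
      have := hq0 (s + 1)
      nlinarith
    · exact not_le.mp (Nat.findGreatest_is_greatest (P := P) (n := s) (k := σ + 1)
        (Nat.lt_succ_self _) h1)
  have hHs1 : profileScale α h (s + 1) = bestDenom α (s + 1) * profileHeight α h (s + 1) := rfl
  have hhσ := hcomp σ (s + 1) (by omega) (by omega)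
  have hone : 1 ≤ R ^ 2 / ω := by
    rw [le_div_iff₀ hω0]
    nlinarith
  -- If the gap of size R already occurs just after σ, τ = σ works, and q_{σ+1} is within a factor R
  -- of q_{s+1}. Otherwise q_{s+1} < R² q_σ, so the scales at σ and s are comparable and τ = s
  -- works.
  by_cases hcase : R * bestDenom α σ ≤ bestDenom α (σ + 1)
  · refine ⟨σ, σ, by omega, le_rfl, hcase, ?_, ?_, ?_⟩
    · exact (mul_le_mul_of_nonneg_left (profileScale_mono hα hh hσs) hΔ.le).trans hs2
    · rw [div_le_iff₀ (by linarith)]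
      calc ω = ω * 1 := (mul_one ω).symm
        _ ≤ ω * (Δ * (bestDenom α (s + 1) * profileHeight α h (s + 1))) := by
            rw [← hHs1]; gcongr
        _ = Δ * (bestDenom α (s + 1) * (ω * profileHeight α h (s + 1))) := by ring
        _ ≤ Δ * ((R * bestDenom α (σ + 1)) * profileHeight α h σ) := by
            gcongr
            have := hhp (s + 1)
            positivity
        _ = _ := by ring
    · exact le_mul_of_one_le_left (profileScale_pos hα hh σ).le hone
  · push Not at hcase
    refine ⟨σ, s, by omega, hσs, hσP, hs2, ?_, ?_⟩
    · calc ω / R ≤ ω := div_le_self hω0.le hR.le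
        _ = ω * 1 := (mul_one ω).symm
        _ ≤ ω * (Δ * (bestDenom α (s + 1) * profileHeight α h (s + 1))) := by
            rw [← hHs1]; gcongr
        _ = Δ * (bestDenom α (s + 1) * (ω * profileHeight α h (s + 1))) := by ring
        _ ≤ _ := by gcongr
    · rw [div_mul_eq_mul_div, le_div_iff₀ hω0]
      calc profileScale α h s * ω ≤ profileScale α h (s + 1) * ω := by
            gcongr; exact profileScale_mono hα hh (Nat.le_succ s)
        _ = bestDenom α (s + 1) * (ω * profileHeight α h (s + 1)) := by rw [hHs1]; ring
        _ ≤ (R * (R * bestDenom α σ)) * profileHeight α h σ := by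
            have h1 : (bestDenom α (s + 1) : ℝ) ≤ R * (R * bestDenom α σ) := by nlinarith
            have h2 := hhp (s + 1)
            gcongr
        _ = R ^ 2 * profileScale α h σ := by rw [profileScale]; ring

end Scales

/-! ### Drift of Birkhoff sums along long windows -/

section Core

/-- `exists_stable_window` for a sequence whose sums over blocks of length `q` are known. -/
theorem exists_stable_window_of_blocks {v w : ℕ → ℝ} (hw : ∀ j, 0 ≤ w j) {J q n L : ℕ}
    (hJ : 2 ≤ J) (hJL : J * L ≤ n * q) {b E V Λ c : ℝ} (hV0 : 0 < V) (hΛ0 : 0 < Λ)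
    (hb : ∀ m, m + q ≤ 2 * (n * q) →
      |∑ j ∈ Finset.range q, v (m + j) - b| ≤ |b| / 2 ∧ ∑ j ∈ Finset.range q, |v (m + j)| ≤ E)
    (hVE : 2 * n * E ≤ V) (hΛ : ∑ j ∈ Finset.range (2 * (n * q)), w j ≤ Λ)
    (hc : 4 * c ≤ n * |b|) :
    ∃ M : ℕ, L ≤ M ∧ M + L ≤ 2 * (n * q) ∧ c ≤ |∑ j ∈ Finset.range M, v j| ∧
      |∑ j ∈ Finset.range M, v j| ≤ V ∧
      (∀ m, M ≤ m → m ≤ M + L →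
        |∑ j ∈ Finset.range m, v j - ∑ j ∈ Finset.range M, v j| ≤ 2 * V / (J - 1)) ∧
      ∑ j ∈ Finset.range (M + L), w j - ∑ j ∈ Finset.range M, w j ≤ 2 * Λ / (J - 1) := by
  have hvar : ∀ r, r ≤ 2 * n → ∑ j ∈ Finset.range (r * q), |v j| ≤ r * E := by
    intro r
    induction r with
    | zero => simp
    | succ r ih =>
      intro hr
      have h1 : r * q + q ≤ 2 * (n * q) := by
        calc r * q + q = (r + 1) * q := by ring
          _ ≤ 2 * n * q := Nat.mul_le_mul_right q hr
          _ = _ := by ring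
      rw [Nat.succ_mul, Finset.sum_range_add]
      have h2 := (hb (r * q) h1).2
      have h3 := ih (by omega)
      push_cast
      linarith
  have hV : ∑ j ∈ Finset.range (2 * (n * q)), |v j| ≤ V := by
    have := hvar (2 * n) le_rfl
    rw [← mul_assoc]
    refine this.trans (le_trans (le_of_eq ?_) hVE)
    push_cast; ring
  have hblock : ∀ m ≤ n * q, ∀ r ≤ n,
      |∑ j ∈ Finset.range (r * q), v (m + j) - r * b| ≤ r * (|b| / 2) := by
    intro m hm r
    induction r with
    | zero => simp
    | succ r ih =>
      intro hr
      have h0 : r * q + q ≤ n * q := by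
        calc r * q + q = (r + 1) * q := by ring
          _ ≤ n * q := Nat.mul_le_mul_right q hr
      have h1 := (hb (m + r * q) (by omega)).1
      have h2 := ih (by omega)
      rw [Nat.succ_mul, Finset.sum_range_add]
      simp only [← add_assoc]
      push_cast
      rw [abs_le] at *
      constructor <;> linarith
  obtain ⟨M, hM1, hM2, hM3, hM4, hM5⟩ := exists_stable_window (c := c) hw hJ hJL hV0 hΛ0 hV hΛ
    (fun m hm => by
      rw [Finset.sum_range_add, add_sub_cancel_left]
      have h1 := hblock m hm n le_rfl
      have h2 := abs_sub_abs_le_abs_sub ((n : ℝ) * b) (∑ j ∈ Finset.range (n * q), v (m + j))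
      rw [abs_sub_comm] at h1
      rw [abs_mul, Nat.abs_cast] at h2
      linarith)
  refine ⟨M, hM1, hM2, hM3, ?_, hM4, hM5⟩
  refine (Finset.abs_sum_le_sum_abs _ _).trans (le_trans ?_ hV)
  exact Finset.sum_le_sum_of_subset_of_nonneg (Finset.range_mono (by omega))
    fun _ _ _ => abs_nonneg _

/-- The points whose orbit segments of length `q_s`, for `s ≥ s₀` not in `K`, do not come
too close to the singularities. -/
def farSet {k : ℕ} (α : ℝ) (a : Fin k → UnitAddCircle) (x : ℕ → ℝ) (K : Set ℕ) (s₀ : ℕ) :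
    Set UnitAddCircle :=
  {z | ∀ s, s₀ ≤ s → s ∉ K → ∀ j < bestDenom α s, ∀ i,
    x s ≤ ‖z + (((j : ℝ) * α : ℝ) : UnitAddCircle) - a i‖}

theorem birkhoffCocycle_circleRotation_natCast (α : ℝ) (f : UnitAddCircle → ℝ) (n : ℕ)
    (z : UnitAddCircle) : birkhoffCocycle (circleRotation α) f (n : ℤ) z =
      ∑ j ∈ Finset.range n, f (z + (((j : ℝ) * α : ℝ) : UnitAddCircle)) := by
  rw [birkhoffCocycle_natCast]
  simp only [circleRotation_zpow_apply, Int.cast_natCast]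

theorem birkhoffCocycle_circleRotation_neg_natCast (α : ℝ) (f : UnitAddCircle → ℝ) (n : ℕ)
    (z : UnitAddCircle) : birkhoffCocycle (circleRotation α) f (-(n : ℤ)) z =
      -∑ j ∈ Finset.range n, f (z - ((((j : ℝ) + 1) * α : ℝ) : UnitAddCircle)) := by
  rw [birkhoffCocycle_neg_natCast]
  congr 1
  refine Finset.sum_congr rfl fun j _ => ?_
  rw [circleRotation_zpow_apply]
  push_cast
  rw [neg_mul, AddCircle.coe_neg, sub_eq_add_neg]

theorem exists_le_floor_min {u v : ℝ} (hu : 1 ≤ u) (hv : 1 ≤ v) :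
    ∃ n : ℕ, 1 ≤ n ∧ (n : ℝ) ≤ u ∧ (n : ℝ) ≤ v ∧ min u v / 2 ≤ n := by
  have h1 : 1 ≤ min u v := le_min hu hv
  have h2 : 1 ≤ ⌊min u v⌋₊ := Nat.one_le_floor_iff _ |>.mpr h1
  have h3 : ((⌊min u v⌋₊ : ℕ) : ℝ) ≤ min u v := Nat.floor_le (by linarith)
  have h4 := Nat.lt_floor_add_one (min u v)
  have h5 : (1 : ℝ) ≤ (⌊min u v⌋₊ : ℕ) := by exact_mod_cast h2
  exact ⟨_, h2, h3.trans (min_le_left _ _), h3.trans (min_le_right _ _), by linarith⟩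

variable {k : ℕ} {a : Fin k → UnitAddCircle} {f : UnitAddCircle → ℝ} {h : ℝ → ℝ}
  {A B : Fin k → ℝ} {α C m₀ : ℝ} {x : ℕ → ℝ} {K : Set ℕ}

/-- The shifted block starting at time m is a block based at z + mα; as the orbit is far from the
singularities for 2nq steps, every block inside has the known sum. -/
theorem exists_forward_window {z y : UnitAddCircle} {d b E' η V Λ c : ℝ} {q n J L : ℕ}
    {w : ℕ → ℝ} (hy : y = z + (d : UnitAddCircle))
    (hb : ∀ θ : UnitAddCircle,
      (∀ j < q, ∀ i, η ≤ ‖θ + (((j : ℝ) * α : ℝ) : UnitAddCircle) - a i‖) →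
      |∑ j ∈ Finset.range q, (f (θ + (((j : ℝ) * α : ℝ) : UnitAddCircle)) -
        f (θ + (d : UnitAddCircle) + (((j : ℝ) * α : ℝ) : UnitAddCircle))) - b| ≤ |b| / 2 ∧
      ∑ j ∈ Finset.range q, |f (θ + (((j : ℝ) * α : ℝ) : UnitAddCircle)) -
        f (θ + (d : UnitAddCircle) + (((j : ℝ) * α : ℝ) : UnitAddCircle))| ≤ E')
    (hfar : ∀ j < 2 * (n * q), ∀ i, η ≤ ‖z + (((j : ℝ) * α : ℝ) : UnitAddCircle) - a i‖)
    (hw : ∀ j, 0 ≤ w j) (hJ : 2 ≤ J) (hJL : J * L ≤ n * q) (hV0 : 0 < V) (hΛ0 : 0 < Λ)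
    (hVE : 2 * n * E' ≤ V) (hΛ : ∑ j ∈ Finset.range (2 * (n * q)), w j ≤ Λ)
    (hc : 4 * c ≤ n * |b|) :
    ∃ M : ℕ, L ≤ M ∧ M + L ≤ 2 * (n * q) ∧
      c ≤ |birkhoffCocycle (circleRotation α) f M z - birkhoffCocycle (circleRotation α) f M y| ∧
      |birkhoffCocycle (circleRotation α) f M z - birkhoffCocycle (circleRotation α) f M y| ≤ V ∧
      (∀ m : ℕ, M ≤ m → m ≤ M + L →
        |birkhoffCocycle (circleRotation α) f m z - birkhoffCocycle (circleRotation α) f m y -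
          (birkhoffCocycle (circleRotation α) f M z - birkhoffCocycle (circleRotation α) f M y)| ≤
            2 * V / (J - 1)) ∧
      ∑ j ∈ Finset.range (M + L), w j - ∑ j ∈ Finset.range M, w j ≤ 2 * Λ / (J - 1) := by
  set v : ℕ → ℝ := fun j => f (z + (((j : ℝ) * α : ℝ) : UnitAddCircle)) -
    f (y + (((j : ℝ) * α : ℝ) : UnitAddCircle)) with hv
  have hsum : ∀ m : ℕ, birkhoffCocycle (circleRotation α) f m z -
      birkhoffCocycle (circleRotation α) f m y = ∑ j ∈ Finset.range m, v j := by
    intro m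
    rw [birkhoffCocycle_circleRotation_natCast, birkhoffCocycle_circleRotation_natCast,
      ← Finset.sum_sub_distrib]
  simp only [hsum]
  refine exists_stable_window_of_blocks (v := v) hw hJ hJL hV0 hΛ0 (fun m hm => ?_) hVE hΛ hc
  have hs : ∀ j : ℕ, z + ((((m + j : ℕ) : ℝ) * α : ℝ) : UnitAddCircle) =
      (z + ((m * α : ℝ) : UnitAddCircle)) + (((j : ℝ) * α : ℝ) : UnitAddCircle) := by
    intro j
    rw [add_assoc, ← AddCircle.coe_add]; congr 2; push_cast; ring
  have hs' : ∀ j : ℕ, y + ((((m + j : ℕ) : ℝ) * α : ℝ) : UnitAddCircle) =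
      (z + ((m * α : ℝ) : UnitAddCircle)) + (d : UnitAddCircle) +
        (((j : ℝ) * α : ℝ) : UnitAddCircle) := by
    intro j
    rw [add_right_comm, ← hs, hy, add_right_comm]
  simp only [hv, hs, hs']
  refine hb _ fun j hj i => ?_
  rw [← hs]
  exact hfar (m + j) (by omega) i

/-- A block of past points is a forward block based at its earliest point and read in reverse order.
The minus sign in the cocycle at negative times does not affect the absolute values. -/
theorem exists_backward_window {z y : UnitAddCircle} {d b E' η V Λ c : ℝ} {q n J L : ℕ}
    {w : ℕ → ℝ} (hy : y = z + (d : UnitAddCircle))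
    (hb : ∀ θ : UnitAddCircle,
      (∀ j < q, ∀ i, η ≤ ‖θ + (((j : ℝ) * α : ℝ) : UnitAddCircle) - a i‖) →
      |∑ j ∈ Finset.range q, (f (θ + (((j : ℝ) * α : ℝ) : UnitAddCircle)) -
        f (θ + (d : UnitAddCircle) + (((j : ℝ) * α : ℝ) : UnitAddCircle))) - b| ≤ |b| / 2 ∧
      ∑ j ∈ Finset.range q, |f (θ + (((j : ℝ) * α : ℝ) : UnitAddCircle)) -
        f (θ + (d : UnitAddCircle) + (((j : ℝ) * α : ℝ) : UnitAddCircle))| ≤ E')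
    (hfar : ∀ j < 2 * (n * q), ∀ i,
      η ≤ ‖z - ((((j : ℝ) + 1) * α : ℝ) : UnitAddCircle) - a i‖)
    (hw : ∀ j, 0 ≤ w j) (hJ : 2 ≤ J) (hJL : J * L ≤ n * q) (hV0 : 0 < V) (hΛ0 : 0 < Λ)
    (hVE : 2 * n * E' ≤ V) (hΛ : ∑ j ∈ Finset.range (2 * (n * q)), w j ≤ Λ)
    (hc : 4 * c ≤ n * |b|) :
    ∃ M : ℕ, L ≤ M ∧ M + L ≤ 2 * (n * q) ∧
      c ≤ |birkhoffCocycle (circleRotation α) f (-M) z -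
        birkhoffCocycle (circleRotation α) f (-M) y| ∧
      |birkhoffCocycle (circleRotation α) f (-M) z -
        birkhoffCocycle (circleRotation α) f (-M) y| ≤ V ∧
      (∀ m : ℕ, M ≤ m → m ≤ M + L →
        |birkhoffCocycle (circleRotation α) f (-m) z -
          birkhoffCocycle (circleRotation α) f (-m) y -
          (birkhoffCocycle (circleRotation α) f (-M) z -
            birkhoffCocycle (circleRotation α) f (-M) y)| ≤ 2 * V / (J - 1)) ∧
      ∑ j ∈ Finset.range (M + L), w j - ∑ j ∈ Finset.range M, w j ≤ 2 * Λ / (J - 1) := by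
  set v : ℕ → ℝ := fun j => f (z - ((((j : ℝ) + 1) * α : ℝ) : UnitAddCircle)) -
    f (y - ((((j : ℝ) + 1) * α : ℝ) : UnitAddCircle)) with hv
  have hsum : ∀ m : ℕ, birkhoffCocycle (circleRotation α) f (-m) z -
      birkhoffCocycle (circleRotation α) f (-m) y = -∑ j ∈ Finset.range m, v j := by
    intro m
    rw [birkhoffCocycle_circleRotation_neg_natCast, birkhoffCocycle_circleRotation_neg_natCast,
      Finset.sum_sub_distrib]
    ring
  simp only [hsum, abs_neg, ← neg_sub']
  refine exists_stable_window_of_blocks (v := v) hw hJ hJL hV0 hΛ0 (fun m hm => ?_) hVE hΛ hc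
  set z' := z - ((((m + q : ℕ) : ℝ) * α : ℝ) : UnitAddCircle) with hz'
  have hs : ∀ j < q, z - ((((m + (q - 1 - j) : ℕ) + 1 : ℝ) * α : ℝ) : UnitAddCircle) =
      z' + (((j : ℝ) * α : ℝ) : UnitAddCircle) := by
    intro j hj
    rw [hz', sub_add, ← AddCircle.coe_sub]; congr 2
    have : ((m + (q - 1 - j) : ℕ) : ℝ) = m + q - 1 - j := by
      rw [Nat.cast_add, Nat.cast_sub (by omega), Nat.cast_sub (by omega)]
      push_cast; ring
    rw [this]; push_cast; ring
  have hs' : ∀ j < q, y - ((((m + (q - 1 - j) : ℕ) + 1 : ℝ) * α : ℝ) : UnitAddCircle) =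
      z' + (d : UnitAddCircle) + (((j : ℝ) * α : ℝ) : UnitAddCircle) := by
    intro j hj
    rw [add_right_comm, ← hs j hj, hy]; abel
  have hv' : ∀ j < q, v (m + (q - 1 - j)) =
      f (z' + (((j : ℝ) * α : ℝ) : UnitAddCircle)) -
        f (z' + (d : UnitAddCircle) + (((j : ℝ) * α : ℝ) : UnitAddCircle)) := by
    intro j hj
    simp only [hv]
    rw [hs j hj, hs' j hj]
  rw [← Finset.sum_range_reflect, ← Finset.sum_range_reflect (fun j => |v (m + j)|),
    Finset.sum_congr rfl fun j hj => hv' j (Finset.mem_range.mp hj),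
    Finset.sum_congr rfl fun j hj => congrArg abs (hv' j (Finset.mem_range.mp hj))]
  refine hb _ fun j hj i => ?_
  rw [← hs j hj]
  exact hfar (m + (q - 1 - j)) (by omega) i

set_option maxHeartbeats 1000000 in
/-- Over long windows, the Birkhoff sums of two close points differ by an almost constant amount,
bounded and bounded away from `0`. The weights `w` and `u` play no role in this, but the window
is chosen so that they give it no more than its share of mass. -/
theorem HasSingularitiesOfType.exists_drift_window (hα : Irrational α)
    (hf : HasSingularitiesOfType f a h A B) (hC : 1 < C) (hbad : BadlyApproximableBy α a C)
    (hAB : ∑ i, A i ≠ ∑ i, B i) (hm₀ : 0 < m₀) (hx_pos : ∀ s, 0 < x s)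
    (hx_lt : ∀ s, x s < 1 / (bestDenom α s : ℝ))
    (h1a : Tendsto (fun s : ℕ => deriv h (x s / (4 * C)) / profileScale α h s) atTop (𝓝 0))
    (h1b : Tendsto (fun s : ℕ => x s * profileScale α h s) atTop atTop)
    (hK : K = {s : ℕ | (bestDenom α (s + 1) : ℝ) < 1 / x s})
    (h2 : Summable fun s : (Kᶜ : Set ℕ) => (bestDenom α (s : ℕ) : ℝ) * x (s : ℕ))
    (h3 : ∀ s : ℕ, m₀ < profileHeight α h s / profileHeight α h (s + 1)) :
    ∃ c V : ℝ, 0 < c ∧ ∀ ε : ℝ, 0 < ε → ∃ κ : ℝ, 0 < κ ∧ ∀ s₀ N : ℕ, ∃ δ : ℝ, 0 < δ ∧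
      ∀ z y : UnitAddCircle, z ∈ farSet α a x K s₀ → z ≠ y → ‖z - y‖ < δ →
      ∀ (r : ℝ) (w u : ℕ → ℝ), 0 < r → (∀ j, 0 ≤ w j) → (∀ j, 0 ≤ u j) →
        (∀ n : ℕ, 1 ≤ n → ∑ j ∈ Finset.range n, w j ≤ r * n) →
        (∀ n : ℕ, 1 ≤ n → ∑ j ∈ Finset.range n, u j ≤ r * n) →
        ∃ M L : ℕ, N < M ∧ N < L ∧ κ * M ≤ L ∧ ∃ p : ℝ, c ≤ |p| ∧ |p| ≤ V ∧
          (((∀ n : ℕ, M ≤ n → n ≤ M + L → |birkhoffCocycle (circleRotation α) f n z -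
              birkhoffCocycle (circleRotation α) f n y - p| < ε) ∧
            ∑ j ∈ Finset.range (M + L), w j - ∑ j ∈ Finset.range M, w j ≤ 16 * r * L) ∨
          ((∀ n : ℕ, M ≤ n → n ≤ M + L → |birkhoffCocycle (circleRotation α) f (-n) z -
              birkhoffCocycle (circleRotation α) f (-n) y - p| < ε) ∧
            ∑ j ∈ Finset.range (M + L), u j - ∑ j ∈ Finset.range M, u j ≤ 16 * r * L)) := by
  have hh := hf.profile
  set Γ := ∑ i, A i - ∑ i, B i with hΓ
  have hΓ0 : 0 < |Γ| := abs_pos.mpr (sub_ne_zero.mpr hAB)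
  have hSA0 : 0 ≤ ∑ i, A i := Finset.sum_nonneg fun i _ => hf.nonneg_right i
  have hSB0 : 0 ≤ ∑ i, B i := Finset.sum_nonneg fun i _ => hf.nonneg_left i
  obtain ⟨ρ, hρ0, hρ⟩ := hf.block_bounds hα (half_pos hΓ0)
  set E := |Γ| / 2 + 2 * (∑ i, A i + ∑ i, B i) with hE
  have hE0 : 0 < E := by positivity
  -- The free time is q_{τ+1}/(8C) and two runs of n blocks are needed; the ratio 16C leaves room
  -- for n ≥ 1.
  obtain ⟨c₂, C₃, hc₂, hC₃, hscales⟩ := exists_scales hα hh hm₀ h3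
    (show 1 < 16 * C by linarith)
  set c₁ := min (1 / 2) (c₂ / (32 * C)) with hc₁
  have hc₁0 : 0 < c₁ := by positivity
  -- n blocks drift by at least |Γ|c₁/2, half of which survives at one of two windows; 2n blocks
  -- have variation at most 2E, because nΔH ≤ 1.
  refine ⟨|Γ| * c₁ / 4, 2 * E, by positivity, fun ε hε => ?_⟩
  obtain ⟨J, hJ⟩ : ∃ J : ℕ, 2 * (2 * E) / ε + 2 < J := exists_nat_gt _
  have hJ2 : (2 : ℝ) < J := by
    have : 0 ≤ 2 * (2 * E) / ε := by positivity
    linarith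
  have hJ2' : 2 ≤ J := by exact_mod_cast hJ2.le
  have hJε : 2 * (2 * E) / ((J : ℝ) - 1) < ε := by
    rw [div_lt_iff₀ (by linarith)]
    have h4 : 2 * (2 * E) / ε < J - 1 := by linarith
    rw [div_lt_iff₀ hε] at h4
    linarith
  -- The window satisfies M ≤ 2ℓ and ℓ ≤ 2JL.
  refine ⟨1 / (4 * J), by positivity, fun s₀ N => ?_⟩
  have hevent : ∀ᶠ s in atTop, s₀ ≤ s ∧ J * (N + 1) ≤ bestDenom α s := by
    filter_upwards [eventually_ge_atTop s₀,
      (bestDenom_strictMono hα).tendsto_atTop.eventually_ge_atTop (J * (N + 1))] with s h4 h5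
    exact ⟨h4, h5⟩
  have h1a' : ∀ᶠ s in atTop, -deriv h (x s / (4 * C)) ≤ ρ / C₃ * profileScale α h s := by
    filter_upwards [h1a.eventually (lt_mem_nhds (show -(ρ / C₃) < 0 by
      rw [neg_lt_zero]; positivity))] with s hs
    rw [lt_div_iff₀ (profileScale_pos hα hh s)] at hs
    linarith
  obtain ⟨s₁, hs₁⟩ := eventually_atTop.mp (hρ.and (hevent.and (h1a'.and
    ((h1b.eventually_ge_atTop (4 * C)).and
      (eventually_forward_or_backward_far hα hf.injective hC hbad hx_pos hK h2)))))
  obtain ⟨δ, hδ0, hδ⟩ := hscales s₁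
  refine ⟨δ, hδ0, fun z y hz hzy hzyδ r wp wm hr hwp hwm hwp' hwm' => ?_⟩
  set Δ := ‖z - y‖ with hΔdef
  have hΔ0 : 0 < Δ := norm_pos_iff.mpr (sub_ne_zero.mpr hzy)
  obtain ⟨σ, τ, hσ1, hστ, hqR, hΔτ, hΔc, hHτσ⟩ := hδ Δ hΔ0 hzyδ
  obtain ⟨hblock, ⟨-, hqN⟩, -⟩ := hs₁ σ hσ1
  obtain ⟨-, ⟨hτs₀, -⟩, hG, hxH, hfree⟩ := hs₁ τ (hσ1.trans hστ)
  set q := bestDenom α σ with hq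
  set H := profileScale α h σ with hH
  have hH0 : 0 < H := profileScale_pos hα hh σ
  have hHτ0 : 0 < profileScale α h τ := profileScale_pos hα hh τ
  have hq0 : (0 : ℝ) < q := by exact_mod_cast bestDenom_pos hα σ
  have hΔσ : Δ * H ≤ 1 :=
    (mul_le_mul_of_nonneg_left (profileScale_mono hα hh hστ) hΔ0.le).trans hΔτ
  have hxτ := hx_pos τ
  -- Half the distance x_τ/(2C) kept by the free orbit. It is taken at scale τ while the blocks have
  -- scale σ; comparability of H_τ and H_σ reconciles the two.
  set ξ := x τ / (4 * C) with hξ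
  have hξ0 : 0 < ξ := by positivity
  have hξq : ξ ≤ 1 / (2 * q) := by
    have h4 : x τ ≤ 1 / q := by
      refine (hx_lt τ).le.trans ?_
      have h5 : (q : ℝ) ≤ bestDenom α τ := by
        exact_mod_cast (bestDenom_strictMono hα).monotone hστ
      gcongr
    calc ξ ≤ x τ / 2 := by
          rw [hξ]; gcongr; linarith
      _ ≤ 1 / q / 2 := by gcongr
      _ = _ := by field_simp
  have hξG : -deriv h ξ ≤ ρ * H := by
    calc -deriv h ξ ≤ ρ / C₃ * profileScale α h τ := hG
      _ ≤ ρ / C₃ * (C₃ * H) := by gcongr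
      _ = ρ * H := by field_simp
  -- Combines ΔH_τ ≤ 1 with x_τ H_τ ≥ 4C, from the second limit in condition 1.
  have hΔξ : Δ ≤ ξ := by
    rw [hξ, le_div_iff₀ (by positivity)]
    have h4 : Δ * (4 * C) ≤ Δ * (x τ * profileScale α h τ) := by gcongr
    calc Δ * (4 * C) ≤ Δ * (x τ * profileScale α h τ) := h4
      _ = x τ * (Δ * profileScale α h τ) := by ring
      _ ≤ x τ * 1 := by gcongr
      _ = x τ := mul_one _
  obtain ⟨d, hd1, hd2⟩ := exists_small_coe_eq (z := y - z)
  rw [← norm_neg, neg_sub, ← hΔdef] at hd1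
  have hy : y = z + (d : UnitAddCircle) := by rw [hd2]; abel
  -- Number of blocks: enough for a drift of order 1, but within the free time. By the choice of
  -- scales, neither restriction makes nΔH smaller than c₁.
  obtain ⟨n, hn1, hn2, hn3, hn4⟩ := exists_le_floor_min
    (u := 1 / (Δ * H)) (v := bestDenom α (τ + 1) / (16 * C * q))
    (by rw [le_div_iff₀ (by positivity)]; linarith)
    (by rw [le_div_iff₀ (by positivity)]; linarith)
  rw [le_div_iff₀ (by positivity)] at hn2 hn3
  have hn5 : c₁ ≤ n * (Δ * H) := by
    have h4 : min (1 / (Δ * H)) (bestDenom α (τ + 1) / (16 * C * q)) * (Δ * H) ≤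
        2 * (n * (Δ * H)) := by
      calc _ ≤ (2 * n) * (Δ * H) := by gcongr; linarith
        _ = _ := by ring
    rcases min_choice (1 / (Δ * H)) ((bestDenom α (τ + 1) : ℝ) / (16 * C * q)) with h5 | h5
    · rw [h5, div_mul_cancel₀ _ (by positivity)] at h4
      have := min_le_left (1 / 2 : ℝ) (c₂ / (32 * C))
      linarith
    · rw [h5] at h4
      have h6 : (bestDenom α (τ + 1) : ℝ) / (16 * C * q) * (Δ * H) =
          Δ * (bestDenom α (τ + 1) * profileHeight α h σ) / (16 * C) := by
        rw [hH, profileScale, ← hq]; field_simp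
      have h7 : c₂ / (16 * C) ≤ Δ * (bestDenom α (τ + 1) * profileHeight α h σ) / (16 * C) := by
        gcongr
      have h8 : c₂ / (32 * C) = c₂ / (16 * C) / 2 := by field_simp; norm_num
      have := min_le_right (1 / 2 : ℝ) (c₂ / (32 * C))
      linarith
  have hW : 8 * C * ((2 * (n * q) : ℕ) : ℝ) ≤ bestDenom α (τ + 1) := by
    push_cast; linarith
  set ℓ := n * q with hℓ
  have hqℓ : q ≤ ℓ := Nat.le_mul_of_pos_left q hn1
  have hJpos : 0 < J := by omega
  set L := ℓ / J with hL
  have hJL : J * L ≤ ℓ := Nat.mul_div_le ℓ J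
  have hNL : N + 1 ≤ L := by
    rw [hL, Nat.le_div_iff_mul_le hJpos, mul_comm]
    exact hqN.trans hqℓ
  have hℓL : (ℓ : ℝ) ≤ 2 * J * L := by
    have h4 : ℓ < J * (L + 1) := Nat.lt_mul_div_succ ℓ hJpos
    have h5 : J * (L + 1) ≤ 2 * J * L := by
      calc J * (L + 1) ≤ J * (2 * L) := Nat.mul_le_mul_left _ (by omega)
        _ = 2 * J * L := by ring
    exact_mod_cast (h4.trans_le h5).le
  have hℓ0 : 0 < ℓ := (bestDenom_pos hα σ).trans_le hqℓ
  have hΛle : 2 * (r * (2 * ℓ)) / ((J : ℝ) - 1) ≤ 16 * r * L := by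
    rw [div_le_iff₀ (by linarith)]
    have h4 : (J : ℝ) ≤ 2 * (J - 1) := by linarith
    have hrL : (0 : ℝ) ≤ r * L := by positivity
    have h5 : r * ℓ ≤ r * (2 * J * L) := by gcongr
    calc 2 * (r * (2 * ℓ)) = 4 * (r * ℓ) := by ring
      _ ≤ 4 * (r * (2 * J * L)) := by gcongr
      _ = 8 * (r * L) * J := by ring
      _ ≤ 8 * (r * L) * (2 * (J - 1)) := by gcongr
      _ = _ := by ring
  have hΛ0 : 0 < r * (2 * (ℓ : ℝ)) := by positivity
  have hV0 : 0 < 2 * E := by positivity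
  have hbE : |Γ * H * d| = |Γ| * (Δ * H) := by
    rw [abs_mul, abs_mul, abs_of_pos hH0, hd1]; ring
  have hbd : ∀ θ : UnitAddCircle,
      (∀ j < q, ∀ i, 2 * ξ ≤ ‖θ + (((j : ℝ) * α : ℝ) : UnitAddCircle) - a i‖) →
      |∑ j ∈ Finset.range q, (f (θ + (((j : ℝ) * α : ℝ) : UnitAddCircle)) -
        f (θ + (d : UnitAddCircle) + (((j : ℝ) * α : ℝ) : UnitAddCircle))) - Γ * H * d| ≤
          |Γ * H * d| / 2 ∧
      ∑ j ∈ Finset.range q, |f (θ + (((j : ℝ) * α : ℝ) : UnitAddCircle)) -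
        f (θ + (d : UnitAddCircle) + (((j : ℝ) * α : ℝ) : UnitAddCircle))| ≤ E * (Δ * H) := by
    intro θ hθ
    have h4 := hf.contDiff.block_difference (c := Γ * H) (b := |Γ| / 2 * H) (E := E * H) hξ0
      (hd1.trans_le hΔξ) (fun θ' hθ' => hblock ξ hξ0 hξq hξG θ' hθ') hθ
    rw [hbE]
    rw [hd1] at h4
    exact ⟨h4.1.trans (le_of_eq (by ring)), h4.2.trans (le_of_eq (by ring))⟩
  have h2ξ : 2 * ξ = x τ / (2 * C) := by rw [hξ]; field_simp; norm_num
  have hVE : 2 * n * (E * (Δ * H)) ≤ 2 * E := by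
    calc 2 * n * (E * (Δ * H)) = 2 * E * (n * (Δ * H)) := by ring
      _ ≤ 2 * E * 1 := by gcongr
      _ = _ := by ring
  have hc4 : 4 * (|Γ| * c₁ / 4) ≤ n * |Γ * H * d| := by
    rw [hbE]
    calc 4 * (|Γ| * c₁ / 4) = |Γ| * c₁ := by ring
      _ ≤ |Γ| * (n * (Δ * H)) := by gcongr
      _ = _ := by ring
  have hκ : ∀ M : ℕ, M + L ≤ 2 * ℓ → 1 / (4 * (J : ℝ)) * M ≤ L := by
    intro M hM
    have h4 : (M : ℝ) ≤ 2 * ℓ := by exact_mod_cast (by omega : M ≤ 2 * ℓ)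
    rw [one_div, inv_mul_le_iff₀ (by positivity)]
    linarith
  have hJε' : ∀ t : ℝ, |t| ≤ 2 * (2 * E) / ((J : ℝ) - 1) → |t| < ε := fun t ht => ht.trans_lt hJε
  have hb4 : ∀ θ : UnitAddCircle,
      (∀ j < q, ∀ i, x τ / (2 * C) ≤ ‖θ + (((j : ℝ) * α : ℝ) : UnitAddCircle) - a i‖) → _ :=
    fun θ hθ => hbd θ (by rwa [h2ξ])
  have hdw : ∀ g : ℕ → ℝ, (∀ n : ℕ, 1 ≤ n → ∑ j ∈ Finset.range n, g j ≤ r * n) →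
      ∑ j ∈ Finset.range (2 * (n * q)), g j ≤ r * (2 * ℓ) := by
    intro g hg
    have := hg (2 * ℓ) (by omega)
    push_cast at this
    exact this
  rcases hfree z (fun hτK j hj i => hz τ hτs₀ hτK j hj i) (2 * ℓ) hW with hfwd | hbwd
  · obtain ⟨M, hM1, hM2, hM3, hM4, hM5, hM6⟩ := exists_forward_window hy hb4 hfwd hwp hJ2' hJL
      hV0 hΛ0 hVE (hdw _ hwp') hc4
    exact ⟨M, L, by omega, by omega, hκ M hM2, _, hM3, hM4,
      Or.inl ⟨fun m hm1 hm2 => hJε' _ (hM5 m hm1 hm2), hM6.trans hΛle⟩⟩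
  · obtain ⟨M, hM1, hM2, hM3, hM4, hM5, hM6⟩ := exists_backward_window hy hb4 hbwd hwm hJ2' hJL
      hV0 hΛ0 hVE (hdw _ hwm') hc4
    exact ⟨M, L, by omega, by omega, hκ M hM2, _, hM3, hM4,
      Or.inr ⟨fun m hm1 hm2 => hJε' _ (hM5 m hm1 hm2), hM6.trans hΛle⟩⟩

end Core

/-! ### Rare visits and long time windows -/

section Visits

open Classical in
/-- The number of `j < m` with `o j ∈ B`. -/
noncomputable def visitCount {X : Type*} (B : Set X) (o : ℕ → X) (m : ℕ) : ℕ :=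
  ((Finset.range m).filter fun j => o j ∈ B).card

theorem visitCount_mono {X : Type*} (B : Set X) (o : ℕ → X) : Monotone (visitCount B o) := by
  classical
  intro m n hmn
  unfold visitCount
  convert Finset.card_le_card (Finset.filter_subset_filter (fun j => o j ∈ B)
    (Finset.range_mono hmn))

/-- Most points visit a set of small measure rarely, at all times. -/
theorem IsErgodicFlow.exists_rare_visits {X : Type*} [MetricSpace X] [MeasurableSpace X]
    {T : ℝ → X → X} {μ : Measure X} (hT : IsErgodicFlow T μ) {B : Set X} (hB : MeasurableSet B)
    {l η : ℝ} (hl : 0 < l) (hμB : μ B ≤ ENNReal.ofReal (l * η)) (τ : ℝ) :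
    ∃ Z : Set X, MeasurableSet Z ∧ μ Zᶜ ≤ ENNReal.ofReal η ∧
      ∀ x ∈ Z, ∀ n : ℕ, (visitCount B (fun j => T (j * τ) x) n : ℝ) ≤ l * n := by
  classical
  have hiter : ∀ (j : ℕ) (x : X), (T τ)^[j] x = T (j * τ) x := by
    intro j
    induction j with
    | zero => intro x; simp [hT.map_zero]
    | succ j ih =>
      intro x
      rw [Function.iterate_succ_apply', ih, ← hT.map_add]
      congr 1; push_cast; ring
  have hg : Measurable (B.indicator (1 : X → ℝ≥0∞)) := measurable_one.indicator hB
  have hsum : ∀ (x : X) (n : ℕ), ∑ j ∈ Finset.range n, B.indicator (1 : X → ℝ≥0∞) ((T τ)^[j] x) =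
      (visitCount B (fun j => T (j * τ) x) n : ℝ≥0∞) := by
    intro x n
    unfold visitCount
    simp only [hiter, Set.indicator_apply, Pi.one_apply, Finset.sum_boole]
  have hmax := mul_measure_exists_le_sum_le (hT.preserving τ) hg (c := ENNReal.ofReal l)
  refine ⟨{x | ∃ n : ℕ, 1 ≤ n ∧ ENNReal.ofReal l * n ≤
    ∑ j ∈ Finset.range n, B.indicator 1 ((T τ)^[j] x)}ᶜ,
    (measurableSet_exists_le_sum (hT.preserving τ).measurable hg _).compl, ?_, ?_⟩
  · rw [compl_compl]
    rw [lintegral_indicator_one hB] at hmax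
    have h1 := hmax.trans hμB
    rw [ENNReal.ofReal_mul hl.le] at h1
    exact (ENNReal.mul_le_mul_iff_right (by simpa using hl) ENNReal.ofReal_ne_top).mp h1
  · intro x hx n
    rcases Nat.eq_zero_or_pos n with rfl | hn
    · simp [visitCount]
    have h1 : ¬ ENNReal.ofReal l * n ≤ ∑ j ∈ Finset.range n, B.indicator 1 ((T τ)^[j] x) :=
      fun h => hx ⟨n, hn, h⟩
    rw [hsum, not_le, ← ENNReal.ofReal_natCast n, ← ENNReal.ofReal_mul hl.le,
      ← ENNReal.ofReal_natCast, ENNReal.ofReal_lt_ofReal_iff (by positivity)] at h1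
    exact h1.le

theorem one_sub_lt_closeFreq {X : Type*} [MetricSpace X] [MeasurableSpace X] {T : ℝ → X → X}
    {τ p ε : ℝ} {x y : X} {M L : ℕ} {B : Set X} (hε : 0 < ε) (hL : 0 < L)
    (hclose : ∀ m : ℕ, M ≤ m → m ≤ M + L → T (m * τ) x ∉ B →
      dist (T (m * τ) x) (T (m * τ + p) y) < ε)
    (hB : (visitCount B (fun j => T (j * τ) x) (M + L + 1) : ℝ) -
      visitCount B (fun j => T (j * τ) x) M ≤ ε / 2 * L) :
    1 - ε < closeFreq T τ p ε x y M L := by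
  classical
  have h1 : visitCount B (fun j => T (j * τ) x) (M + L + 1) =
      visitCount B (fun j => T (j * τ) x) M +
        ((Finset.Icc M (M + L)).filter fun m : ℕ => T (m * τ) x ∈ B).card := by
    have hI : Finset.Icc M (M + L) = Finset.Ico M (M + L + 1) := by
      ext; simp only [Finset.mem_Icc, Finset.mem_Ico]; omega
    unfold visitCount
    rw [hI, Finset.range_eq_Ico, ← Finset.Ico_union_Ico_eq_Ico (Nat.zero_le M) (by omega : M ≤ M + L + 1),
      Finset.filter_union, Finset.card_union_of_disjoint, ← Finset.range_eq_Ico]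
    exact Finset.disjoint_filter_filter (Finset.Ico_disjoint_Ico_consecutive _ _ _)
  have h2 : (Finset.Icc M (M + L)).card ≤
      ((Finset.Icc M (M + L)).filter fun m : ℕ => T (m * τ) x ∈ B).card +
      ((Finset.Icc M (M + L)).filter fun m : ℕ =>
        dist (T (m * τ) x) (T (m * τ + p) y) < ε).card := by
    refine le_trans (Finset.card_le_card fun m hm => ?_) (Finset.card_union_le _ _)
    rw [Finset.mem_union, Finset.mem_filter, Finset.mem_filter]
    by_cases hmB : T (m * τ) x ∈ B
    · exact Or.inl ⟨hm, hmB⟩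
    · have := Finset.mem_Icc.mp hm
      exact Or.inr ⟨hm, hclose m this.1 this.2 hmB⟩
  rw [Nat.card_Icc] at h2
  rw [h1] at hB
  -- The closed window contains L + 1 integers, while frequencies are divided by L.
  have h3 : ((M + L + 1 - M : ℕ) : ℝ) = L + 1 := by
    rw [Nat.add_assoc, Nat.add_sub_cancel_left]; push_cast; rfl
  have h4 := (Nat.cast_le (α := ℝ)).mpr h2
  rw [h3] at h4
  push_cast at h4 hB
  have hL' : (0 : ℝ) < L := by exact_mod_cast hL
  have h5 : 0 < ε * L := by positivity
  unfold closeFreq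
  rw [one_div, inv_mul_eq_div, lt_div_iff₀ hL']
  refine lt_of_lt_of_le (b := (L : ℝ) + 1 - ε / 2 * L) (by linarith) ?_
  convert (show (L : ℝ) + 1 - ε / 2 * L ≤ (((Finset.Icc M (M + L)).filter fun m : ℕ =>
        dist (T (m * τ) x) (T (m * τ + p) y) < ε).card : ℝ) by linarith) using 2

theorem exists_mem_Ico_of_le_of_lt {k : ℕ → ℕ} {m M L : ℕ} (h1 : k M ≤ m) (h2 : m < k (M + L)) :
    ∃ n, M ≤ n ∧ n < M + L ∧ k n ≤ m ∧ m < k (n + 1) := by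
  induction L with
  | zero => exact absurd h2 (not_lt.mpr h1)
  | succ L ih =>
    by_cases h3 : m < k (M + L)
    · obtain ⟨n, h4, h5, h6⟩ := ih h3
      exact ⟨n, h4, by omega, h6⟩
    · exact ⟨M + L, by omega, by omega, not_lt.mp h3, h2⟩

/-- A window of indices of a sequence `u` of linear growth gives a window of multiples of `t₀`. -/
theorem exists_time_window {c b D t₀ κ : ℝ} (hc : 0 < c) (hb : 0 ≤ b) (hD : 0 < D) (ht : 0 < t₀)
    (hκ : 0 < κ) (N : ℕ) :
    ∃ N' : ℕ, ∀ u : ℕ → ℝ, (∀ M L : ℕ, c * L - b ≤ u (M + L) - u M) → -D ≤ u 0 →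
      (∀ n : ℕ, 1 ≤ n → u n ≤ D * n) → ∀ M L : ℕ, N' < M → N' < L → κ * M ≤ L →
      ∃ L' : ℕ, ⌈u (M + L) / t₀⌉₊ = ⌈u M / t₀⌉₊ + L' + 1 ∧ N < ⌈u M / t₀⌉₊ ∧ N < L' ∧
        κ * c / (4 * D) * ⌈u M / t₀⌉₊ ≤ L' ∧ c * L ≤ 2 * t₀ * L' := by
  -- N₁ makes the linear growth beat the constants b, D and the rounding to multiples of t₀; N₂
  -- makes the rounding at most double the bound DM.
  obtain ⟨N₁, hN₁⟩ := exists_nat_gt ((2 * (b + 2 * t₀) + 2 * t₀ * N + D) / c)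
  obtain ⟨N₂, hN₂⟩ := exists_nat_gt (t₀ / D)
  refine ⟨max N₁ N₂, fun u hinc h0 hup M L hM hL hML => ?_⟩
  rw [div_lt_iff₀ hc] at hN₁
  rw [div_lt_iff₀ hD] at hN₂
  have hM1 : (N₁ : ℝ) ≤ M := by exact_mod_cast ((le_max_left N₁ N₂).trans hM.le)
  have hM2 : (N₂ : ℝ) ≤ M := by exact_mod_cast ((le_max_right N₁ N₂).trans hM.le)
  have hL1 : (N₁ : ℝ) ≤ L := by exact_mod_cast ((le_max_left N₁ N₂).trans hL.le)
  have hcM : (N₁ : ℝ) * c ≤ M * c := by gcongr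
  have hcL : (N₁ : ℝ) * c ≤ L * c := by gcongr
  have hDM : (N₂ : ℝ) * D ≤ M * D := by gcongr
  have htN : 0 ≤ t₀ * N := by positivity
  have hinc1 := hinc 0 M
  rw [zero_add] at hinc1
  have huM : t₀ * N < u M := by linarith
  have hinc2 := hinc M L
  have e1 : u M / t₀ ≤ ⌈u M / t₀⌉₊ := Nat.le_ceil _
  have e2 : u (M + L) / t₀ ≤ ⌈u (M + L) / t₀⌉₊ := Nat.le_ceil _
  have e3 : (⌈u M / t₀⌉₊ : ℝ) < u M / t₀ + 1 :=
    Nat.ceil_lt_add_one (div_nonneg (by linarith) ht.le)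
  set m₁ := ⌈u M / t₀⌉₊
  set m₂ := ⌈u (M + L) / t₀⌉₊
  rw [div_le_iff₀ ht] at e1 e2
  rw [← sub_lt_iff_lt_add, lt_div_iff₀ ht] at e3
  have e4 : c * L ≤ 2 * t₀ * ((m₂ : ℝ) - m₁ - 1) := by linarith
  have e5 : (m₁ : ℝ) + 1 < m₂ := by
    have : 0 < t₀ * ((m₂ : ℝ) - m₁ - 1) := by linarith
    have := pos_of_mul_pos_right this ht.le
    linarith
  have e6 : m₁ + 1 < m₂ := by exact_mod_cast e5
  have e7 : ((m₂ - m₁ - 1 : ℕ) : ℝ) = m₂ - m₁ - 1 := by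
    rw [Nat.cast_sub (by omega), Nat.cast_sub (by omega)]; simp
  refine ⟨m₂ - m₁ - 1, by omega, ?_, ?_, ?_, ?_⟩
  · have : t₀ * N < t₀ * m₁ := by linarith
    exact_mod_cast lt_of_mul_lt_mul_left this ht.le
  · rw [← Nat.cast_lt (α := ℝ), e7]
    refine lt_of_mul_lt_mul_left (a := 2 * t₀) ?_ (by positivity)
    linarith
  · rw [e7]
    have h1 : 1 ≤ M := by omega
    have h2 : t₀ * m₁ ≤ 2 * D * M := by linarith [hup M h1]
    refine le_of_mul_le_mul_left (a := 2 * t₀) ?_ (by positivity)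
    calc 2 * t₀ * (κ * c / (4 * D) * m₁) = κ * c / (2 * D) * (t₀ * m₁) := by field_simp; norm_num
      _ ≤ κ * c / (2 * D) * (2 * D * M) := by gcongr
      _ = c * (κ * M) := by field_simp
      _ ≤ c * L := by gcongr
      _ ≤ _ := e4
  · rw [e7]; exact e4

/-- Closeness along a window of indices of `u`, except at rare times, gives closeness with large
frequency along a window of times. -/
theorem exists_closeFreq_window {X : Type*} [MetricSpace X] [MeasurableSpace X] {T : ℝ → X → X}
    {c b D t₀ κ ε : ℝ} (hc : 0 < c) (hb : 0 ≤ b) (hD : 0 < D) (ht : 0 < t₀) (hκ : 0 < κ)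
    (hε : 0 < ε) (N : ℕ) :
    ∃ N' : ℕ, ∀ u : ℕ → ℝ, (∀ M L : ℕ, c * L - b ≤ u (M + L) - u M) → -D ≤ u 0 →
      (∀ n : ℕ, 1 ≤ n → u n ≤ D * n) → ∀ (B : Set X) (x y : X) (τ p : ℝ) (M L : ℕ),
      N' < M → N' < L → κ * M ≤ L →
      (visitCount B (fun j => T (j * τ) x) ⌈u (M + L) / t₀⌉₊ : ℝ) -
        visitCount B (fun j => T (j * τ) x) ⌈u M / t₀⌉₊ ≤ ε * c / (4 * t₀) * L →
      (∀ n m : ℕ, M ≤ n → n < M + L → u n ≤ m * t₀ → m * t₀ < u (n + 1) → T (m * τ) x ∉ B →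
        dist (T (m * τ) x) (T (m * τ + p) y) < ε) →
      ∃ M' L' : ℕ, N < M' ∧ N < L' ∧ κ * c / (4 * D) ≤ (L' : ℝ) / M' ∧
        1 - ε < closeFreq T τ p ε x y M' L' := by
  obtain ⟨N', hN'⟩ := exists_time_window hc hb hD ht hκ N
  refine ⟨N', fun u hinc h0 hup B x y τ p M L hM hL hML hvis hclose => ?_⟩
  obtain ⟨L', h1, h2, h3, h4, h5⟩ := hN' u hinc h0 hup M L hM hL hML
  refine ⟨⌈u M / t₀⌉₊, L', h2, h3, ?_, one_sub_lt_closeFreq (B := B) hε (by omega)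
    (fun m hm1 hm2 hmB => ?_) ?_⟩
  · rwa [le_div_iff₀ (by exact_mod_cast (Nat.zero_le N).trans_lt h2)]
  · obtain ⟨n, e1, e2, e3, e4⟩ := exists_mem_Ico_of_le_of_lt (k := fun n => ⌈u n / t₀⌉₊) hm1
      (by rw [h1]; omega : m < ⌈u (M + L) / t₀⌉₊)
    refine hclose n m e1 e2 ?_ ?_ hmB
    · rwa [Nat.ceil_le, div_le_iff₀ ht] at e3
    · rwa [Nat.lt_ceil, lt_div_iff₀ ht] at e4
  · rw [h1] at hvis
    refine hvis.trans ?_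
    calc ε * c / (4 * t₀) * L = ε / (4 * t₀) * (c * L) := by ring
      _ ≤ ε / (4 * t₀) * (2 * t₀ * L') := by gcongr
      _ = _ := by field_simp; norm_num

end Visits

/-! ### Closeness of two orbits of the special flow. -/

section Closeness

variable {X : Type*} {T : Equiv.Perm X} {f : X → ℝ}

/-- The points of `X^f` at height less than `2ε` above the bottom or below the top. -/
def nearBoundary (f : X → ℝ) (ε : ℝ) : Set (SpecialSpace f) :=
  {p | p.height < 2 * ε ∨ f p.base - 2 * ε < p.height}

/-- Compensating the drift leaves a height discrepancy below 2ε: ε from the initial heights and ε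
from the drift. A point at least 2ε from both ends of its fibre therefore forces the other point to
have the same index, which is why the drift is controlled at n and at n + 1. -/
theorem dist_specialFlow_lt [MetricSpace X] (hf : ∀ x, 0 < f x)
    (hiso : ∀ (n : ℤ) x y, dist ((T ^ n) x) ((T ^ n) y) = dist x y)
    {p q : SpecialSpace f} {t D ε : ℝ} {n : ℤ}
    (h1 : birkhoffCocycle T f n p.base ≤ t + p.height)
    (h2 : t + p.height < birkhoffCocycle T f (n + 1) p.base)
    (hp : specialFlow T f t p ∉ nearBoundary f ε) (hpq : dist p q < ε)
    (hD : |birkhoffCocycle T f n p.base - birkhoffCocycle T f n q.base - D| < ε)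
    (hD' : |birkhoffCocycle T f (n + 1) p.base - birkhoffCocycle T f (n + 1) q.base - D| < ε) :
    dist (specialFlow T f t p) (specialFlow T f (t + -D) q) < 4 * ε := by
  obtain ⟨e1, e2⟩ := specialFlow_eq hf h1 h2
  have hpq' : dist p.base q.base + |p.height - q.height| < ε := hpq
  have hd0 : 0 ≤ dist p.base q.base := dist_nonneg
  have ha0 : 0 ≤ |p.height - q.height| := abs_nonneg _
  have hab : |p.height - q.height| < ε := by linarith
  simp only [nearBoundary, mem_ofPred_eq, not_or, not_lt] at hp
  rw [e1, e2] at hp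
  have hadd := birkhoffCocycle_add_one T f n p.base
  rw [abs_lt] at hD hD' hab
  obtain ⟨d1, d2⟩ := specialFlow_eq (T := T) hf (t := t + -D) (p := q) (n := n)
    (by linarith) (by linarith)
  change dist (specialFlow T f t p).base (specialFlow T f (t + -D) q).base +
    |(specialFlow T f t p).height - (specialFlow T f (t + -D) q).height| < 4 * ε
  rw [e1, e2, d1, d2, hiso]
  have : |t + p.height - birkhoffCocycle T f n p.base -
      (t + -D + q.height - birkhoffCocycle T f n q.base)| < 2 * ε := by
    rw [abs_lt]; constructor <;> linarith
  linarith

/-- Guarantees that points on different orbits have different base points, as the drift argument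
requires. -/
theorem eq_specialFlow_of_base_eq (hf : ∀ x, 0 < f x) {p q : SpecialSpace f}
    (h : p.base = q.base) : p = specialFlow T f (p.height - q.height) q := by
  have h0 := p.height_nonneg
  have h1 := p.height_lt
  obtain ⟨e1, e2⟩ := specialFlow_eq (T := T) (n := 0) (t := p.height - q.height) (p := q) hf
    (by rw [birkhoffCocycle_zero]; linarith)
    (by rw [birkhoffCocycle_add_one, birkhoffCocycle_zero, ← h]; simpa)
  ext
  · rw [e1, h]; simp
  · rw [e2, birkhoffCocycle_zero]; ring

variable [MeasurableSpace X]

theorem measurableSet_nearBoundary (hfm : Measurable f) (ε : ℝ) :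
    MeasurableSet (nearBoundary f ε) :=
  (measurableSet_lt measurable_height measurable_const).union
    (measurableSet_lt ((hfm.comp measurable_base).sub_const _) measurable_height)

end Closeness

/-! ### Small exceptional sets in the special space. -/

section SpecialMeasure

variable {X : Type*} [MeasurableSpace X] {T : Equiv.Perm X} {f : X → ℝ} {μ : Measure X}

/-- Absolute continuity of the integral of f: f is unbounded in general, so smallness in the base is
not proportional to smallness upstairs. -/
theorem exists_pos_specialMeasure_base_lt [SFinite μ] (hfm : Measurable f)
    (h0 : specialMeasureAux μ f univ ≠ 0) (hint : ∫⁻ x, ENNReal.ofReal (f x) ∂μ ≠ ∞) {η : ℝ≥0∞}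
    (hη : η ≠ 0) : ∃ δ : ℝ≥0∞, 0 < δ ∧ ∀ E, MeasurableSet E → μ E < δ →
      specialMeasure μ f (SpecialSpace.base ⁻¹' E) ≤ η := by
  obtain ⟨δ, hδ, h⟩ := exists_pos_setLIntegral_lt_of_measure_lt hint
    (ε := specialMeasureAux μ f univ * η) (mul_ne_zero h0 hη)
  refine ⟨δ, hδ, fun E hE hμE => ?_⟩
  rw [specialMeasure, Measure.smul_apply, specialMeasureAux_base_preimage hfm μ hE, smul_eq_mul]
  rw [mul_comm, ← div_eq_mul_inv]
  refine ENNReal.div_le_of_le_mul ?_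
  rw [mul_comm]
  exact (h E hμE).le

/-- Weak maximal inequality for T and its inverse, with D large compared with the integral of f.
This gives one linear upper bound for all n ≥ 1, off a small set. -/
theorem exists_birkhoffCocycle_le [IsProbabilityMeasure μ] (hT : MeasurePreserving T μ μ)
    (hT' : MeasurePreserving T.symm μ μ) (hfm : Measurable f) (hf : ∀ x, 0 < f x)
    (hint : ∫⁻ x, ENNReal.ofReal (f x) ∂μ ≠ ∞) {δ : ℝ≥0∞} (hδ : 0 < δ) :
    ∃ (D : ℝ) (E : Set X), 0 < D ∧ MeasurableSet E ∧ μ Eᶜ < δ ∧ ∀ x ∈ E, ∀ n : ℕ, 1 ≤ n →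
      birkhoffCocycle T f n x ≤ D * n ∧ -birkhoffCocycle T f (-n) x ≤ D * n := by
  set I := ∫⁻ x, ENNReal.ofReal (f x) ∂μ with hI
  obtain ⟨D, hD0, hD⟩ : ∃ D : ℝ, 0 < D ∧ 2 * I < ENNReal.ofReal D * δ := by
    have h2I : 2 * I ≠ ∞ := ENNReal.mul_ne_top (by simp) hint
    obtain ⟨n, hn⟩ := ENNReal.exists_nat_mul_gt hδ.ne' h2I
    refine ⟨n, ?_, by rwa [ENNReal.ofReal_natCast]⟩
    rcases Nat.eq_zero_or_pos n with rfl | h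
    · simp at hn
    · exact_mod_cast h
  have hg : Measurable fun x => ENNReal.ofReal (f x) := hfm.ennreal_ofReal
  have hg' : Measurable fun x => ENNReal.ofReal (f (T.symm x)) :=
    (hfm.comp hT'.measurable).ennreal_ofReal
  have h1 := mul_measure_exists_le_sum_le hT hg (c := ENNReal.ofReal D)
  have h2 := mul_measure_exists_le_sum_le hT' hg' (c := ENNReal.ofReal D)
  rw [hT'.lintegral_comp hg] at h2
  set E₁ := {x | ∃ n : ℕ, 1 ≤ n ∧ ENNReal.ofReal D * n ≤
    ∑ k ∈ Finset.range n, ENNReal.ofReal (f (T^[k] x))} with hE₁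
  set E₂ := {x | ∃ n : ℕ, 1 ≤ n ∧ ENNReal.ofReal D * n ≤
    ∑ k ∈ Finset.range n, ENNReal.ofReal (f (T.symm (T.symm^[k] x)))} with hE₂
  have hm₁ : MeasurableSet E₁ := measurableSet_exists_le_sum hT.measurable hg _
  have hm₂ : MeasurableSet E₂ := measurableSet_exists_le_sum hT'.measurable hg' _
  refine ⟨D, (E₁ ∪ E₂)ᶜ, hD0, (hm₁.union hm₂).compl, ?_, fun x hx n hn => ?_⟩
  · rw [compl_compl]
    have h3 : ENNReal.ofReal D * μ (E₁ ∪ E₂) < ENNReal.ofReal D * δ := by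
      calc ENNReal.ofReal D * μ (E₁ ∪ E₂) ≤ ENNReal.ofReal D * (μ E₁ + μ E₂) := by
            gcongr; exact measure_union_le _ _
        _ ≤ I + I := by rw [mul_add]; exact add_le_add h1 h2
        _ = 2 * I := (two_mul I).symm
        _ < _ := hD
    exact lt_of_mul_lt_mul_left' h3
  · rw [mem_compl_iff, mem_union, not_or] at hx
    have h3 : ¬ ENNReal.ofReal D * n ≤ ∑ k ∈ Finset.range n, ENNReal.ofReal (f (T^[k] x)) :=
      fun h => hx.1 ⟨n, hn, h⟩
    have h4 : ¬ ENNReal.ofReal D * n ≤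
        ∑ k ∈ Finset.range n, ENNReal.ofReal (f (T.symm (T.symm^[k] x))) :=
      fun h => hx.2 ⟨n, hn, h⟩
    rw [← ENNReal.ofReal_sum_of_nonneg (fun _ _ => (hf _).le), ← ENNReal.ofReal_natCast,
      ← ENNReal.ofReal_mul hD0.le] at h3 h4
    rw [birkhoffCocycle_natCast, birkhoffCocycle_neg_natCast, neg_neg]
    refine ⟨?_, ?_⟩
    · have h5 : ∑ i ∈ Finset.range n, f ((T ^ (i : ℤ)) x) = ∑ i ∈ Finset.range n, f (T^[i] x) := by
        refine Finset.sum_congr rfl fun i _ => ?_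
        rw [zpow_natCast, Equiv.Perm.iterate_eq_pow]
      rw [h5]
      exact le_of_not_ge fun h => h3 (ENNReal.ofReal_le_ofReal h)
    · have h5 : ∑ i ∈ Finset.range n, f ((T ^ (-((i : ℤ) + 1))) x) =
          ∑ i ∈ Finset.range n, f (T.symm (T.symm^[i] x)) := by
        refine Finset.sum_congr rfl fun i _ => ?_
        rw [← Function.iterate_succ_apply' T.symm, Equiv.Perm.iterate_eq_pow,
          ← Equiv.Perm.inv_def, inv_pow, ← zpow_natCast, ← zpow_neg]
        push_cast; rfl
      rw [h5]
      exact le_of_not_ge fun h => h4 (ENNReal.ofReal_le_ofReal h)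

/-- As ε decreases to 0 these sets shrink into the zero section, which is null; the top of a fibre
does not belong to the space. -/
theorem exists_specialMeasure_nearBoundary_le [SFinite μ] [IsFiniteMeasure (specialMeasure μ f)]
    (hfm : Measurable f) {η : ℝ≥0∞} (hη : 0 < η) {ε₀ : ℝ} (hε₀ : 0 < ε₀) :
    ∃ ε : ℝ, 0 < ε ∧ ε ≤ ε₀ ∧ specialMeasure μ f (nearBoundary f ε) ≤ η := by
  set B : ℕ → Set (SpecialSpace f) := fun n => nearBoundary f (ε₀ / (n + 1)) with hB
  have hanti : Antitone B := by
    intro m n hmn p hp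
    have h1 : ε₀ / ((n : ℝ) + 1) ≤ ε₀ / ((m : ℝ) + 1) := by gcongr
    simp only [hB, nearBoundary, mem_ofPred_eq] at hp ⊢
    exact hp.imp (fun h => by linarith) (fun h => by linarith)
  have hinter : ⋂ n, B n ⊆ {p | p.height = 0} := by
    intro p hp
    by_contra h0
    have h1 : 0 < p.height := lt_of_le_of_ne p.height_nonneg (Ne.symm h0)
    have h2 := p.height_lt
    have hlim : Tendsto (fun n : ℕ => ε₀ / ((n : ℝ) + 1)) atTop (𝓝 0) := by
      simpa using (tendsto_one_div_add_atTop_nhds_zero_nat (𝕜 := ℝ)).const_mul ε₀ |>.congr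
        fun n => by rw [mul_one_div]
    obtain ⟨n, hn1, hn2⟩ := ((hlim.eventually_lt_const (half_pos h1)).and
      (hlim.eventually_lt_const (half_pos (sub_pos.mpr h2)))).exists
    rcases mem_iInter.mp hp n with h | h <;> linarith
  have hzero : specialMeasure μ f {p | p.height = 0} = 0 := by
    rw [specialMeasure, Measure.smul_apply, smul_eq_mul]
    refine mul_eq_zero_of_right _ (le_antisymm ?_ bot_le)
    rw [specialMeasureAux_apply hfm]
    refine (measure_mono (t := univ ×ˢ {0}) ?_).trans ?_
    · rintro _ ⟨p, hp, rfl⟩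
      exact ⟨mem_univ _, hp⟩
    · rw [Measure.prod_prod]; simp
  have hlim := tendsto_measure_iInter_atTop (μ := specialMeasure μ f) (s := B)
    (fun n => (measurableSet_nearBoundary hfm _).nullMeasurableSet) hanti
    ⟨0, measure_ne_top _ _⟩
  rw [measure_mono_null hinter hzero] at hlim
  obtain ⟨n, hn⟩ := (hlim.eventually_lt_const hη).exists
  refine ⟨ε₀ / (n + 1), by positivity, ?_, hn.le⟩
  exact div_le_self hε₀.le (by linarith [(Nat.cast_nonneg n : (0 : ℝ) ≤ n)])

end SpecialMeasure

/-! ### Measure of the set of orbits that stay away from the singularities. -/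

section FarSet

variable {k : ℕ} {a : Fin k → UnitAddCircle} {α : ℝ} {x : ℕ → ℝ} {K : Set ℕ}

theorem measurableSet_farSet (s₀ : ℕ) : MeasurableSet (farSet α a x K s₀) := by
  have : farSet α a x K s₀ = ⋂ s, ⋂ (_ : s₀ ≤ s), ⋂ (_ : s ∉ K), ⋂ j,
      ⋂ (_ : j < bestDenom α s), ⋂ i,
        {z | x s ≤ ‖z + (((j : ℝ) * α : ℝ) : UnitAddCircle) - a i‖} := by
    ext z
    simp only [farSet, mem_ofPred_eq, mem_iInter]
  rw [this]
  refine IsClosed.measurableSet ?_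
  refine isClosed_iInter fun s => isClosed_iInter fun _ => isClosed_iInter fun _ =>
    isClosed_iInter fun j => isClosed_iInter fun _ => isClosed_iInter fun i =>
    isClosed_le continuous_const (by fun_prop)

/-- Borel–Cantelli: at scale s the bad points lie in k q_s balls of radius x_s, of total measure at
most 2k q_s x_s, and the tails of the series tend to 0. -/
theorem tendsto_measure_compl_farSet (hx_pos : ∀ s, 0 < x s)
    (h2 : Summable fun s : (Kᶜ : Set ℕ) => (bestDenom α (s : ℕ) : ℝ) * x (s : ℕ)) :
    Tendsto (fun s₀ => (volume : Measure UnitAddCircle) (farSet α a x K s₀)ᶜ) atTop (𝓝 0) := by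
  classical
  set g : ℕ → ℝ := (Kᶜ : Set ℕ).indicator fun s => (bestDenom α s : ℝ) * x s with hg
  have hg0 : ∀ s, 0 ≤ g s := fun s =>
    indicator_nonneg (fun s _ => mul_nonneg (Nat.cast_nonneg _) (hx_pos s).le) s
  have hgs : Summable g := summable_subtype_iff_indicator.mp h2
  set F : ℕ → ℝ≥0∞ := fun s => ENNReal.ofReal (2 * k * g s) with hF
  have hFs : ∑' s, F s ≠ ∞ := (hgs.mul_left (2 * k : ℝ)).tsum_ofReal_ne_top
  set E : ℕ → Set UnitAddCircle := fun s => ⋃ (_ : s ∉ K), ⋃ j ∈ Finset.range (bestDenom α s),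
    ⋃ i : Fin k, Metric.closedBall (a i - (((j : ℝ) * α : ℝ) : UnitAddCircle)) (x s) with hE
  have hEF : ∀ s, volume (E s) ≤ F s := by
    intro s
    by_cases hs : s ∈ K
    · simp [hE, hs]
    have h1 : E s = ⋃ j ∈ Finset.range (bestDenom α s), ⋃ i : Fin k,
        Metric.closedBall (a i - (((j : ℝ) * α : ℝ) : UnitAddCircle)) (x s) := by
      simp [hE, hs]
    rw [h1]
    calc _ ≤ ∑ j ∈ Finset.range (bestDenom α s), volume (⋃ i : Fin k,
          Metric.closedBall (a i - (((j : ℝ) * α : ℝ) : UnitAddCircle)) (x s)) :=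
            measure_biUnion_finset_le _ _
      _ ≤ ∑ j ∈ Finset.range (bestDenom α s), ∑ i : Fin k, volume
          (Metric.closedBall (a i - (((j : ℝ) * α : ℝ) : UnitAddCircle)) (x s)) :=
            Finset.sum_le_sum fun j _ => measure_iUnion_fintype_le _ _
      _ ≤ ∑ j ∈ Finset.range (bestDenom α s), ∑ i : Fin k, ENNReal.ofReal (2 * x s) := by
            refine Finset.sum_le_sum fun j _ => Finset.sum_le_sum fun i _ => ?_
            rw [AddCircle.volume_closedBall]
            exact ENNReal.ofReal_le_ofReal (min_le_right _ _)
      _ = F s := by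
            have h3 : g s = bestDenom α s * x s := indicator_of_mem (s := Kᶜ) hs _
            have h4 := (hx_pos s).le
            simp only [Finset.sum_const, Finset.card_range, Finset.card_univ, Fintype.card_fin,
              nsmul_eq_mul, hF, h3]
            rw [← ENNReal.ofReal_natCast, ← ENNReal.ofReal_natCast,
              ← ENNReal.ofReal_mul (by positivity), ← ENNReal.ofReal_mul (by positivity)]
            congr 1; ring
  refine tendsto_of_tendsto_of_tendsto_of_le_of_le tendsto_const_nhds
    (ENNReal.tendsto_sum_nat_add F hFs) (fun _ => bot_le) fun s₀ => ?_
  refine (measure_mono (t := ⋃ s, E (s + s₀)) ?_).trans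
    ((measure_iUnion_le _).trans (ENNReal.tsum_le_tsum fun s => hEF _))
  intro z hz
  simp only [farSet, mem_compl_iff, mem_ofPred_eq, not_forall, not_le] at hz
  obtain ⟨s, hs, hsK, j, hj, i, hzi⟩ := hz
  refine mem_iUnion.mpr ⟨s - s₀, ?_⟩
  rw [Nat.sub_add_cancel hs]
  simp only [hE, mem_iUnion, Finset.mem_range, Metric.mem_closedBall, dist_eq_norm]
  exact ⟨hsK, j, hj, i, by rw [sub_sub_eq_add_sub]; exact hzi.le⟩

end FarSet

/-! ### The switchable property -/

section Sequences

/-- The weight of index j counts the visits at times between u j and u (j + 1). The sum telescopes,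
so rarity of visits in time becomes a linear bound in the index, the form required by
`exists_drift_window`. -/
theorem sum_visits_le {X : Type*} (B : Set X) (o : ℕ → X) {u : ℕ → ℝ} {l D t₀ : ℝ} (hl : 0 < l)
    (hD : 0 < D) (ht : 0 < t₀) (hup : ∀ n : ℕ, 1 ≤ n → u n ≤ D * n)
    (hvis : ∀ n : ℕ, (visitCount B o n : ℝ) ≤ l * n) {n : ℕ} (hn : 1 ≤ n) :
    ∑ j ∈ Finset.range n, ((visitCount B o ⌈u (j + 1) / t₀⌉₊ : ℝ) -
      visitCount B o ⌈u j / t₀⌉₊) ≤ l * (D / t₀ + 1) * n := by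
  rw [Finset.sum_range_sub (fun j => (visitCount B o ⌈u j / t₀⌉₊ : ℝ))]
  have h1 : (⌈u n / t₀⌉₊ : ℝ) ≤ ⌈D * n / t₀⌉₊ := by
    have := hup n hn
    exact_mod_cast Nat.ceil_mono (by gcongr)
  have h2 : (⌈D * n / t₀⌉₊ : ℝ) < D * n / t₀ + 1 := Nat.ceil_lt_add_one (by positivity)
  have h3 : (1 : ℝ) ≤ n := by exact_mod_cast hn
  calc _ ≤ (visitCount B o ⌈u n / t₀⌉₊ : ℝ) := sub_le_self _ (Nat.cast_nonneg _)
    _ ≤ l * ⌈u n / t₀⌉₊ := hvis _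
    _ ≤ l * (D * n / t₀ + n) := by gcongr; linarith
    _ = _ := by ring

variable {X : Type*} {T : Equiv.Perm X} {f : X → ℝ} {b c D : ℝ}

theorem forward_increment (hlow : ∀ (n : ℕ) x, c * n - b ≤ birkhoffCocycle T f n x) (x : X) (s : ℝ)
    (M L : ℕ) : c * L - b ≤ (birkhoffCocycle T f ((M + L : ℕ) : ℤ) x - s) -
      (birkhoffCocycle T f M x - s) := by
  have := birkhoffCocycle_add T f M L x
  have := hlow L ((T ^ (M : ℤ)) x)
  push_cast
  linarith

theorem backward_increment (hlow : ∀ (n : ℕ) x, c * n - b ≤ birkhoffCocycle T f n x) (x : X)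
    (s : ℝ) (M L : ℕ) : c * L - b ≤ (s - birkhoffCocycle T f (-((M + L : ℕ) : ℤ)) x) -
      (s - birkhoffCocycle T f (-(M : ℤ)) x) := by
  have h1 := birkhoffCocycle_add T f (-((M + L : ℕ) : ℤ)) L x
  have := hlow L ((T ^ (-((M + L : ℕ) : ℤ))) x)
  rw [show -((M + L : ℕ) : ℤ) + L = -(M : ℤ) by push_cast; ring] at h1
  linarith

theorem height_lt_of_birkhoffCocycle_le {p : SpecialSpace f}
    (hD : ∀ n : ℕ, 1 ≤ n → birkhoffCocycle T f n p.base ≤ D * n) : p.height < D := by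
  have h1 := hD 1 le_rfl
  have h2 := birkhoffCocycle_add_one T f 0 p.base
  rw [birkhoffCocycle_zero] at h2
  simp only [zpow_zero, Equiv.Perm.coe_one, id, zero_add] at h2
  simp only [Nat.cast_one, mul_one] at h1
  linarith [p.height_lt]

end Sequences

section Main

variable {k : ℕ} {a : Fin k → UnitAddCircle} {f : UnitAddCircle → ℝ} {α : ℝ} {x : ℕ → ℝ}
  {K : Set ℕ}

theorem isProbabilityMeasure_volume_unitAddCircle :
    IsProbabilityMeasure (volume : Measure UnitAddCircle) :=
  ⟨UnitAddCircle.measure_univ⟩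

theorem dist_circleRotation_zpow (α : ℝ) (n : ℤ) (z y : UnitAddCircle) :
    dist ((circleRotation α ^ n) z) ((circleRotation α ^ n) y) = dist z y := by
  rw [circleRotation_zpow_apply, circleRotation_zpow_apply, dist_add_right]

set_option maxHeartbeats 1000000 in
/-- Drift of Birkhoff sums along long windows gives the switchable `R(t₀, P)`-property. -/
theorem switchableR_specialFlow (hα : Irrational α) (hf : IsC2Off f a) (hf_pos : ∀ z, 0 < f z)
    (hint : ∫⁻ z, ENNReal.ofReal (f z) ≠ ∞) (hx_pos : ∀ s, 0 < x s)
    (h2 : Summable fun s : (Kᶜ : Set ℕ) => (bestDenom α (s : ℕ) : ℝ) * x (s : ℕ)) {c V : ℝ}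
    (hdrift : ∀ ε : ℝ, 0 < ε → ∃ κ : ℝ, 0 < κ ∧ ∀ s₀ N : ℕ, ∃ δ : ℝ, 0 < δ ∧
      ∀ z y : UnitAddCircle, z ∈ farSet α a x K s₀ → z ≠ y → ‖z - y‖ < δ →
      ∀ (r : ℝ) (w u : ℕ → ℝ), 0 < r → (∀ j, 0 ≤ w j) → (∀ j, 0 ≤ u j) →
        (∀ n : ℕ, 1 ≤ n → ∑ j ∈ Finset.range n, w j ≤ r * n) →
        (∀ n : ℕ, 1 ≤ n → ∑ j ∈ Finset.range n, u j ≤ r * n) →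
        ∃ M L : ℕ, N < M ∧ N < L ∧ κ * M ≤ L ∧ ∃ p : ℝ, c ≤ |p| ∧ |p| ≤ V ∧
          (((∀ n : ℕ, M ≤ n → n ≤ M + L → |birkhoffCocycle (circleRotation α) f n z -
              birkhoffCocycle (circleRotation α) f n y - p| < ε) ∧
            ∑ j ∈ Finset.range (M + L), w j - ∑ j ∈ Finset.range M, w j ≤ 16 * r * L) ∨
          ((∀ n : ℕ, M ≤ n → n ≤ M + L → |birkhoffCocycle (circleRotation α) f (-n) z -
              birkhoffCocycle (circleRotation α) f (-n) y - p| < ε) ∧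
            ∑ j ∈ Finset.range (M + L), u j - ∑ j ∈ Finset.range M, u j ≤ 16 * r * L)))
    {t₀ : ℝ} (ht : 0 < t₀) :
    SwitchableR (specialFlow (circleRotation α) f) (specialMeasure volume f) t₀
      {p | c ≤ |p| ∧ |p| ≤ V} := by
  have := isProbabilityMeasure_volume_unitAddCircle
  have hfm := hf.measurable
  have hu := hf.birkhoffUnbounded hα hf_pos
  have hTm := measurePreserving_circleRotation α
  have hTm' := measurePreserving_circleRotation_symm α
  have hflow := isErgodicFlow_specialFlow hTm hTm' (preErgodic_circleRotation hα) hfm hf_pos hint hu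
  have := hflow.prob
  have haux : specialMeasureAux volume f univ ≠ 0 := by
    intro h0
    have h1 := measure_univ (μ := specialMeasure volume f)
    rw [specialMeasure, Measure.smul_apply, h0] at h1
    simp at h1
  obtain ⟨cl, b, hcl, hb, hlow⟩ := hf.exists_linear_growth hα hf_pos
  intro ε hε
  have hε8 : ENNReal.ofReal (ε / 8) ≠ 0 := by simpa using hε
  obtain ⟨δ₁, hδ₁, hbase⟩ := exists_pos_specialMeasure_base_lt hfm haux hint hε8
  obtain ⟨D, E, hD, hE, hμE, hDE⟩ := exists_birkhoffCocycle_le hTm hTm' hfm hf_pos hint hδ₁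
  -- Chosen so that the share 16 r L of visits granted by the drift window, with r = l(2D/t₀ + 1),
  -- is exactly the tolerance of `exists_closeFreq_window`.
  set l := ε * cl / (64 * (2 * D + t₀)) with hl
  have hl0 : 0 < l := by positivity
  -- The maximal inequality divides this measure by l, leaving ε/8 for each time direction; ε₁ ≤ ε/4
  -- absorbs the factor 4 of `dist_specialFlow_lt`.
  obtain ⟨ε₁, hε₁, hε₁4, hμB⟩ := exists_specialMeasure_nearBoundary_le (μ := volume) hfm
    (η := ENNReal.ofReal (l * (ε / 8))) (by rw [ENNReal.ofReal_pos]; positivity)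
    (show 0 < ε / 4 by positivity)
  set B := nearBoundary f ε₁ with hB
  have hBm : MeasurableSet B := measurableSet_nearBoundary hfm ε₁
  obtain ⟨κ, hκ, hdrift⟩ := hdrift ε₁ hε₁
  refine ⟨κ * cl / (4 * (2 * D)), by positivity, fun N => ?_⟩
  obtain ⟨N', hN'⟩ := exists_closeFreq_window (X := SpecialSpace f)
    (T := specialFlow (circleRotation α) f) hcl hb (show 0 < 2 * D by positivity) ht hκ hε N
  obtain ⟨s₀, hs₀⟩ := ((tendsto_measure_compl_farSet (a := a) hx_pos h2).eventually_lt_const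
    hδ₁).exists
  obtain ⟨δ, hδ, hdrift⟩ := hdrift s₀ N'
  obtain ⟨Z₁, hZ₁m, hZ₁μ, hZ₁⟩ := hflow.exists_rare_visits hBm hl0 hμB t₀
  obtain ⟨Z₂, hZ₂m, hZ₂μ, hZ₂⟩ := hflow.exists_rare_visits hBm hl0 hμB (-t₀)
  have hFm := measurableSet_farSet (α := α) (a := a) (x := x) (K := K) s₀
  set Z : Set (SpecialSpace f) := (SpecialSpace.base ⁻¹' E ∩
    SpecialSpace.base ⁻¹' (farSet α a x K s₀)) ∩ (Z₁ ∩ Z₂) with hZ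
  have hZm : MeasurableSet Z :=
    ((measurable_base hE).inter (measurable_base hFm)).inter (hZ₁m.inter hZ₂m)
  refine ⟨min δ ε₁, lt_min hδ hε₁, Z, hZm, ?_, ?_⟩
  · have h1 : specialMeasure volume f Zᶜ ≤ ENNReal.ofReal (ε / 2) := by
      rw [hZ, compl_inter, compl_inter, compl_inter]
      calc _ ≤ (specialMeasure volume f (SpecialSpace.base ⁻¹' Eᶜ) +
            specialMeasure volume f (SpecialSpace.base ⁻¹' (farSet α a x K s₀)ᶜ)) +
            (specialMeasure volume f Z₁ᶜ + specialMeasure volume f Z₂ᶜ) :=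
            (measure_union_le _ _).trans
              (add_le_add (measure_union_le _ _) (measure_union_le _ _))
        _ ≤ (ENNReal.ofReal (ε / 8) + ENNReal.ofReal (ε / 8)) +
            (ENNReal.ofReal (ε / 8) + ENNReal.ofReal (ε / 8)) :=
            add_le_add (add_le_add (hbase _ hE.compl hμE) (hbase _ hFm.compl hs₀))
              (add_le_add hZ₁μ hZ₂μ)
        _ = ENNReal.ofReal (ε / 2) := by
            rw [← ENNReal.ofReal_add (by positivity) (by positivity),
              ← ENNReal.ofReal_add (by positivity) (by positivity)]
            congr 1; ring
    have h3 : (specialMeasure volume f).real Zᶜ ≤ ε / 2 :=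
      ENNReal.toReal_le_of_le_ofReal (by positivity) h1
    rw [probReal_compl_eq_one_sub hZm] at h3
    linarith
  intro p hp q _ hpq horb
  have hne : p.base ≠ q.base := fun h => horb _ (eq_specialFlow_of_base_eq hf_pos h)
  have hpqε : dist p q < ε₁ := hpq.trans_le (min_le_right _ _)
  have hnorm : ‖p.base - q.base‖ < δ := by
    rw [← dist_eq_norm]
    have h1 : dist p q = dist p.base q.base + |p.height - q.height| := rfl
    have := abs_nonneg (p.height - q.height)
    have := hpq.trans_le (min_le_left _ _)
    linarith
  have hS : ∀ n : ℕ, 1 ≤ n → birkhoffCocycle (circleRotation α) f n p.base ≤ D * n :=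
    fun n hn => (hDE _ hp.1.1 n hn).1
  have hS' : ∀ n : ℕ, 1 ≤ n → -birkhoffCocycle (circleRotation α) f (-n) p.base ≤ D * n :=
    fun n hn => (hDE _ hp.1.1 n hn).2
  have hpD := height_lt_of_birkhoffCocycle_le hS
  have hp0 := p.height_nonneg
  -- The times needed to reach the bottom of the fibre of index n forwards (`up`), and of index −n
  -- backwards (`um`).
  set up : ℕ → ℝ := fun n => birkhoffCocycle (circleRotation α) f n p.base - p.height with hup
  set um : ℕ → ℝ := fun n => p.height - birkhoffCocycle (circleRotation α) f (-n) p.base with hum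
  have hmono := strictMono_birkhoffCocycle (T := circleRotation α) hf_pos p.base
  have hup_mono : Monotone up := fun m n hmn =>
    sub_le_sub_right (hmono.monotone (by exact_mod_cast hmn)) _
  have hum_mono : Monotone um := fun m n hmn =>
    sub_le_sub_left (hmono.monotone (by simpa using hmn)) _
  have hupD : ∀ n : ℕ, 1 ≤ n → up n ≤ 2 * D * n := by
    intro n hn
    have h3 : 0 ≤ D * n := by positivity
    have := hS n hn
    simp only [hup]
    linarith
  have humD : ∀ n : ℕ, 1 ≤ n → um n ≤ 2 * D * n := by
    intro n hn
    have h3 : D * 1 ≤ D * n := by gcongr; exact_mod_cast hn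
    have := hS' n hn
    simp only [hum]
    linarith
  have hup0 : -(2 * D) ≤ up 0 := by
    simp only [hup, Nat.cast_zero, birkhoffCocycle_zero]; linarith
  have hum0 : -(2 * D) ≤ um 0 := by
    simp only [hum, Nat.cast_zero, neg_zero, birkhoffCocycle_zero]; linarith
  set op : ℕ → SpecialSpace f := fun j => specialFlow (circleRotation α) f (j * t₀) p with hop
  set om : ℕ → SpecialSpace f := fun j => specialFlow (circleRotation α) f (j * -t₀) p with hom
  have hnn : ∀ (o : ℕ → SpecialSpace f) (u : ℕ → ℝ), Monotone u → ∀ j : ℕ,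
      (0 : ℝ) ≤ (visitCount B o ⌈u (j + 1) / t₀⌉₊ : ℝ) - visitCount B o ⌈u j / t₀⌉₊ := by
    intro o u hu j
    rw [sub_nonneg, Nat.cast_le]
    have := hu (Nat.le_succ j)
    exact visitCount_mono B o (Nat.ceil_mono (by gcongr))
  have h16 : 16 * (l * (2 * D / t₀ + 1)) = ε * cl / (4 * t₀) := by
    rw [hl]; field_simp; norm_num
  obtain ⟨M, L, hM, hL, hML, P, hP1, hP2, hcase⟩ := hdrift p.base q.base hp.1.2 hne hnorm
    (l * (2 * D / t₀ + 1)) _ _ (by positivity) (hnn op up hup_mono) (hnn om um hum_mono)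
    (fun n hn => sum_visits_le B op hl0 (by positivity) ht hupD (hZ₁ p hp.2.1) hn)
    (fun n hn => sum_visits_le B om hl0 (by positivity) ht humD (hZ₂ p hp.2.2) hn)
  have hPm : -P ∈ {p : ℝ | c ≤ |p| ∧ |p| ≤ V} := by
    rw [mem_ofPred_eq, abs_neg]; exact ⟨hP1, hP2⟩
  have hiso := dist_circleRotation_zpow α
  rcases hcase with ⟨hfw, hvis⟩ | ⟨hbw, hvis⟩
  · rw [Finset.sum_range_sub (fun j => (visitCount B op ⌈up j / t₀⌉₊ : ℝ)),
      Finset.sum_range_sub (fun j => (visitCount B op ⌈up j / t₀⌉₊ : ℝ)), sub_sub_sub_cancel_right,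
      h16] at hvis
    obtain ⟨M', L', h4, h5, h6, h7⟩ := hN' up (forward_increment hlow p.base p.height) hup0 hupD
      B p q t₀ (-P) M L hM hL hML hvis (fun n m hn1 hn2 hm1 hm2 hmB => by
        refine (dist_specialFlow_lt (n := n) hf_pos hiso ?_ ?_ hmB hpqε
          (hfw n hn1 hn2.le) ?_).trans_le (by linarith)
        · simp only [hup] at hm1; linarith
        · simp only [hup, Nat.cast_add, Nat.cast_one] at hm2; linarith
        · exact_mod_cast hfw (n + 1) (by omega) (by omega))
    exact ⟨M', L', h4, h5, h6, -P, hPm, Or.inl h7⟩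
  · rw [Finset.sum_range_sub (fun j => (visitCount B om ⌈um j / t₀⌉₊ : ℝ)),
      Finset.sum_range_sub (fun j => (visitCount B om ⌈um j / t₀⌉₊ : ℝ)), sub_sub_sub_cancel_right,
      h16] at hvis
    obtain ⟨M', L', h4, h5, h6, h7⟩ := hN' um (backward_increment hlow p.base p.height) hum0 humD
      B p q (-t₀) (-P) M L hM hL hML hvis (fun n m hn1 hn2 hm1 hm2 hmB => by
        simp only [hum] at hm1 hm2
        have e1 : -((n + 1 : ℕ) : ℤ) + 1 = -(n : ℤ) := by push_cast; ring
        -- Backward time reverses the half-open intervals, so the right end could be attained. That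
        -- would put the flow point at height 0, in the excluded set near the boundary.
        have hlt : (m : ℝ) * -t₀ + p.height <
            birkhoffCocycle (circleRotation α) f (-(n : ℤ)) p.base := by
          refine lt_of_le_of_ne (by linarith) fun heq => hmB ?_
          obtain ⟨-, e2⟩ := specialFlow_eq (n := -(n : ℤ)) hf_pos heq.ge
            (heq.trans_lt (hmono (by omega)))
          refine Or.inl ?_
          rw [e2]
          linarith
        refine (dist_specialFlow_lt (n := -((n + 1 : ℕ) : ℤ)) hf_pos hiso (by linarith)
          (by rwa [e1]) hmB hpqε (hbw (n + 1) (by omega) (by omega)) ?_).trans_le (by linarith)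
        rw [e1]
        exact hbw n hn1 hn2.le)
    exact ⟨M', L', h4, h5, h6, -P, hPm, Or.inr h7⟩

end Main

theorem theorem1p5 (α : ℝ) (hα : Irrational α) (k : ℕ) (a : Fin k → UnitAddCircle)
    (h : ℝ → ℝ) (A B : Fin k → ℝ) (f : UnitAddCircle → ℝ)
    -- `f` is a ceiling function: positive (with an arbitrary positive value at each `a i`) and
    -- integrable
    (hf_pos : ∀ x, 0 < f x) (hf_int : Integrable f volume)
    (hf : HasSingularitiesOfType f a h A B)
    (C : ℝ) (hC : 1 < C) (hbad : BadlyApproximableBy α a C)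
    (hAB : ∑ i, A i ≠ ∑ i, B i)
    (m₀ : ℝ) (hm₀ : 0 < m₀) (x : ℕ → ℝ)
    (hx_pos : ∀ s, 0 < x s) (hx_lt : ∀ s, x s < 1 / (bestDenom α s : ℝ))
    (h1a : Tendsto (fun s : ℕ => deriv h (x s / (4 * C)) /
      ((bestDenom α s : ℝ) * h (1 / (2 * (bestDenom α s : ℝ))))) atTop (𝓝 0))
    (h1b : Tendsto (fun s : ℕ => x s * (bestDenom α s : ℝ) *
      h (1 / (2 * (bestDenom α s : ℝ)))) atTop atTop)
    (K : Set ℕ) (hK : K = {s : ℕ | (bestDenom α (s + 1) : ℝ) < 1 / x s})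
    (h2 : Summable fun s : (Kᶜ : Set ℕ) => (bestDenom α (s : ℕ) : ℝ) * x (s : ℕ))
    (h3 : ∀ s : ℕ, m₀ < h (1 / (2 * (bestDenom α s : ℝ))) /
      h (1 / (2 * (bestDenom α (s + 1) : ℝ)))) :
    HasSWR (specialFlow (circleRotation α) f) (specialMeasure volume f) := by
  have hint : ∫⁻ z, ENNReal.ofReal (f z) ≠ ∞ := by
    exact ((hasFiniteIntegral_iff_ofReal (Eventually.of_forall fun z => (hf_pos z).le)).mp
      hf_int.hasFiniteIntegral).ne
  have := isProbabilityMeasure_volume_unitAddCircle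
  have h1b' : Tendsto (fun s : ℕ => x s * profileScale α h s) atTop atTop := by
    simpa only [profileScale, profileHeight, mul_assoc] using h1b
  obtain ⟨c, V, hc, hdrift⟩ := hf.exists_drift_window hα hC hbad hAB hm₀ hx_pos hx_lt h1a h1b'
    hK h2 h3
  refine ⟨isErgodicFlow_specialFlow (measurePreserving_circleRotation α)
    (measurePreserving_circleRotation_symm α) (preErgodic_circleRotation hα)
    hf.contDiff.measurable hf_pos hint (hf.contDiff.birkhoffUnbounded hα hf_pos),
    {p | c ≤ |p| ∧ |p| ≤ V}, ?_, ?_, fun hcount => ?_⟩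
  · refine Metric.isCompact_of_isClosed_isBounded
      ((isClosed_le continuous_const continuous_abs).inter
        (isClosed_le continuous_abs continuous_const)) ?_
    refine (Metric.isBounded_closedBall (x := (0 : ℝ)) (r := V)).subset fun p hp => ?_
    rw [Metric.mem_closedBall, Real.dist_0_eq_abs]
    exact hp.2
  · rintro ⟨h0, -⟩
    rw [abs_zero] at h0
    exact absurd h0 (not_le.mpr hc)
  -- Every t₀ > 0 works with the same P, and a half-line is not Lebesgue-null, hence not countable.
  · have hsub : Ioi (0 : ℝ) ⊆ {t₀ : ℝ | 0 < t₀ ∧ SwitchableR (specialFlow (circleRotation α) f)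
        (specialMeasure volume f) t₀ {p | c ≤ |p| ∧ |p| ≤ V}} := fun t ht =>
      ⟨ht, switchableR_specialFlow hα hf.contDiff hf_pos hint hx_pos h2 hdrift ht⟩
    have h0 := (hcount.mono hsub).measure_zero volume
    simp at h0
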